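/- Let $\lambda>0$, $\mathbb R_+=(0,\infty)$, $dm_\lambda(x)=x^{2\lambda}\,dx$, $\mu_\lambda=m_\lambda\times m_\lambda$ on $\mathbb R_+\times\mathbb R_+$, and write $\mathbb R_\lambda=(\mathbb R_+\times\mathbb R_+,\mu_\lambda)$. A rectangle is a set $R=I(x_1,t_1)\times I(x_2,t_2)$ with $x_i,t_i>0$ and $I(x,t)=(x-t,x+t)\cap\mathbb R_+$. Functions are complex valued. The space $\mathrm{bmo}(\mathbb R_\lambda)$ consists of the $b\in L^1_{loc}(\mathbb R_\lambda)$ with $$\|b\|_{\mathrm{bmo}}=\sup_R\frac1{\mu_\lambda(R)}\iint_R|b-m_R(b)|\,d\mu_\lambda<\infty,\qquad m_R(b)=\frac1{\mu_\lambda(R)}\iint_R b\,d\mu_\lambda,$$ the supremum being over all rectangles $R$. For $q\in(1,\infty]$, a $q$-atom is a function $a\in L^q(\mathbb R_\lambda)$ vanishing outside a rectangle $R$, with $\|a\|_{L^q}\le\mu_\lambda(R)^{1/q-1}$ and $\int a\,d\mu_\lambda=0$. The little Hardy space $h^{1,q}(\mathbb R_\lambda)$ consists of the functions $f=\sum_i\alpha_ia_i$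 (convergence in $L^1(\mathbb R_\lambda)$) with $q$-atoms $a_i$ and $\alpha_i\in\mathbb C$, $\sum_i|\alpha_i|<\infty$; its norm $\|f\|_{h^{1,q}}$ is the infimum of $\sum_i|\alpha_i|$ over all such representations. Theorem. For every $\lambda>0$ and $q\in(1,\infty]$, the space $h^{1,q}(\mathbb R_\lambda)$ is a Banach space and its dual is $\mathrm{bmo}(\mathbb R_\lambda)$ modulo constants, with equivalent norms. Precisely, there are a linear map $\Phi$ from $\mathrm{bmo}(\mathbb R_\lambda)$ to the dual $(h^{1,q}(\mathbb R_\lambda))^*$ and a constant $C>0$ depending only on $\lambda$ and $q$ such that: (a) for every $b\in\mathrm{bmo}(\mathbb R_\lambda)$ and every finite linear combination $f$ of $q$-atoms, $bf$ is integrable and $\Phi(b)(f)=\int bf\,d\mu_\lambda$; (b) $\Phi$ is surjective; (c) $\Phi(b)=0$ if and only if $b$ is almost everywhere equal to a constant; (d) $C^{-1}\|b\|_{\mathrm{bmo}}\le\|\Phi(b)\|\le C\|b\|_{\mathrm{bmo}}$ for every $b\in\mathrm{bmo}(\mathbb R_\lambda)$. -/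

import Mathlib

open MeasureTheory Set
open scoped ENNReal

noncomputable section

namespace Bessel

/-- The measure `dm_λ(x) = x ^ (2λ) dx` on `ℝ₊ = (0, ∞)`, as a measure on `ℝ` that does not
charge the complement of `(0, ∞)`. -/
def lineMeasure (lam : ℝ) : Measure ℝ :=
  (volume.restrict (Ioi 0)).withDensity fun x => ENNReal.ofReal (x ^ (2 * lam))

/-- The product measure `μ_λ = m_λ × m_λ` on `ℝ₊ × ℝ₊`. -/
def planeMeasure (lam : ℝ) : Measure (ℝ × ℝ) :=
  (lineMeasure lam).prod (lineMeasure lam)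

/-- The open quadrant `ℝ₊ × ℝ₊`. -/
def quadrant : Set (ℝ × ℝ) := Ioi 0 ×ˢ Ioi 0

/-- The interval `I(x, t) = (x - t, x + t) ∩ ℝ₊`. -/
def interval (x t : ℝ) : Set ℝ := Ioo (x - t) (x + t) ∩ Ioi 0

/-- Rectangles `I(x₁, t₁) × I(x₂, t₂)` in `ℝ₊ × ℝ₊`. -/
def IsRectangle (R : Set (ℝ × ℝ)) : Prop :=
  ∃ x₁ t₁ x₂ t₂ : ℝ, 0 < x₁ ∧ 0 < t₁ ∧ 0 < x₂ ∧ 0 < t₂ ∧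
    R = interval x₁ t₁ ×ˢ interval x₂ t₂

theorem IsRectangle.measurableSet {R : Set (ℝ × ℝ)} (hR : IsRectangle R) : MeasurableSet R := by
  obtain ⟨x₁, t₁, x₂, t₂, -, -, -, -, rfl⟩ := hR
  exact (measurableSet_Ioo.inter measurableSet_Ioi).prod
    (measurableSet_Ioo.inter measurableSet_Ioi)

theorem exists_isRectangle : ∃ R, IsRectangle R :=
  ⟨_, 1, 1, 1, 1, one_pos, one_pos, one_pos, one_pos, rfl⟩

/-! ### The little bmo space -/

/-- The mean oscillation `μ_λ(R)⁻¹ ∬_R |b - m_R(b)| dμ_λ`, with values in `[0, ∞]`; here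
`m_R(b)` is the mean value of `b` over `R`. -/
def meanOsc (lam : ℝ) (b : ℝ × ℝ → ℂ) (R : Set (ℝ × ℝ)) : ℝ≥0∞ :=
  (planeMeasure lam R)⁻¹ *
    ∫⁻ x in R, ‖b x - ⨍ y in R, b y ∂(planeMeasure lam)‖ₑ ∂(planeMeasure lam)

/-- The supremum of the mean oscillations of `b` over all rectangles. If `b` is locally
integrable but not integrable over some rectangle touching the axes, this is `∞`. -/
def bmoNorm (lam : ℝ) (b : ℝ × ℝ → ℂ) : ℝ≥0∞ :=
  ⨆ (R : Set (ℝ × ℝ)) (_ : IsRectangle R), meanOsc lam b R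

/-- `b ∈ L¹_loc(ℝ_λ)` with finite bmo norm. -/
def MemBMO (lam : ℝ) (b : ℝ × ℝ → ℂ) : Prop :=
  LocallyIntegrableOn b quadrant (planeMeasure lam) ∧ bmoNorm lam b < ∞

theorem meanOsc_le_bmoNorm (lam : ℝ) (b : ℝ × ℝ → ℂ) {R : Set (ℝ × ℝ)} (hR : IsRectangle R) :
    meanOsc lam b R ≤ bmoNorm lam b :=
  le_iSup₂_of_le R hR le_rfl

theorem meanOsc_congr {lam : ℝ} {b c : ℝ × ℝ → ℂ} (h : b =ᵐ[planeMeasure lam] c)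
    (R : Set (ℝ × ℝ)) : meanOsc lam b R = meanOsc lam c R := by
  have h' := ae_restrict_of_ae (s := R) h
  have hm : ⨍ y in R, b y ∂(planeMeasure lam) = ⨍ y in R, c y ∂(planeMeasure lam) :=
    average_congr h'
  unfold meanOsc
  rw [hm]
  congr 1
  apply lintegral_congr_ae
  filter_upwards [h'] with x hx
  rw [hx]

theorem bmoNorm_congr {lam : ℝ} {b c : ℝ × ℝ → ℂ} (h : b =ᵐ[planeMeasure lam] c) :
    bmoNorm lam b = bmoNorm lam c := by
  unfold bmoNorm
  simp only [meanOsc_congr h]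

theorem locallyIntegrableOn_congr {lam : ℝ} {b c : ℝ × ℝ → ℂ}
    (h : b =ᵐ[planeMeasure lam] c) (hb : LocallyIntegrableOn b quadrant (planeMeasure lam)) :
    LocallyIntegrableOn c quadrant (planeMeasure lam) := fun x hx => by
  obtain ⟨s, hs, hi⟩ := hb x hx
  exact ⟨s, hs, hi.congr (ae_restrict_of_ae h)⟩

theorem memBMO_congr {lam : ℝ} {b c : ℝ × ℝ → ℂ}
    (h : b =ᵐ[planeMeasure lam] c) (hb : MemBMO lam b) : MemBMO lam c :=
  ⟨locallyIntegrableOn_congr h hb.1, bmoNorm_congr h ▸ hb.2⟩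

theorem integrableOn_of_bmoNorm {lam : ℝ} {b : ℝ × ℝ → ℂ}
    (hm : AEStronglyMeasurable b (planeMeasure lam)) (hb : bmoNorm lam b < ∞)
    {R : Set (ℝ × ℝ)} (hR : IsRectangle R) (hfin : planeMeasure lam R ≠ ∞) :
    IntegrableOn b R (planeMeasure lam) := by
  have h1 : meanOsc lam b R < ∞ := (meanOsc_le_bmoNorm lam b hR).trans_lt hb
  unfold meanOsc at h1
  have h2 : ∫⁻ x in R, ‖b x - ⨍ y in R, b y ∂(planeMeasure lam)‖ₑ ∂(planeMeasure lam) < ∞ := by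
    by_contra hcon
    rw [not_lt, top_le_iff] at hcon
    rw [hcon, ENNReal.mul_top (ENNReal.inv_ne_zero.2 hfin)] at h1
    exact lt_irrefl _ h1
  have h3 : IntegrableOn (fun x => b x - ⨍ y in R, b y ∂(planeMeasure lam)) R
      (planeMeasure lam) :=
    ⟨(hm.restrict.sub aestronglyMeasurable_const), h2⟩
  have h4 : IntegrableOn (fun _ => ⨍ y in R, b y ∂(planeMeasure lam)) R (planeMeasure lam) :=
    integrableOn_const hfin
  exact (h3.add h4).congr (Filter.Eventually.of_forall fun x => by simp)

theorem bmoNorm_add_le {lam : ℝ} {b c : ℝ × ℝ → ℂ}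
    (hbm : AEStronglyMeasurable b (planeMeasure lam))
    (hcm : AEStronglyMeasurable c (planeMeasure lam))
    (hb : bmoNorm lam b < ∞) (hc : bmoNorm lam c < ∞) :
    bmoNorm lam (b + c) ≤ bmoNorm lam b + bmoNorm lam c := by
  refine iSup₂_le fun R hR => ?_
  by_cases hfin : planeMeasure lam R = ∞
  · simp [meanOsc, hfin]
  refine le_trans ?_ (add_le_add (meanOsc_le_bmoNorm lam b hR) (meanOsc_le_bmoNorm lam c hR))
  have hbi := integrableOn_of_bmoNorm hbm hb hR hfin
  have hci := integrableOn_of_bmoNorm hcm hc hR hfin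
  have hav : ⨍ y in R, (b + c) y ∂(planeMeasure lam) =
      ⨍ y in R, b y ∂(planeMeasure lam) + ⨍ y in R, c y ∂(planeMeasure lam) := by
    rw [setAverage_eq, setAverage_eq, setAverage_eq, ← smul_add]
    congr 1
    exact integral_add hbi hci
  unfold meanOsc
  rw [hav, ← mul_add, ← lintegral_add_left']
  · gcongr with x
    rw [Pi.add_apply, add_sub_add_comm]
    exact enorm_add_le _ _
  · exact (hbm.restrict.sub aestronglyMeasurable_const).enorm

theorem bmoNorm_smul (lam : ℝ) (z : ℂ) (b : ℝ × ℝ → ℂ) :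
    bmoNorm lam (z • b) = ‖z‖ₑ * bmoNorm lam b := by
  unfold bmoNorm
  rw [ENNReal.mul_iSup]
  congr 1
  ext R
  rw [ENNReal.mul_iSup]
  congr 1
  ext hR
  have hav : ⨍ y in R, (z • b) y ∂(planeMeasure lam) =
      z • ⨍ y in R, b y ∂(planeMeasure lam) := by
    rw [setAverage_eq, setAverage_eq, smul_comm]
    congr 1
    exact integral_smul z b
  unfold meanOsc
  rw [hav, mul_left_comm]
  congr 1
  rw [← lintegral_const_mul' _ _ enorm_ne_top]
  congr 1
  ext x
  rw [Pi.smul_apply, ← smul_sub, enorm_smul]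

/-- The functions (modulo equality almost everywhere) in `bmo(ℝ_λ)`, as a linear subspace. -/
def littleBMOSubmodule (lam : ℝ) : Submodule ℂ ((ℝ × ℝ) →ₘ[planeMeasure lam] ℂ) where
  carrier := {b | MemBMO lam b}
  zero_mem' := by
    refine memBMO_congr (AEEqFun.coeFn_zero (β := ℂ)).symm ⟨?_, ?_⟩
    · intro x _
      exact ⟨univ, Filter.univ_mem, integrableOn_zero⟩
    · simpa using (bmoNorm_smul lam 0 0).trans_lt (by simp)
  add_mem' := by
    intro b c hb hc
    refine memBMO_congr (AEEqFun.coeFn_add b c).symm ⟨hb.1.add hc.1, ?_⟩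
    exact (bmoNorm_add_le b.aestronglyMeasurable c.aestronglyMeasurable hb.2 hc.2).trans_lt
      (ENNReal.add_lt_top.2 ⟨hb.2, hc.2⟩)
  smul_mem' := by
    intro z b hb
    refine memBMO_congr (AEEqFun.coeFn_smul z b).symm ⟨hb.1.smul z, ?_⟩
    rw [bmoNorm_smul]
    exact ENNReal.mul_lt_top enorm_lt_top hb.2

/-- The space `bmo(ℝ_λ)`. Its norm is only a seminorm, since constants have norm `0`. -/
def LittleBMO (lam : ℝ) : Type := ↥(littleBMOSubmodule lam)

namespace LittleBMO

instance (lam : ℝ) : AddCommGroup (LittleBMO lam) :=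
  inferInstanceAs (AddCommGroup ↥(littleBMOSubmodule lam))

instance (lam : ℝ) : Module ℂ (LittleBMO lam) :=
  inferInstanceAs (Module ℂ ↥(littleBMOSubmodule lam))

/-- The almost everywhere class underlying an element of `bmo(ℝ_λ)`. -/
def toAEEqFun {lam : ℝ} (b : LittleBMO lam) : (ℝ × ℝ) →ₘ[planeMeasure lam] ℂ :=
  Subtype.val (p := (· ∈ littleBMOSubmodule lam)) b

instance (lam : ℝ) : CoeFun (LittleBMO lam) fun _ => ℝ × ℝ → ℂ := ⟨fun b => b.toAEEqFun⟩

theorem memBMO {lam : ℝ} (b : LittleBMO lam) : MemBMO lam b :=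
  Subtype.prop (p := (· ∈ littleBMOSubmodule lam)) b

instance (lam : ℝ) : Norm (LittleBMO lam) := ⟨fun b => (bmoNorm lam b).toReal⟩

theorem norm_def {lam : ℝ} (b : LittleBMO lam) : ‖b‖ = (bmoNorm lam b).toReal := rfl

theorem core (lam : ℝ) : SeminormedSpace.Core ℂ (LittleBMO lam) where
  norm_nonneg _ := ENNReal.toReal_nonneg
  norm_smul z b := by
    have h : bmoNorm lam (z • b : LittleBMO lam) = ‖z‖ₑ * bmoNorm lam b :=
      (bmoNorm_congr (AEEqFun.coeFn_smul z b.toAEEqFun)).trans (bmoNorm_smul lam z b)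
    rw [norm_def, norm_def, h, ENNReal.toReal_mul, toReal_enorm]
  norm_triangle b c := by
    have h : bmoNorm lam (b + c : LittleBMO lam) ≤ bmoNorm lam b + bmoNorm lam c :=
      (bmoNorm_congr (AEEqFun.coeFn_add b.toAEEqFun c.toAEEqFun)).trans_le
        (bmoNorm_add_le b.toAEEqFun.aestronglyMeasurable c.toAEEqFun.aestronglyMeasurable
          b.memBMO.2 c.memBMO.2)
    rw [norm_def, norm_def, norm_def, ← ENNReal.toReal_add b.memBMO.2.ne c.memBMO.2.ne]
    exact ENNReal.toReal_mono (ENNReal.add_lt_top.2 ⟨b.memBMO.2, c.memBMO.2⟩).ne h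

instance (lam : ℝ) : SeminormedAddCommGroup (LittleBMO lam) :=
  SeminormedAddCommGroup.ofCore (core lam)

instance (lam : ℝ) : NormedSpace ℂ (LittleBMO lam) where
  norm_smul_le z b := ((core lam).norm_smul z b).le

end LittleBMO

/-! ### The little Hardy space -/

/-- A `q`-atom: a function `a ∈ L^q(ℝ_λ)` vanishing outside a rectangle `R`, with
`‖a‖_q ≤ μ_λ(R) ^ (1/q - 1)` and integral zero. Since such a function is integrable, atoms are
taken as elements of `L¹(ℝ_λ)`. -/
def IsAtom (lam : ℝ) (q : ℝ≥0∞) (a : Lp ℂ 1 (planeMeasure lam)) : Prop :=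
  MemLp a q (planeMeasure lam) ∧
  (∃ R : Set (ℝ × ℝ), IsRectangle R ∧ (∀ᵐ x ∂(planeMeasure lam), x ∉ R → a x = 0) ∧
    eLpNorm a q (planeMeasure lam) ≤ planeMeasure lam R ^ ((q⁻¹).toReal - 1)) ∧
  ∫ x, a x ∂(planeMeasure lam) = 0

theorem isAtom_zero (lam : ℝ) (q : ℝ≥0∞) : IsAtom lam q 0 := by
  have h0 : ((0 : Lp ℂ 1 (planeMeasure lam)) : ℝ × ℝ → ℂ) =ᵐ[planeMeasure lam] 0 :=
    Lp.coeFn_zero ..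
  obtain ⟨R, hR⟩ := exists_isRectangle
  refine ⟨(memLp_congr_ae h0).2 MemLp.zero, ⟨R, hR, ?_, ?_⟩, ?_⟩
  · filter_upwards [h0] with x hx _
    simpa using hx
  · rw [eLpNorm_congr_ae h0]
    simp
  · rw [integral_congr_ae h0]
    simp

theorem IsAtom.norm_le_one {lam : ℝ} {q : ℝ≥0∞} (hq : 1 < q) {a : Lp ℂ 1 (planeMeasure lam)}
    (ha : IsAtom lam q a) : ‖a‖ ≤ 1 := by
  obtain ⟨-, ⟨R, hR, hsupp, hle⟩, -⟩ := ha
  have hind : (a : ℝ × ℝ → ℂ) =ᵐ[planeMeasure lam] R.indicator a := by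
    filter_upwards [hsupp] with x hx
    by_cases hxR : x ∈ R
    · simp [hxR]
    · simp [hxR, hx hxR]
  have hres : eLpNorm a 1 (planeMeasure lam) = eLpNorm a 1 ((planeMeasure lam).restrict R) := by
    rw [eLpNorm_congr_ae hind, eLpNorm_indicator_eq_eLpNorm_restrict hR.measurableSet]
  have h1 : eLpNorm a 1 (planeMeasure lam) ≤ 1 := by
    calc eLpNorm a 1 (planeMeasure lam) = eLpNorm a 1 ((planeMeasure lam).restrict R) := hres
      _ ≤ eLpNorm a q ((planeMeasure lam).restrict R) *
          (planeMeasure lam).restrict R univ ^ (1 / (1 : ℝ≥0∞).toReal - 1 / q.toReal) :=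
        eLpNorm_le_eLpNorm_mul_rpow_measure_univ hq.le (Lp.aestronglyMeasurable a).restrict
      _ ≤ planeMeasure lam R ^ ((q⁻¹).toReal - 1) * planeMeasure lam R ^ (1 - (q⁻¹).toReal) := by
        rw [Measure.restrict_apply_univ, ENNReal.toReal_inv]
        simp only [ENNReal.toReal_one, one_div, inv_one]
        rw [ENNReal.toReal_inv] at hle
        gcongr
        exact (eLpNorm_mono_measure _ Measure.restrict_le_self).trans hle
      _ ≤ 1 := by
        rw [← neg_sub, ENNReal.rpow_neg]
        exact ENNReal.inv_mul_le_one _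
  rw [Lp.norm_def]
  exact ENNReal.toReal_le_of_le_ofReal zero_le_one (by simpa using h1)

/-- `f = ∑ αᵢ aᵢ` in `L¹(ℝ_λ)`, with `q`-atoms `aᵢ` and `∑ |αᵢ| < ∞`. -/
structure IsAtomicDecomposition (lam : ℝ) (q : ℝ≥0∞) (f : Lp ℂ 1 (planeMeasure lam))
    (α : ℕ → ℂ) (a : ℕ → Lp ℂ 1 (planeMeasure lam)) : Prop where
  isAtom : ∀ i, IsAtom lam q (a i)
  summable : Summable fun i => ‖α i‖
  hasSum : HasSum (fun i => α i • a i) f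

theorem IsAtomicDecomposition.zero (lam : ℝ) (q : ℝ≥0∞) :
    IsAtomicDecomposition lam q 0 0 0 where
  isAtom _ := isAtom_zero lam q
  summable := by simp
  hasSum := by simp

theorem IsAtomicDecomposition.smul {lam : ℝ} {q : ℝ≥0∞} {f : Lp ℂ 1 (planeMeasure lam)}
    {α : ℕ → ℂ} {a : ℕ → Lp ℂ 1 (planeMeasure lam)} (h : IsAtomicDecomposition lam q f α a)
    (z : ℂ) : IsAtomicDecomposition lam q (z • f) (fun i => z * α i) a where
  isAtom := h.isAtom
  summable := by simpa only [norm_mul] using h.summable.mul_left ‖z‖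
  hasSum := by simpa only [smul_smul] using h.hasSum.const_smul z

theorem exists_interleave {E : Type*} [NormedAddCommGroup E] [NormedSpace ℂ E] {P : E → Prop}
    {f g : E} {α β : ℕ → ℂ} {a b : ℕ → E} (ha : ∀ i, P (a i)) (hb : ∀ i, P (b i))
    (hα : Summable fun i => ‖α i‖) (hβ : Summable fun i => ‖β i‖)
    (hf : HasSum (fun i => α i • a i) f) (hg : HasSum (fun i => β i • b i) g) :
    ∃ (γ : ℕ → ℂ) (c : ℕ → E), (∀ i, P (c i)) ∧ (Summable fun i => ‖γ i‖) ∧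
      HasSum (fun i => γ i • c i) (f + g) ∧ ∑' i, ‖γ i‖ = ∑' i, ‖α i‖ + ∑' i, ‖β i‖ := by
  obtain ⟨e⟩ : Nonempty (ℕ ≃ ℕ ⊕ ℕ) := ⟨Equiv.natSumNatEquivNat.symm⟩
  have hs : HasSum (fun s : ℕ ⊕ ℕ => ‖Sum.elim α β s‖) (∑' i, ‖α i‖ + ∑' i, ‖β i‖) :=
    HasSum.sum hα.hasSum hβ.hasSum
  have hs' := e.hasSum_iff.2 hs
  have hfg : HasSum (fun s : ℕ ⊕ ℕ => Sum.elim α β s • Sum.elim a b s) (f + g) :=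
    HasSum.sum hf hg
  have hP : ∀ s, P (Sum.elim a b s) := by
    rintro (i | i)
    · exact ha i
    · exact hb i
  exact ⟨Sum.elim α β ∘ e, Sum.elim a b ∘ e, fun i => hP (e i), hs'.summable,
    e.hasSum_iff.2 hfg, hs'.tsum_eq⟩

theorem IsAtomicDecomposition.add {lam : ℝ} {q : ℝ≥0∞} {f g : Lp ℂ 1 (planeMeasure lam)}
    {α β : ℕ → ℂ} {a b : ℕ → Lp ℂ 1 (planeMeasure lam)}
    (h : IsAtomicDecomposition lam q f α a) (k : IsAtomicDecomposition lam q g β b) :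
    ∃ γ c, IsAtomicDecomposition lam q (f + g) γ c ∧
      ∑' i, ‖γ i‖ = ∑' i, ‖α i‖ + ∑' i, ‖β i‖ := by
  obtain ⟨γ, c, h1, h2, h3, h4⟩ := exists_interleave h.isAtom k.isAtom h.summable k.summable
    h.hasSum k.hasSum
  exact ⟨γ, c, ⟨h1, h2, h3⟩, h4⟩

/-- The functions in `h^{1,q}(ℝ_λ)`, as a linear subspace of `L¹(ℝ_λ)`. -/
def littleHardySubmodule (lam : ℝ) (q : ℝ≥0∞) : Submodule ℂ (Lp ℂ 1 (planeMeasure lam)) where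
  carrier := {f | ∃ α a, IsAtomicDecomposition lam q f α a}
  zero_mem' := ⟨_, _, IsAtomicDecomposition.zero lam q⟩
  add_mem' := by
    rintro f g ⟨α, a, h⟩ ⟨β, b, k⟩
    obtain ⟨γ, c, hc, -⟩ := h.add k
    exact ⟨γ, c, hc⟩
  smul_mem' := by
    rintro z f ⟨α, a, h⟩
    exact ⟨_, _, h.smul z⟩

/-- The norm `inf ∑ |αᵢ|` over all atomic decompositions. -/
def atomicNorm (lam : ℝ) (q : ℝ≥0∞) (f : Lp ℂ 1 (planeMeasure lam)) : ℝ :=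
  sInf {r | ∃ α a, IsAtomicDecomposition lam q f α a ∧ r = ∑' i, ‖α i‖}

theorem atomicNorm_nonneg (lam : ℝ) (q : ℝ≥0∞) (f : Lp ℂ 1 (planeMeasure lam)) :
    0 ≤ atomicNorm lam q f := by
  apply Real.sInf_nonneg
  rintro r ⟨α, a, -, rfl⟩
  exact tsum_nonneg fun _ => norm_nonneg _

theorem atomicNorm_le {lam : ℝ} {q : ℝ≥0∞} {f : Lp ℂ 1 (planeMeasure lam)}
    {α : ℕ → ℂ} {a : ℕ → Lp ℂ 1 (planeMeasure lam)} (h : IsAtomicDecomposition lam q f α a) :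
    atomicNorm lam q f ≤ ∑' i, ‖α i‖ := by
  refine csInf_le ⟨0, ?_⟩ ⟨α, a, h, rfl⟩
  rintro r ⟨α, a, -, rfl⟩
  exact tsum_nonneg fun _ => norm_nonneg _

theorem exists_lt_of_atomicNorm_lt {lam : ℝ} {q : ℝ≥0∞} {f : Lp ℂ 1 (planeMeasure lam)}
    (hf : f ∈ littleHardySubmodule lam q) {ε : ℝ} (hε : atomicNorm lam q f < ε) :
    ∃ α a, IsAtomicDecomposition lam q f α a ∧ ∑' i, ‖α i‖ < ε := by
  obtain ⟨α, a, h⟩ := hf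
  have hne : {r | ∃ α a, IsAtomicDecomposition lam q f α a ∧ r = ∑' i, ‖α i‖}.Nonempty :=
    ⟨_, α, a, h, rfl⟩
  obtain ⟨r, ⟨β, b, k, rfl⟩, hlt⟩ := exists_lt_of_csInf_lt hne hε
  exact ⟨β, b, k, hlt⟩

theorem atomicNorm_smul_le {lam : ℝ} {q : ℝ≥0∞} {f : Lp ℂ 1 (planeMeasure lam)}
    (hf : f ∈ littleHardySubmodule lam q) (z : ℂ) :
    atomicNorm lam q (z • f) ≤ ‖z‖ * atomicNorm lam q f := by
  refine le_of_forall_pos_le_add fun ε hε => ?_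
  have hz : 0 < ‖z‖ + 1 := by positivity
  obtain ⟨α, a, h, hlt⟩ := exists_lt_of_atomicNorm_lt hf
    (lt_add_of_pos_right (atomicNorm lam q f) (div_pos hε hz))
  have h1 := atomicNorm_le (h.smul z)
  simp only [norm_mul, tsum_mul_left] at h1
  have h2 : ‖z‖ * (ε / (‖z‖ + 1)) ≤ ε := by
    rw [mul_div_assoc', div_le_iff₀ hz]
    nlinarith
  nlinarith [mul_le_mul_of_nonneg_left hlt.le (norm_nonneg z)]

theorem norm_le_atomicNorm {lam : ℝ} {q : ℝ≥0∞} (hq : 1 < q) {f : Lp ℂ 1 (planeMeasure lam)}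
    (hf : f ∈ littleHardySubmodule lam q) : ‖f‖ ≤ atomicNorm lam q f := by
  refine le_of_forall_pos_le_add fun ε hε => ?_
  obtain ⟨α, a, h, hlt⟩ := exists_lt_of_atomicNorm_lt hf
    (lt_add_of_pos_right (atomicNorm lam q f) hε)
  refine le_trans ?_ hlt.le
  rw [← h.hasSum.tsum_eq]
  refine tsum_of_norm_bounded h.summable.hasSum fun i => ?_
  rw [norm_smul]
  exact mul_le_of_le_one_right (norm_nonneg _) ((h.isAtom i).norm_le_one hq)

/-- The space `h^{1,q}(ℝ_λ)`. -/
def LittleHardy (lam : ℝ) (q : ℝ≥0∞) : Type := ↥(littleHardySubmodule lam q)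

namespace LittleHardy

instance (lam : ℝ) (q : ℝ≥0∞) : AddCommGroup (LittleHardy lam q) :=
  inferInstanceAs (AddCommGroup ↥(littleHardySubmodule lam q))

instance (lam : ℝ) (q : ℝ≥0∞) : Module ℂ (LittleHardy lam q) :=
  inferInstanceAs (Module ℂ ↥(littleHardySubmodule lam q))

/-- The inclusion of `h^{1,q}(ℝ_λ)` into `L¹(ℝ_λ)`. -/
def toLp {lam : ℝ} {q : ℝ≥0∞} (f : LittleHardy lam q) : Lp ℂ 1 (planeMeasure lam) :=
  Subtype.val (p := (· ∈ littleHardySubmodule lam q)) f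

theorem mem {lam : ℝ} {q : ℝ≥0∞} (f : LittleHardy lam q) :
    f.toLp ∈ littleHardySubmodule lam q :=
  Subtype.prop (p := (· ∈ littleHardySubmodule lam q)) f

instance (lam : ℝ) (q : ℝ≥0∞) : Norm (LittleHardy lam q) := ⟨fun f => atomicNorm lam q f.toLp⟩

theorem norm_def {lam : ℝ} {q : ℝ≥0∞} (f : LittleHardy lam q) :
    ‖f‖ = atomicNorm lam q f.toLp := rfl

theorem core (lam : ℝ) (q : ℝ≥0∞) [hq : Fact (1 < q)] :
    NormedSpace.Core ℂ (LittleHardy lam q) where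
  norm_nonneg f := atomicNorm_nonneg lam q f.toLp
  norm_smul z f := by
    refine le_antisymm (atomicNorm_smul_le f.mem z) ?_
    by_cases hz : z = 0
    · rw [hz, norm_zero, zero_mul]
      exact atomicNorm_nonneg lam q _
    have h := atomicNorm_smul_le (littleHardySubmodule lam q |>.smul_mem z f.mem) z⁻¹
    rw [inv_smul_smul₀ hz, norm_inv, ← div_eq_inv_mul, le_div_iff₀ (norm_pos_iff.2 hz),
      mul_comm] at h
    exact h
  norm_triangle f g := by
    refine le_of_forall_pos_le_add fun ε hε => ?_
    obtain ⟨α, a, h, hl⟩ := exists_lt_of_atomicNorm_lt f.mem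
      (lt_add_of_pos_right (atomicNorm lam q f.toLp) (half_pos hε))
    obtain ⟨β, b, k, kl⟩ := exists_lt_of_atomicNorm_lt g.mem
      (lt_add_of_pos_right (atomicNorm lam q g.toLp) (half_pos hε))
    obtain ⟨γ, c, hc, hsum⟩ := h.add k
    have h1 : ‖f + g‖ ≤ ∑' i, ‖γ i‖ := atomicNorm_le hc
    rw [norm_def f, norm_def g]
    linarith
  norm_eq_zero_iff f := by
    constructor
    · intro h
      have h1 := norm_le_atomicNorm hq.out f.mem
      rw [← norm_def, h] at h1
      exact Subtype.ext (norm_le_zero_iff.1 h1)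
    · rintro rfl
      refine le_antisymm ?_ (atomicNorm_nonneg lam q _)
      have h1 := atomicNorm_le (IsAtomicDecomposition.zero lam q)
      rwa [show ∑' i, ‖(0 : ℕ → ℂ) i‖ = 0 by simp] at h1

instance (lam : ℝ) (q : ℝ≥0∞) [Fact (1 < q)] : NormedAddCommGroup (LittleHardy lam q) :=
  NormedAddCommGroup.ofCore (core lam q)

instance (lam : ℝ) (q : ℝ≥0∞) [Fact (1 < q)] : NormedSpace ℂ (LittleHardy lam q) where
  norm_smul_le z f := ((core lam q).norm_smul z f).le

end LittleHardy

end Bessel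

end

/-! Both halves of the duality rest on one John–Nirenberg inequality for a martingale on a
quaternary tree (`treeAvg_exp_le`, `treeAvg_pow_le`). A family of complex numbers in which each node
is the mean of its four children, and whose mean oscillation over descendants is at most `M`, has
exponential moments of order `1 / M`. The weight enters only through a change of variables. The map
`flatten`, affine in `x ^ (2λ + 1)`, carries the normalized measure on an interval to Lebesgue
measure on `(0, 1)`. Applied in both coordinates (`Chart`), it turns dyadic squares of the unit
square into rectangles. All rectangles compete in the bmo norm, so no doubling argument is needed.

Boundedness. Dyadic averages of a bmo function form such a martingale. Lebesgue differentiation and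
Fatou give `L^p` bounds for `b - m_R(b)` for every finite `p` (`exists_eLpNorm_sub_average_le`), and
Hölder pairs `b` with `q`-atoms. For a general element `f` of the Hardy space the product `b f` need
not be integrable, so the pairing is the limit of integrals against truncations of `b`. Truncations
have oscillation controlled uniformly in the height, so the limit exists and agrees with the sum
over any atomic decomposition (`tendsto_integral_trunc_of_decomposition`).

Lower bound. On a rectangle the oscillation of `b` is the pairing of `b` with a mean-zero function
of sup norm at most 2, which is a controlled multiple of an atom
(`meanOsc_le_of_forall_bddMeanZero`).

Surjectivity. The core is that the Hardy norm of a bounded mean-zero function on a fixed rectangle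
is controlled by its `L²` norm, for every `q > 1` (`exists_norm_bddToHardy_le`). This is not a
direct consequence of the size condition on atoms when `q > 2`. For dyadic step functions it follows
by duality: the values of a norming functional on normalized indicators of cells form a martingale
of bounded oscillation, so John–Nirenberg puts them in `L²`. General functions are summed from step
functions with geometrically decaying `L²` remainders, using completeness. A functional is then
`L²`-bounded on each rectangle, and Hahn–Banach and Riesz represent it there by a function. The
representers are normalized and glued along growing squares (`exists_global_representation`).
Density of bounded functions identifies the resulting functional with the given one
(`eq_of_forall_bddToHardy`). -/

noncomputable section

namespace Bessel

/-! ### Averages over descendants in a quaternary tree -/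

section Tree

variable {ι V W : Type*} [AddCommGroup V] [Module ℝ V] [AddCommGroup W] [Module ℝ W]
  (ch : ι → Bool × Bool → ι)

/-- The average of `c` over the `4 ^ m` descendants of `Q` at depth `m`. -/
def treeAvg : ℕ → (ι → V) → ι → V
  | 0, c, Q => c Q
  | m + 1, c, Q => (4 : ℝ)⁻¹ • ∑ k, treeAvg m c (ch Q k)

@[simp] theorem treeAvg_zero (c : ι → V) (Q : ι) : treeAvg ch 0 c Q = c Q := rfl

theorem treeAvg_succ (m : ℕ) (c : ι → V) (Q : ι) :
    treeAvg ch (m + 1) c Q = (4 : ℝ)⁻¹ • ∑ k, treeAvg ch m c (ch Q k) := rfl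

/-- Used to pass functionals on the Hardy space and point evaluations of functions through tree
averages. -/
theorem map_treeAvg (L : V →ₗ[ℝ] W) (m : ℕ) (c : ι → V) (Q : ι) :
    L (treeAvg ch m c Q) = treeAvg ch m (fun Q' => L (c Q')) Q := by
  induction m generalizing Q with
  | zero => rfl
  | succ m ih => simp only [treeAvg_succ, map_smul, map_sum, ih]

theorem treeAvg_add (m : ℕ) (c d : ι → V) (Q : ι) :
    treeAvg ch m (fun Q' => c Q' + d Q') Q = treeAvg ch m c Q + treeAvg ch m d Q := by
  induction m generalizing Q with
  | zero => rfl
  | succ m ih => simp only [treeAvg_succ, ih, Finset.sum_add_distrib, smul_add]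

/-- The hypothesis is the martingale property for one generation; iterating it covers every depth.
-/
theorem treeAvg_eq_self {c : ι → V} (hc : ∀ Q, c Q = (4 : ℝ)⁻¹ • ∑ k, c (ch Q k)) (m : ℕ)
    (Q : ι) : treeAvg ch m c Q = c Q := by
  induction m generalizing Q with
  | zero => rfl
  | succ m ih => simp only [treeAvg_succ, ih]; exact (hc Q).symm

theorem treeAvg_const (v : V) (m : ℕ) (Q : ι) : treeAvg ch m (fun _ => v) Q = v := by
  refine treeAvg_eq_self ch (c := fun _ => v) (fun Q => ?_) m Q
  rw [Finset.sum_const, Finset.card_univ, ← Nat.cast_smul_eq_nsmul ℝ, smul_smul]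
  simp

theorem treeAvg_mono {c d : ι → ℝ} (h : ∀ Q, c Q ≤ d Q) (m : ℕ) (Q : ι) :
    treeAvg ch m c Q ≤ treeAvg ch m d Q := by
  induction m generalizing Q with
  | zero => exact h Q
  | succ m ih =>
    simp only [treeAvg_succ, smul_eq_mul]
    gcongr with k
    exact ih _

theorem treeAvg_const_mul (a : ℝ) (c : ι → ℝ) (m : ℕ) (Q : ι) :
    treeAvg ch m (fun Q' => a * c Q') Q = a * treeAvg ch m c Q :=
  (map_treeAvg ch (LinearMap.mulLeft ℝ a) m c Q).symm

theorem norm_treeAvg_le {E : Type*} [NormedAddCommGroup E] [NormedSpace ℝ E] (c : ι → E) (m : ℕ)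
    (Q : ι) : ‖treeAvg ch m c Q‖ ≤ treeAvg ch m (fun Q' => ‖c Q'‖) Q := by
  induction m generalizing Q with
  | zero => exact le_rfl
  | succ m ih =>
    simp only [treeAvg_succ, smul_eq_mul]
    rw [norm_smul, Real.norm_of_nonneg (by norm_num)]
    gcongr
    exact (norm_sum_le _ _).trans (Finset.sum_le_sum fun k _ => ih _)

/-- Discrete stopping time estimate: descendants whose value is within `4 * M` of `z` are estimated
directly, and once the value leaves this disc the exponential bound is restarted. -/
theorem treeAvg_exp_le_of_forall {β : ι → ℂ} {M θ A : ℝ} (hM : 0 < M) (hθ : 0 ≤ θ)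
    (hmart : ∀ Q, β Q = (4 : ℝ)⁻¹ • ∑ k, β (ch Q k))
    (hjump : ∀ Q k, ‖β (ch Q k) - β Q‖ ≤ 4 * M) (hA : 0 ≤ A) (z : ℂ) (m : ℕ)
    (ih : ∀ j ≤ m, ∀ Q, treeAvg ch j (fun Q' => Real.exp (θ * ‖β Q' - β Q‖)) Q ≤ A)
    (Q : ι) (hQ : ‖β Q - z‖ ≤ 8 * M) :
    treeAvg ch m (fun Q' => Real.exp (θ * ‖β Q' - z‖)) Q ≤
      Real.exp (4 * M * θ) +
        Real.exp (8 * M * θ) * A / (4 * M) * treeAvg ch m (fun Q' => ‖β Q' - z‖) Q := by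
  induction m generalizing Q with
  | zero =>
    simp only [treeAvg_zero]
    rcases le_or_gt ‖β Q - z‖ (4 * M) with h | h
    · have h1 : Real.exp (θ * ‖β Q - z‖) ≤ Real.exp (4 * M * θ) := by
        rw [Real.exp_le_exp]; nlinarith
      have h2 : 0 ≤ Real.exp (8 * M * θ) * A / (4 * M) * ‖β Q - z‖ := by positivity
      linarith
    -- At depth 0 the hypothesis reads `exp 0 ≤ A`.
    · have hA1 : 1 ≤ A := by simpa using ih 0 le_rfl Q
      have h1 : Real.exp (θ * ‖β Q - z‖) ≤ Real.exp (8 * M * θ) := by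
        rw [Real.exp_le_exp]; nlinarith
      have h2 : Real.exp (8 * M * θ) * A ≤
          Real.exp (8 * M * θ) * A / (4 * M) * ‖β Q - z‖ := by
        rw [div_mul_eq_mul_div, le_div_iff₀ (by positivity)]
        gcongr
      have h3 := Real.exp_pos (4 * M * θ)
      have h4 := Real.exp_pos (8 * M * θ)
      nlinarith
  | succ m IH =>
    rcases le_or_gt ‖β Q - z‖ (4 * M) with h | h
    -- Not stopped yet: a jump is at most `4 * M`, so the children remain within `8 * M` of `z` and
    -- the induction continues.
    · have hk : ∀ k, treeAvg ch m (fun Q' => Real.exp (θ * ‖β Q' - z‖)) (ch Q k) ≤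
          Real.exp (4 * M * θ) + Real.exp (8 * M * θ) * A / (4 * M) *
            treeAvg ch m (fun Q' => ‖β Q' - z‖) (ch Q k) := fun k => by
        refine IH (fun j hj => ih j (hj.trans m.le_succ)) _ ?_
        have := norm_sub_le_norm_sub_add_norm_sub (β (ch Q k)) (β Q) z
        have := hjump Q k
        linarith
      have hs := Finset.sum_le_sum fun k (_ : k ∈ Finset.univ) => hk k
      rw [Finset.sum_add_distrib, ← Finset.mul_sum] at hs
      simp only [Finset.sum_const, Finset.card_univ, Fintype.card_prod, Fintype.card_bool,
        nsmul_eq_mul] at hs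
      simp only [treeAvg_succ, smul_eq_mul]
      push_cast at hs
      linarith
    -- Stopped: recentring from `z` to `β Q` costs the factor `exp (8 * M * θ)`, and the bound `A`
    -- controls what remains.
    · have h1 : treeAvg ch (m + 1) (fun Q' => Real.exp (θ * ‖β Q' - z‖)) Q ≤
          Real.exp (8 * M * θ) * A := by
        calc _ ≤ treeAvg ch (m + 1) (fun Q' => Real.exp (8 * M * θ) *
              Real.exp (θ * ‖β Q' - β Q‖)) Q := by
              refine treeAvg_mono ch (fun Q' => ?_) _ _
              rw [← Real.exp_add, Real.exp_le_exp]
              have := norm_sub_le_norm_sub_add_norm_sub (β Q') (β Q) z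
              nlinarith
          _ ≤ _ := by
              rw [treeAvg_const_mul]
              gcongr
              exact ih _ le_rfl Q
      -- By the martingale property the distance at the stopped node is at most the mean distance
      -- over its descendants. Since it exceeds `4 * M`, the stopped contribution is paid for as in
      -- Chebyshev's inequality.
      have h2 : ‖β Q - z‖ ≤ treeAvg ch (m + 1) (fun Q' => ‖β Q' - z‖) Q := by
        refine le_trans (le_of_eq ?_) (norm_treeAvg_le ch (fun Q' => β Q' - z) (m + 1) Q)
        have := treeAvg_add ch (m + 1) β (fun _ => -z) Q
        rw [treeAvg_const, treeAvg_eq_self ch hmart] at this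
        simp only [sub_eq_add_neg, this]
      have h3 : Real.exp (8 * M * θ) * A ≤ Real.exp (8 * M * θ) * A / (4 * M) *
          treeAvg ch (m + 1) (fun Q' => ‖β Q' - z‖) Q := by
        rw [div_mul_eq_mul_div, le_div_iff₀ (by positivity)]
        have := h.le.trans h2
        gcongr
      have h4 := Real.exp_pos (4 * M * θ)
      linarith

/-- A discrete **John–Nirenberg inequality**. -/
theorem treeAvg_exp_le {β : ι → ℂ} {M : ℝ} (hM : 0 < M)
    (hmart : ∀ Q, β Q = (4 : ℝ)⁻¹ • ∑ k, β (ch Q k))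
    (hosc : ∀ m Q, treeAvg ch m (fun Q' => ‖β Q' - β Q‖) Q ≤ M) (m : ℕ) (Q : ι) :
    treeAvg ch m (fun Q' => Real.exp (Real.log 2 / (8 * M) * ‖β Q' - β Q‖)) Q ≤ 4 := by
  have hl : 0 < Real.log 2 := Real.log_pos one_lt_two
  -- Each child has weight 1/4 in the oscillation at depth 1.
  have hjump : ∀ Q k, ‖β (ch Q k) - β Q‖ ≤ 4 * M := fun Q k => by
    have h := hosc 1 Q
    simp only [treeAvg_succ, treeAvg_zero, smul_eq_mul] at h
    have := Finset.single_le_sum (f := fun k => ‖β (ch Q k) - β Q‖)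
      (fun k _ => norm_nonneg _) (Finset.mem_univ k)
    linarith
  induction m using Nat.strong_induction_on generalizing Q with
  | _ m ih =>
    rcases m with _ | m
    · simp
    -- The stopping estimate is run from the children, with `z = β Q`, so that only depths at most
    -- `m` are needed. With `θ = log 2 / (8 M)` one has `exp (8 M θ) = 2`, so the bound 4 reproduces
    -- itself: `2 + (2 * 4 / (4 * M)) * M = 4`.
    · have hk : ∀ k, _ := fun k => treeAvg_exp_le_of_forall ch hM
        (div_nonneg hl.le (by positivity)) hmart hjump (by norm_num : (0 : ℝ) ≤ 4) (β Q) m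
        (fun j hj => ih j (Nat.lt_succ_of_le hj)) (ch Q k) ((hjump Q k).trans (by linarith))
      have hs := Finset.sum_le_sum fun k (_ : k ∈ Finset.univ) => hk k
      rw [Finset.sum_add_distrib, ← Finset.mul_sum] at hs
      simp only [Finset.sum_const, Finset.card_univ, Fintype.card_prod, Fintype.card_bool,
        nsmul_eq_mul] at hs
      have ho := hosc (m + 1) Q
      simp only [treeAvg_succ, smul_eq_mul] at ho ⊢
      have e8 : Real.exp (8 * M * (Real.log 2 / (8 * M))) = 2 := by
        rw [mul_div_cancel₀ _ (by positivity), Real.exp_log two_pos]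
      have e4 : Real.exp (4 * M * (Real.log 2 / (8 * M))) ≤ 2 := by
        refine le_trans (Real.exp_le_exp.2 ?_) e8.le
        gcongr
        norm_num
      rw [e8] at hs
      have h5 : 2 * 4 / (4 * M) * ∑ k, treeAvg ch m (fun Q' => ‖β Q' - β Q‖) (ch Q k) ≤ 8 := by
        rw [div_mul_eq_mul_div, div_le_iff₀ (by positivity)]
        linarith
      push_cast at hs
      linarith

/-- Power moments follow from the exponential moment by `t ^ n / n! ≤ exp t`, with `t` the exponent
in `treeAvg_exp_le`. -/
theorem treeAvg_pow_le {β : ι → ℂ} {M : ℝ} (hM : 0 < M)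
    (hmart : ∀ Q, β Q = (4 : ℝ)⁻¹ • ∑ k, β (ch Q k))
    (hosc : ∀ m Q, treeAvg ch m (fun Q' => ‖β Q' - β Q‖) Q ≤ M) (n m : ℕ) (Q : ι) :
    treeAvg ch m (fun Q' => ‖β Q' - β Q‖ ^ n) Q ≤
      4 * n.factorial * (8 / Real.log 2) ^ n * M ^ n := by
  have hl : 0 < Real.log 2 := Real.log_pos one_lt_two
  calc _ ≤ treeAvg ch m (fun Q' => (n.factorial * (8 / Real.log 2) ^ n * M ^ n) *
          Real.exp (Real.log 2 / (8 * M) * ‖β Q' - β Q‖)) Q := by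
        refine treeAvg_mono ch (fun Q' => ?_) _ _
        have h := Real.pow_div_factorial_le_exp
          (x := Real.log 2 / (8 * M) * ‖β Q' - β Q‖) (by positivity) n
        calc ‖β Q' - β Q‖ ^ n = (n.factorial * (8 / Real.log 2) ^ n * M ^ n) *
              ((Real.log 2 / (8 * M) * ‖β Q' - β Q‖) ^ n / n.factorial) := by
              have : (n.factorial : ℝ) ≠ 0 := by positivity
              rw [mul_pow, div_pow, div_pow, mul_pow]
              field_simp
          _ ≤ _ := by gcongr
    _ ≤ _ := by
        rw [treeAvg_const_mul]
        have := treeAvg_exp_le ch hM hmart hosc m Q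
        have h0 : 0 ≤ n.factorial * (8 / Real.log 2) ^ n * M ^ n := by positivity
        nlinarith

end Tree

/-! ### Half-open squares in the unit square -/

/-- A half-open square `[s, s + r) × [t, t + r)` contained in the unit square. -/
structure Cell where
  /-- The first coordinate of the lower left corner. -/
  s : ℝ
  /-- The second coordinate of the lower left corner. -/
  t : ℝ
  /-- The side length. -/
  r : ℝ
  r_pos : 0 < r
  s_nonneg : 0 ≤ s
  t_nonneg : 0 ≤ t
  s_le : s + r ≤ 1
  t_le : t + r ≤ 1

namespace Cell

/-- The set of points of a cell. -/
def set (Q : Cell) : Set (ℝ × ℝ) := Ico Q.s (Q.s + Q.r) ×ˢ Ico Q.t (Q.t + Q.r)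

/-- The unit square. -/
def root : Cell := ⟨0, 0, 1, one_pos, le_rfl, le_rfl, by norm_num, by norm_num⟩

/-- The four dyadic children of a cell. -/
def child (Q : Cell) (k : Bool × Bool) : Cell where
  s := if k.1 then Q.s + Q.r / 2 else Q.s
  t := if k.2 then Q.t + Q.r / 2 else Q.t
  r := Q.r / 2
  r_pos := half_pos Q.r_pos
  s_nonneg := by have := Q.r_pos; have := Q.s_nonneg; split_ifs <;> linarith
  t_nonneg := by have := Q.r_pos; have := Q.t_nonneg; split_ifs <;> linarith
  s_le := by have := Q.r_pos; have := Q.s_le; split_ifs <;> linarith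
  t_le := by have := Q.r_pos; have := Q.t_le; split_ifs <;> linarith

/-- The index of the child of `Q` which contains the point `y` of `Q`. -/
def side (Q : Cell) (y : ℝ × ℝ) : Bool × Bool :=
  (decide (Q.s + Q.r / 2 ≤ y.1), decide (Q.t + Q.r / 2 ≤ y.2))

/-- The descendant of `Q` at depth `m` which contains the point `y` of `Q`. -/
def leaf : ℕ → Cell → ℝ × ℝ → Cell
  | 0, Q, _ => Q
  | m + 1, Q, y => leaf m (Q.child (Q.side y)) y

theorem measurableSet_set (Q : Cell) : MeasurableSet Q.set :=
  measurableSet_Ico.prod measurableSet_Ico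

theorem set_subset_root (Q : Cell) : Q.set ⊆ root.set := by
  rintro ⟨x, y⟩ ⟨⟨h1, h2⟩, h3, h4⟩
  have := Q.s_nonneg; have := Q.t_nonneg; have := Q.s_le; have := Q.t_le
  simp only at h1 h2 h3 h4
  refine ⟨⟨?_, ?_⟩, ?_, ?_⟩ <;> simp only [root] <;> linarith

theorem volume_set (Q : Cell) : volume Q.set = ENNReal.ofReal (Q.r ^ 2) := by
  rw [set, Measure.volume_eq_prod, Measure.prod_prod, Real.volume_Ico, Real.volume_Ico,
    add_sub_cancel_left, add_sub_cancel_left, ← ENNReal.ofReal_mul Q.r_pos.le, sq]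

theorem volume_real_set (Q : Cell) : volume.real Q.set = Q.r ^ 2 := by
  rw [Measure.real, volume_set, ENNReal.toReal_ofReal (sq_nonneg _)]

/-- Half-open squares are used so that the children form an exact partition, with `side` selecting
the piece. -/
theorem mem_child_iff {Q : Cell} {k : Bool × Bool} {y : ℝ × ℝ} :
    y ∈ (Q.child k).set ↔ y ∈ Q.set ∧ Q.side y = k := by
  obtain ⟨a, b⟩ := k
  obtain ⟨u, v⟩ := y
  have := Q.r_pos
  simp only [set, child, side, mem_prod, mem_Ico, Prod.mk.injEq]
  cases a <;> cases b <;>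
    simp only [if_true, Bool.false_eq_true, if_false, decide_eq_true_eq, decide_eq_false_iff_not,
      not_le] <;>
    constructor <;> rintro ⟨⟨h1, h2⟩, h3, h4⟩
  all_goals first
    | exact ⟨⟨⟨by linarith, by linarith⟩, by linarith, by linarith⟩, by linarith, by linarith⟩
    | exact ⟨⟨by linarith [h1.1, h1.2], by linarith [h1.1, h1.2]⟩,
        by linarith [h2.1, h2.2], by linarith [h2.1, h2.2]⟩

theorem iUnion_child (Q : Cell) : ⋃ k, (Q.child k).set = Q.set := by
  ext y
  simp [mem_child_iff]

theorem disjoint_child (Q : Cell) :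
    Pairwise (Function.onFun Disjoint fun k => (Q.child k).set) := by
  intro k l hkl
  rw [Function.onFun, Set.disjoint_left]
  intro y hy hy'
  exact hkl ((mem_child_iff.1 hy).2.symm.trans (mem_child_iff.1 hy').2)

theorem mem_leaf {Q : Cell} {y : ℝ × ℝ} (hy : y ∈ Q.set) (m : ℕ) : y ∈ (leaf m Q y).set := by
  induction m generalizing Q with
  | zero => exact hy
  | succ m ih => exact ih (mem_child_iff.2 ⟨hy, rfl⟩)

theorem leaf_r (m : ℕ) (Q : Cell) (y : ℝ × ℝ) : (leaf m Q y).r = Q.r / 2 ^ m := by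
  induction m generalizing Q with
  | zero => simp [leaf]
  | succ m ih =>
    rw [leaf, ih, pow_succ']
    simp only [child]
    field_simp

theorem measurable_side (Q : Cell) : Measurable Q.side := by
  refine Measurable.prodMk ?_ ?_
  · refine measurable_to_bool ?_
    have : (fun y : ℝ × ℝ => decide (Q.s + Q.r / 2 ≤ y.1)) ⁻¹' {true} =
      {y | Q.s + Q.r / 2 ≤ y.1} := by ext; simp
    rw [this]
    exact measurableSet_le measurable_const measurable_fst
  · refine measurable_to_bool ?_
    have : (fun y : ℝ × ℝ => decide (Q.t + Q.r / 2 ≤ y.2)) ⁻¹' {true} =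
      {y | Q.t + Q.r / 2 ≤ y.2} := by ext; simp
    rw [this]
    exact measurableSet_le measurable_const measurable_snd

/-- Nothing is required of `G`: at a fixed depth the function is constant on finitely many
measurable pieces. -/
theorem measurable_leaf {X : Type*} [MeasurableSpace X] (G : Cell → X) (m : ℕ) (Q : Cell) :
    Measurable fun y => G (leaf m Q y) := by
  induction m generalizing Q with
  | zero => simp only [leaf]; exact measurable_const
  | succ m ih =>
    have h : Measurable fun p : (Bool × Bool) × (ℝ × ℝ) => G (leaf m (Q.child p.1) p.2) :=
      measurable_from_prod_countable_right fun k => ih (Q.child k)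
    exact h.comp (Q.measurable_side.prodMk measurable_id)

/-- The dictionary between integrals of dyadic step functions and tree averages; all leaves at the
same depth have equal area. -/
theorem setLIntegral_leaf {G : Cell → ℝ} (hG : ∀ Q, 0 ≤ G Q) (m : ℕ) (Q : Cell) :
    ∫⁻ y in Q.set, ENNReal.ofReal (G (leaf m Q y)) =
      ENNReal.ofReal (Q.r ^ 2 * treeAvg child m G Q) := by
  induction m generalizing Q with
  | zero =>
    simp only [leaf, lintegral_const, Measure.restrict_apply_univ, volume_set, treeAvg_zero]
    rw [mul_comm, ENNReal.ofReal_mul (sq_nonneg _)]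
  | succ m ih =>
    have h0 : ∀ k, 0 ≤ treeAvg child m G (Q.child k) := fun k => by
      have := treeAvg_mono child hG m (Q.child k)
      rwa [treeAvg_const] at this
    conv_lhs => rw [← iUnion_child]
    rw [lintegral_iUnion (fun k => measurableSet_set _) Q.disjoint_child, tsum_fintype]
    have h1 : ∀ k, ∫⁻ y in (Q.child k).set, ENNReal.ofReal (G (leaf (m + 1) Q y)) =
        ENNReal.ofReal ((Q.child k).r ^ 2 * treeAvg child m G (Q.child k)) := fun k => by
      rw [← ih]
      refine setLIntegral_congr_fun (measurableSet_set _) fun y hy => ?_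
      rw [leaf, (mem_child_iff.1 hy).2]
    rw [Finset.sum_congr rfl fun k _ => h1 k,
      ← ENNReal.ofReal_sum_of_nonneg fun k _ => mul_nonneg (sq_nonneg _) (h0 k)]
    congr 1
    simp only [child, treeAvg_succ, smul_eq_mul, ← Finset.mul_sum]
    ring

theorem integrableOn_norm_sub {E : Type*} [NormedAddCommGroup E] {F : ℝ × ℝ → E}
    (hF : IntegrableOn F root.set) (z : E) :
    IntegrableOn (fun y => ‖F y - z‖) root.set := by
  refine (Integrable.sub hF (integrableOn_const ?_)).norm
  rw [volume_set]
  exact ENNReal.ofReal_ne_top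

section Average

variable {E : Type*} [NormedAddCommGroup E] [NormedSpace ℝ E]

/-- The mean value of `F` over a cell. -/
def avg (F : ℝ × ℝ → E) (Q : Cell) : E := (Q.r ^ 2)⁻¹ • ∫ y in Q.set, F y

theorem avg_eq_average (F : ℝ × ℝ → E) (Q : Cell) : avg F Q = ⨍ y in Q.set, F y := by
  rw [avg, setAverage_eq, volume_real_set]

theorem avg_eq_child {F : ℝ × ℝ → E} (hF : IntegrableOn F root.set) (Q : Cell) :
    avg F Q = (4 : ℝ)⁻¹ • ∑ k, avg F (Q.child k) := by
  have h : ∫ y in Q.set, F y = ∑ k, ∫ y in (Q.child k).set, F y := by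
    conv_lhs => rw [← iUnion_child]
    rw [integral_iUnion (fun k => measurableSet_set _) Q.disjoint_child, tsum_fintype]
    rw [iUnion_child]
    exact hF.mono_set Q.set_subset_root
  simp only [avg, child, ← Finset.smul_sum]
  rw [h, smul_smul]
  congr 1
  have := Q.r_pos
  field_simp
  norm_num

theorem norm_avg_le (F : ℝ × ℝ → E) (Q : Cell) : ‖avg F Q‖ ≤ avg (fun y => ‖F y‖) Q := by
  unfold avg
  have := Q.r_pos
  rw [norm_smul, Real.norm_of_nonneg (by positivity), smul_eq_mul]
  gcongr
  exact norm_integral_le_integral_norm _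

theorem avg_sub_const [CompleteSpace E] {F : ℝ × ℝ → E} (hF : IntegrableOn F root.set)
    (z : E) (Q : Cell) :
    avg (fun y => F y - z) Q = avg F Q - z := by
  unfold avg
  have := Q.r_pos
  have hfin : IsFiniteMeasure (volume.restrict Q.set) :=
    ⟨by rw [Measure.restrict_apply_univ, volume_set]; exact ENNReal.ofReal_lt_top⟩
  rw [integral_sub (hF.mono_set Q.set_subset_root) (integrable_const _), setIntegral_const,
    volume_real_set,
    smul_sub, smul_smul, inv_mul_cancel₀ (by positivity), one_smul]

/-- The norm of an average is at most the average of the norm, and averages of `‖F - z‖` form a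
martingale. The oscillation of the martingale of averages is thus bounded by that of `F`. -/
theorem treeAvg_norm_avg_sub_le [CompleteSpace E] {F : ℝ × ℝ → E} (hF : IntegrableOn F root.set)
    (z : E) (m : ℕ)
    (Q : Cell) : treeAvg child m (fun Q' => ‖avg F Q' - z‖) Q ≤ avg (fun y => ‖F y - z‖) Q := by
  refine (treeAvg_mono child (fun Q' => ?_) m Q).trans_eq
    (treeAvg_eq_self child (avg_eq_child (integrableOn_norm_sub hF z)) m Q)
  rw [← avg_sub_const hF]
  exact norm_avg_le _ _

/-- Balls of the sup metric on the plane are squares, so differentiation along balls applies to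
cells. -/
theorem closedBall_ae_eq (Q : Cell) :
    Metric.closedBall (Q.s + Q.r / 2, Q.t + Q.r / 2) (Q.r / 2) =ᵐ[volume] Q.set := by
  rw [← closedBall_prod_same, Real.closedBall_eq_Icc, Real.closedBall_eq_Icc,
    Measure.volume_eq_prod, set]
  have e : ∀ x : ℝ, x + Q.r / 2 - Q.r / 2 = x ∧ x + Q.r / 2 + Q.r / 2 = x + Q.r :=
    fun x => ⟨by ring, by ring⟩
  rw [(e Q.s).1, (e Q.s).2, (e Q.t).1, (e Q.t).2]
  exact Measure.set_prod_ae_eq Ico_ae_eq_Icc.symm Ico_ae_eq_Icc.symm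

/-- **Lebesgue differentiation** along the dyadic cells containing a point. -/
theorem ae_tendsto_avg_leaf [CompleteSpace E] {F : ℝ × ℝ → E} (hF : IntegrableOn F root.set) :
    ∀ᵐ y ∂(volume.restrict root.set),
      Filter.Tendsto (fun m => avg F (leaf m root y)) Filter.atTop (nhds (F y)) := by
  rw [ae_restrict_iff' root.measurableSet_set]
  -- Extension by zero, because the differentiation theorem asks for local integrability on the
  -- whole plane.
  have hF' : Integrable (root.set.indicator F) volume :=
    (integrable_indicator_iff root.measurableSet_set).2 hF
  filter_upwards [IsUnifLocDoublingMeasure.ae_tendsto_average volume hF'.locallyIntegrable 1]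
    with y hy hyr
  -- The balls are centred at the midpoints of the leaves rather than at `y`. The point `y` lies in
  -- each closed ball, so the dilation factor 1 suffices.
  have h := hy (l := Filter.atTop) (fun m : ℕ => ((leaf m root y).s + (leaf m root y).r / 2,
    (leaf m root y).t + (leaf m root y).r / 2)) (fun m : ℕ => (leaf m root y).r / 2) ?_ ?_
  · rw [indicator_of_mem hyr] at h
    refine h.congr fun m => ?_
    rw [avg_eq_average, setAverage_congr (closedBall_ae_eq _)]
    rw [setAverage_eq, setAverage_eq]
    congr 1
    refine setIntegral_congr_fun (measurableSet_set _) fun x hx => ?_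
    exact indicator_of_mem (set_subset_root _ hx) F
  · simp only [leaf_r]
    refine tendsto_nhdsWithin_iff.2 ⟨?_, Filter.Eventually.of_forall fun m => ?_⟩
    · have := (tendsto_pow_atTop_nhds_zero_of_lt_one (by norm_num : (0 : ℝ) ≤ 1 / 2)
        (by norm_num)).const_mul ((root.r) / 2)
      rw [mul_zero] at this
      refine this.congr fun m => ?_
      rw [one_div, inv_pow]; ring
    · have := root.r_pos
      simp only [mem_Ioi]
      positivity
  · refine Filter.Eventually.of_forall fun m => ?_
    have h := mem_leaf hyr m
    rw [one_mul, ← closedBall_prod_same, Real.closedBall_eq_Icc, Real.closedBall_eq_Icc]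
    obtain ⟨⟨h1, h2⟩, h3, h4⟩ := h
    exact ⟨⟨by linarith, by linarith⟩, by linarith, by linarith⟩

end Average

/-- The **John–Nirenberg inequality** on the unit square. -/
theorem lintegral_pow_le {F : ℝ × ℝ → ℂ} (hF : IntegrableOn F root.set)
    {M : ℝ} (hM : 0 < M)
    (hosc : ∀ Q : Cell, avg (fun y => ‖F y - avg F Q‖) Q ≤ M) (n : ℕ) :
    ∫⁻ y in root.set, ENNReal.ofReal (‖F y - avg F root‖ ^ n) ≤
      ENNReal.ofReal (4 * n.factorial * (8 / Real.log 2) ^ n * M ^ n) := by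
  -- The discrete inequality bounds the dyadic approximations uniformly in the depth; Fatou's lemma
  -- then passes to `F`.
  have hb : ∀ m, ∫⁻ y in root.set, ENNReal.ofReal (‖avg F (leaf m root y) - avg F root‖ ^ n) ≤
      ENNReal.ofReal (4 * n.factorial * (8 / Real.log 2) ^ n * M ^ n) := fun m => by
    rw [setLIntegral_leaf (G := fun Q => ‖avg F Q - avg F root‖ ^ n) (fun Q => by positivity)]
    refine ENNReal.ofReal_le_ofReal ?_
    have := treeAvg_pow_le child hM (avg_eq_child hF)
      (fun m Q => (treeAvg_norm_avg_sub_le hF _ m Q).trans (hosc Q)) n m root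
    simpa [root] using this
  calc _ ≤ ∫⁻ y in root.set, Filter.liminf
        (fun m => ENNReal.ofReal (‖avg F (leaf m root y) - avg F root‖ ^ n)) Filter.atTop := by
        refine lintegral_mono_ae ?_
        filter_upwards [ae_tendsto_avg_leaf hF] with y hy
        refine le_of_eq (Filter.Tendsto.liminf_eq ?_).symm
        exact ENNReal.tendsto_ofReal (((hy.sub_const _).norm).pow n)
    _ ≤ Filter.liminf (fun m => ∫⁻ y in root.set,
          ENNReal.ofReal (‖avg F (leaf m root y) - avg F root‖ ^ n)) Filter.atTop :=
        lintegral_liminf_le fun m => measurable_leaf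
          (fun Q => ENNReal.ofReal (‖avg F Q - avg F root‖ ^ n)) m root
    _ ≤ _ := by
        refine Filter.liminf_le_of_frequently_le' (Filter.Frequently.of_forall hb)

end Cell

/-! ### Measure preserving coordinates on rectangles -/

instance (lam : ℝ) : SFinite (lineMeasure lam) := by
  unfold lineMeasure; infer_instance

/-- The increasing map of `(a, b)` onto `(0, 1)` which transports the normalized measure
`x ^ (2λ) dx` to Lebesgue measure. -/
def flatten (lam a b x : ℝ) : ℝ :=
  (x ^ (2 * lam + 1) - a ^ (2 * lam + 1)) / (b ^ (2 * lam + 1) - a ^ (2 * lam + 1))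

/-- The inverse of `flatten`. -/
def unflatten (lam a b s : ℝ) : ℝ :=
  (a ^ (2 * lam + 1) + s * (b ^ (2 * lam + 1) - a ^ (2 * lam + 1))) ^ (2 * lam + 1)⁻¹

section Line

variable {lam a b : ℝ}

theorem measurable_flatten : Measurable (flatten lam a b) :=
  ((measurable_id.pow_const _).sub_const _).div_const _

theorem measurable_unflatten : Measurable (unflatten lam a b) :=
  ((measurable_id.mul_const _).const_add _).pow_const _

theorem rpow_sub_rpow_pos (hlam : 0 < lam) (ha : 0 ≤ a) (hab : a < b) :
    0 < b ^ (2 * lam + 1) - a ^ (2 * lam + 1) :=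
  sub_pos.2 (Real.rpow_lt_rpow ha hab (by linarith))

theorem flatten_lt_flatten (hlam : 0 < lam) (ha : 0 ≤ a) (hab : a < b) {x y : ℝ} (hx : 0 ≤ x)
    (hy : 0 ≤ y) : flatten lam a b x < flatten lam a b y ↔ x < y := by
  unfold flatten
  rw [div_lt_div_iff_of_pos_right (rpow_sub_rpow_pos hlam ha hab), sub_lt_sub_iff_right,
    Real.rpow_lt_rpow_iff hx hy (by linarith)]

theorem unflatten_nonneg (hlam : 0 < lam) (ha : 0 ≤ a) (hab : a < b) {s : ℝ} (hs : 0 ≤ s) :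
    0 ≤ unflatten lam a b s := by
  have := rpow_sub_rpow_pos hlam ha hab
  unfold unflatten
  positivity

theorem flatten_unflatten (hlam : 0 < lam) (ha : 0 ≤ a) (hab : a < b) {s : ℝ} (hs : 0 ≤ s) :
    flatten lam a b (unflatten lam a b s) = s := by
  have := rpow_sub_rpow_pos hlam ha hab
  unfold flatten unflatten
  rw [Real.rpow_inv_rpow (by positivity) (by linarith), add_sub_cancel_left,
    mul_div_cancel_right₀ _ this.ne']

theorem unflatten_flatten (hlam : 0 < lam) (ha : 0 ≤ a) (hab : a < b) {x : ℝ} (hx : 0 ≤ x) :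
    unflatten lam a b (flatten lam a b x) = x := by
  have := rpow_sub_rpow_pos hlam ha hab
  unfold flatten unflatten
  rw [div_mul_cancel₀ _ this.ne', add_sub_cancel, Real.rpow_rpow_inv hx (by linarith)]

theorem flatten_mem_Ioo_iff (hlam : 0 < lam) (ha : 0 ≤ a) (hab : a < b) {x s t : ℝ} (hx : 0 ≤ x)
    (hs : 0 ≤ s) (ht : 0 ≤ t) : flatten lam a b x ∈ Ioo s t ↔
      x ∈ Ioo (unflatten lam a b s) (unflatten lam a b t) := by
  rw [mem_Ioo, mem_Ioo, ← flatten_lt_flatten hlam ha hab (unflatten_nonneg hlam ha hab hs) hx,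
    ← flatten_lt_flatten hlam ha hab hx (unflatten_nonneg hlam ha hab ht),
    flatten_unflatten hlam ha hab hs, flatten_unflatten hlam ha hab ht]

theorem unflatten_zero (hlam : 0 < lam) (ha : 0 ≤ a) : unflatten lam a b 0 = a := by
  unfold unflatten
  rw [zero_mul, add_zero, Real.rpow_rpow_inv ha (by linarith)]

theorem unflatten_one (hlam : 0 < lam) (ha : 0 ≤ a) (hab : a < b) : unflatten lam a b 1 = b := by
  unfold unflatten
  rw [one_mul, add_sub_cancel, Real.rpow_rpow_inv (ha.trans hab.le) (by linarith)]

theorem unflatten_lt_unflatten (hlam : 0 < lam) (ha : 0 ≤ a) (hab : a < b) {s t : ℝ} (hs : 0 ≤ s)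
    (hst : s < t) : unflatten lam a b s < unflatten lam a b t := by
  rw [← flatten_lt_flatten hlam ha hab (unflatten_nonneg hlam ha hab hs)
    (unflatten_nonneg hlam ha hab (hs.trans hst.le)), flatten_unflatten hlam ha hab hs,
    flatten_unflatten hlam ha hab (hs.trans hst.le)]
  exact hst

theorem flatten_image_Ioo (hlam : 0 < lam) (ha : 0 ≤ a) (hab : a < b) :
    flatten lam a b '' Ioo a b = Ioo 0 1 := by
  ext s
  constructor
  · rintro ⟨x, hx, rfl⟩
    rw [flatten_mem_Ioo_iff hlam ha hab (ha.trans hx.1.le) le_rfl zero_le_one,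
      unflatten_zero hlam ha, unflatten_one hlam ha hab]
    exact hx
  · intro hs
    refine ⟨unflatten lam a b s, ?_, flatten_unflatten hlam ha hab hs.1.le⟩
    have := (flatten_mem_Ioo_iff hlam ha hab (unflatten_nonneg hlam ha hab hs.1.le) le_rfl
      zero_le_one).1 (by rwa [flatten_unflatten hlam ha hab hs.1.le])
    rwa [unflatten_zero hlam ha, unflatten_one hlam ha hab] at this

theorem lineMeasure_restrict_Ioo (ha : 0 ≤ a) : (lineMeasure lam).restrict (Ioo a b) =
    (volume.restrict (Ioo a b)).withDensity fun x => ENNReal.ofReal (x ^ (2 * lam)) := by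
  unfold lineMeasure
  rw [restrict_withDensity measurableSet_Ioo, Measure.restrict_restrict measurableSet_Ioo,
    inter_eq_left.2 fun x (hx : x ∈ Ioo a b) => mem_Ioi.2 (ha.trans_lt hx.1)]

theorem hasDerivAt_flatten {x : ℝ} (hx : 0 < x) : HasDerivAt (flatten lam a b)
    ((2 * lam + 1) / (b ^ (2 * lam + 1) - a ^ (2 * lam + 1)) * x ^ (2 * lam)) x := by
  have := ((Real.hasDerivAt_rpow_const (p := 2 * lam + 1) (Or.inl hx.ne')).sub_const
    (a ^ (2 * lam + 1))).div_const (b ^ (2 * lam + 1) - a ^ (2 * lam + 1))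
  refine this.congr_deriv ?_
  rw [add_sub_cancel_right]
  ring

/-- The derivative of `flatten` is a constant multiple of the density `x ^ (2λ)`, so this is the
change of variables formula for a monotone function. -/
theorem map_flatten (hlam : 0 < lam) (ha : 0 ≤ a) (hab : a < b) :
    Measure.map (flatten lam a b) ((lineMeasure lam).restrict (Ioo a b)) =
      lineMeasure lam (Ioo a b) • volume.restrict (Ioo 0 1) := by
  have hD := rpow_sub_rpow_pos hlam ha hab
  set D := b ^ (2 * lam + 1) - a ^ (2 * lam + 1) with hDdef
  have hk : 0 < 2 * lam + 1 := by linarith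
  have key : ∀ A, MeasurableSet A → (lineMeasure lam).restrict (Ioo a b)
      (flatten lam a b ⁻¹' A) = ENNReal.ofReal (D / (2 * lam + 1)) * volume (A ∩ Ioo 0 1) := by
    intro A hA
    have hm := measurable_flatten (lam := lam) (a := a) (b := b) hA
    have hs : MeasurableSet (flatten lam a b ⁻¹' A ∩ Ioo a b) := hm.inter measurableSet_Ioo
    rw [lineMeasure_restrict_Ioo ha, withDensity_apply _ hm, Measure.restrict_restrict hm,
      ← flatten_image_Ioo hlam ha hab, inter_comm A, ← image_inter_preimage, inter_comm (Ioo a b),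
      ← lintegral_deriv_eq_volume_image_of_monotoneOn hs
        (fun x hx => (hasDerivAt_flatten (ha.trans_lt hx.2.1)).hasDerivWithinAt),
      ← lintegral_const_mul' _ _ ENNReal.ofReal_ne_top]
    · refine setLIntegral_congr_fun hs fun x hx => ?_
      rw [← ENNReal.ofReal_mul (by positivity), ← hDdef]
      congr 1
      field_simp
    · intro x hx y hy hxy
      rcases hxy.eq_or_lt with rfl | h
      · exact le_rfl
      · exact ((flatten_lt_flatten hlam ha hab (ha.trans hx.2.1.le) (ha.trans hy.2.1.le)).2 h).le
  -- Testing the formula on the whole line identifies the constant as the mass of the interval.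
  have hc : lineMeasure lam (Ioo a b) = ENNReal.ofReal (D / (2 * lam + 1)) := by
    have := key univ MeasurableSet.univ
    simpa using this
  ext A hA
  rw [Measure.map_apply measurable_flatten hA, key A hA, hc, Measure.smul_apply, smul_eq_mul,
    Measure.restrict_apply hA]

theorem lineMeasure_Ioo (hlam : 0 < lam) (ha : 0 ≤ a) (hab : a < b) :
    lineMeasure lam (Ioo a b) ≠ 0 ∧ lineMeasure lam (Ioo a b) ≠ ∞ := by
  constructor
  · have h : (volume.restrict (Ioo a b)) ≪ (lineMeasure lam).restrict (Ioo a b) := by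
      rw [lineMeasure_restrict_Ioo ha]
      refine withDensity_absolutelyContinuous' (by fun_prop) ?_
      rw [ae_restrict_iff' measurableSet_Ioo]
      refine Filter.Eventually.of_forall fun x hx => ?_
      have := Real.rpow_pos_of_pos (ha.trans_lt hx.1) (2 * lam)
      simpa using this
    intro h0
    have := h (s := univ) (by simpa using h0)
    simp only [Measure.restrict_apply_univ, Real.volume_Ioo, ENNReal.ofReal_eq_zero,
      sub_nonpos] at this
    exact absurd hab this.not_gt
  · have : (lineMeasure lam).restrict (Ioo a b) univ < ∞ := by
      rw [lineMeasure_restrict_Ioo ha, withDensity_apply _ MeasurableSet.univ,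
        Measure.restrict_univ]
      calc ∫⁻ x in Ioo a b, ENNReal.ofReal (x ^ (2 * lam))
          ≤ ∫⁻ x in Ioo a b, ENNReal.ofReal (b ^ (2 * lam)) := by
            refine setLIntegral_mono measurable_const fun x hx => ENNReal.ofReal_le_ofReal ?_
            exact Real.rpow_le_rpow (ha.trans hx.1.le) hx.2.le (by linarith)
        _ < ∞ := by
            rw [lintegral_const]
            exact ENNReal.mul_lt_top ENNReal.ofReal_lt_top (by simp)
    simpa using this.ne

theorem interval_eq_Ioo (x t : ℝ) : interval x t = Ioo (max (x - t) 0) (x + t) := by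
  unfold interval
  ext; simp only [mem_inter_iff, mem_Ioi, mem_Ioo, max_lt_iff]; tauto

end Line

/-- Intersecting with the half-line only replaces a negative left endpoint by 0. Conversely, the
midpoint and half-length of an interval serve as centre and radius. -/
theorem isRectangle_iff {R : Set (ℝ × ℝ)} : IsRectangle R ↔ ∃ a b c d : ℝ, 0 ≤ a ∧ a < b ∧ 0 ≤ c ∧
    c < d ∧ R = Ioo a b ×ˢ Ioo c d := by
  constructor
  · rintro ⟨x, t, y, u, hx, ht, hy, hu, rfl⟩
    refine ⟨_, _, _, _, le_max_right _ _, ?_, le_max_right _ _, ?_,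
      by rw [interval_eq_Ioo x t, interval_eq_Ioo y u]⟩
    · exact max_lt (by linarith) (by linarith)
    · exact max_lt (by linarith) (by linarith)
  · rintro ⟨a, b, c, d, ha, hab, hc, hcd, rfl⟩
    refine ⟨(a + b) / 2, (b - a) / 2, (c + d) / 2, (d - c) / 2, by linarith, by linarith,
      by linarith, by linarith, ?_⟩
    have e : ∀ a b : ℝ, (a + b) / 2 - (b - a) / 2 = a ∧ (a + b) / 2 + (b - a) / 2 = b :=
      fun a b => ⟨by ring, by ring⟩
    rw [interval_eq_Ioo, interval_eq_Ioo, (e a b).1, (e a b).2, (e c d).1, (e c d).2,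
      max_eq_left ha, max_eq_left hc]

theorem IsRectangle.measure_ne {lam : ℝ} (hlam : 0 < lam) {R : Set (ℝ × ℝ)} (hR : IsRectangle R) :
    planeMeasure lam R ≠ 0 ∧ planeMeasure lam R ≠ ∞ := by
  obtain ⟨a, b, c, d, ha, hab, hc, hcd, rfl⟩ := isRectangle_iff.1 hR
  rw [planeMeasure, Measure.prod_prod]
  exact ⟨mul_ne_zero (lineMeasure_Ioo hlam ha hab).1 (lineMeasure_Ioo hlam hc hcd).1,
    ENNReal.mul_ne_top (lineMeasure_Ioo hlam ha hab).2 (lineMeasure_Ioo hlam hc hcd).2⟩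

/-- Coordinates on a rectangle which transport the normalized measure to Lebesgue measure on the
unit square and cells of the unit square to rectangles. -/
structure Chart (lam : ℝ) (R : Set (ℝ × ℝ)) where
  /-- The coordinates. -/
  map : ℝ × ℝ → ℝ × ℝ
  /-- The inverse of the coordinates. -/
  inv : ℝ × ℝ → ℝ × ℝ
  measurable_map : Measurable map
  measurable_inv : Measurable inv
  map_eq : Measure.map map ((planeMeasure lam).restrict R) =
    planeMeasure lam R • volume.restrict Cell.root.set
  inv_map : ∀ x ∈ R, inv (map x) = x
  map_mem : ∀ x ∈ R, map x ∈ Cell.root.set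
  exists_rectangle : ∀ Q : Cell, ∃ R', IsRectangle R' ∧ R' ⊆ R ∧
    R' =ᵐ[planeMeasure lam] (R ∩ map ⁻¹' Q.set : Set (ℝ × ℝ))

/-- The coordinates are flattened separately. Monotonicity makes the preimage of a product of open
intervals again such a product, and the edges which distinguish it from a half-open cell are null.
-/
theorem IsRectangle.exists_chart {lam : ℝ} (hlam : 0 < lam) {R : Set (ℝ × ℝ)}
    (hR : IsRectangle R) : Nonempty (Chart lam R) := by
  have hRm := hR.measurableSet
  obtain ⟨a, b, c, d, ha, hab, hc, hcd, rfl⟩ := isRectangle_iff.1 hR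
  have hmeas : Measurable (Prod.map (flatten lam a b) (flatten lam c d)) :=
    measurable_flatten.prodMap measurable_flatten
  have hunit : (volume.restrict (Ioo (0 : ℝ) 1)).prod (volume.restrict (Ioo (0 : ℝ) 1)) =
      volume.restrict Cell.root.set := by
    rw [Measure.prod_restrict, ← Measure.volume_eq_prod]
    refine Measure.restrict_congr_set ?_
    rw [Measure.volume_eq_prod, Cell.set]
    simp only [Cell.root, zero_add]
    exact Measure.set_prod_ae_eq Ioo_ae_eq_Ico Ioo_ae_eq_Ico
  have hmap : Measure.map (Prod.map (flatten lam a b) (flatten lam c d))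
      ((planeMeasure lam).restrict (Ioo a b ×ˢ Ioo c d)) =
      planeMeasure lam (Ioo a b ×ˢ Ioo c d) • volume.restrict Cell.root.set := by
    rw [planeMeasure, ← Measure.prod_restrict,
      ← Measure.map_prod_map _ _ measurable_flatten measurable_flatten,
      map_flatten hlam ha hab, map_flatten hlam hc hcd, Measure.prod_smul_left,
      Measure.prod_smul_right, Measure.prod_prod, hunit, smul_smul]
  refine ⟨⟨Prod.map (flatten lam a b) (flatten lam c d),
    Prod.map (unflatten lam a b) (unflatten lam c d), hmeas,
    measurable_unflatten.prodMap measurable_unflatten, hmap, ?_, ?_, ?_⟩⟩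
  · rintro ⟨x, y⟩ ⟨hx, hy⟩
    simp only [Prod.map_apply]
    rw [unflatten_flatten hlam ha hab (ha.trans hx.1.le),
      unflatten_flatten hlam hc hcd (hc.trans hy.1.le)]
  · rintro ⟨x, y⟩ ⟨hx, hy⟩
    have h1 := (flatten_image_Ioo hlam ha hab).le (mem_image_of_mem _ hx)
    have h2 := (flatten_image_Ioo hlam hc hcd).le (mem_image_of_mem _ hy)
    simp only [Cell.set, Cell.root, zero_add]
    exact ⟨Ioo_subset_Ico_self h1, Ioo_subset_Ico_self h2⟩
  · intro Q
    have hs := Q.s_nonneg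
    have ht := Q.t_nonneg
    have hr := Q.r_pos
    have sub : ∀ {a b s : ℝ}, 0 ≤ a → a < b → 0 ≤ s → s + Q.r ≤ 1 →
          Ioo (unflatten lam a b s) (unflatten lam a b (s + Q.r)) ⊆ Ioo a b := by
        intro a b s ha hab hs h1 x hx
        have hx0 := (unflatten_nonneg hlam ha hab hs).trans hx.1.le
        rw [← flatten_mem_Ioo_iff hlam ha hab hx0 hs (by linarith)] at hx
        have : flatten lam a b x ∈ Ioo 0 1 := ⟨hs.trans_lt hx.1, hx.2.trans_le h1⟩
        rw [flatten_mem_Ioo_iff hlam ha hab hx0 le_rfl zero_le_one, unflatten_zero hlam ha,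
          unflatten_one hlam ha hab] at this
        exact this
    have hsub := prod_mono (sub ha hab hs Q.s_le) (sub hc hcd ht Q.t_le)
    have hopen : Ioo (unflatten lam a b Q.s) (unflatten lam a b (Q.s + Q.r)) ×ˢ
          Ioo (unflatten lam c d Q.t) (unflatten lam c d (Q.t + Q.r)) ∩ Ioo a b ×ˢ Ioo c d =
          Ioo a b ×ˢ Ioo c d ∩ Prod.map (flatten lam a b) (flatten lam c d) ⁻¹'
            (Ioo Q.s (Q.s + Q.r) ×ˢ Ioo Q.t (Q.t + Q.r)) := by
        ext ⟨x, y⟩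
        simp only [mem_inter_iff, mem_prod, mem_preimage, Prod.map_apply]
        constructor
        · rintro ⟨⟨h1, h2⟩, h3, h4⟩
          exact ⟨⟨h3, h4⟩, (flatten_mem_Ioo_iff hlam ha hab (ha.trans h3.1.le) hs
            (by linarith)).2 h1, (flatten_mem_Ioo_iff hlam hc hcd (hc.trans h4.1.le) ht
            (by linarith)).2 h2⟩
        · rintro ⟨⟨h3, h4⟩, h1, h2⟩
          exact ⟨⟨(flatten_mem_Ioo_iff hlam ha hab (ha.trans h3.1.le) hs
            (by linarith)).1 h1, (flatten_mem_Ioo_iff hlam hc hcd (hc.trans h4.1.le) ht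
            (by linarith)).1 h2⟩, h3, h4⟩
    rw [inter_eq_left.2 hsub] at hopen
    refine ⟨Ioo (unflatten lam a b Q.s) (unflatten lam a b (Q.s + Q.r)) ×ˢ
      Ioo (unflatten lam c d Q.t) (unflatten lam c d (Q.t + Q.r)), ?_, hsub, ?_⟩
    · exact isRectangle_iff.2 ⟨_, _, _, _, unflatten_nonneg hlam ha hab hs,
        unflatten_lt_unflatten hlam ha hab hs (by linarith), unflatten_nonneg hlam hc hcd ht,
        unflatten_lt_unflatten hlam hc hcd ht (by linarith), rfl⟩
    · rw [hopen]
      have hae : (Ioo Q.s (Q.s + Q.r) ×ˢ Ioo Q.t (Q.t + Q.r) : Set (ℝ × ℝ)) =ᵐ[volume] Q.set := by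
        rw [Measure.volume_eq_prod, Cell.set]
        exact Measure.set_prod_ae_eq Ioo_ae_eq_Ico Ioo_ae_eq_Ico
      -- The null edges are pulled back from the square through the image measure.
      have hae' : ∀ᵐ y ∂(Measure.map (Prod.map (flatten lam a b) (flatten lam c d))
          ((planeMeasure lam).restrict (Ioo a b ×ˢ Ioo c d))),
          y ∈ (Ioo Q.s (Q.s + Q.r) ×ˢ Ioo Q.t (Q.t + Q.r) : Set (ℝ × ℝ)) ↔ y ∈ Q.set := by
        rw [hmap]
        refine Measure.ae_smul_measure (ae_restrict_of_ae ?_) _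
        filter_upwards [hae] with y hy
        exact iff_of_eq hy
      have := (ae_restrict_iff' hRm).1 (ae_of_ae_map hmeas.aemeasurable hae')
      filter_upwards [this] with x hx
      exact propext (and_congr_right hx)

/-! ### The John–Nirenberg inequality on rectangles -/

namespace Chart

variable {lam : ℝ} {R : Set (ℝ × ℝ)} (c : Chart lam R)

theorem measurableSet_preimage (Q : Cell) : MeasurableSet (c.map ⁻¹' Q.set) :=
  c.measurable_map Q.measurableSet_set

theorem measure_cell (Q : Cell) :
    planeMeasure lam (R ∩ c.map ⁻¹' Q.set) = planeMeasure lam R * ENNReal.ofReal (Q.r ^ 2) := by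
  rw [inter_comm, ← Measure.restrict_apply (c.measurableSet_preimage Q),
    ← Measure.map_apply c.measurable_map Q.measurableSet_set, c.map_eq, Measure.smul_apply,
    Measure.restrict_apply Q.measurableSet_set, inter_eq_left.2 Q.set_subset_root, Q.volume_set,
    smul_eq_mul]

theorem lintegral_comp_map {g : ℝ × ℝ → ℝ≥0∞} (hg : Measurable g) :
    ∫⁻ x in R, g (c.map x) ∂(planeMeasure lam) =
      planeMeasure lam R * ∫⁻ y in Cell.root.set, g y := by
  rw [← lintegral_map hg c.measurable_map, c.map_eq, lintegral_smul_measure, smul_eq_mul]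

theorem integrableOn_comp_inv {E : Type*} [NormedAddCommGroup E] (hR : MeasurableSet R)
    (h0 : planeMeasure lam R ≠ 0) (hi : planeMeasure lam R ≠ ∞) {f : ℝ × ℝ → E}
    (hf : StronglyMeasurable f) (hfi : IntegrableOn f R (planeMeasure lam)) :
    IntegrableOn (fun y => f (c.inv y)) Cell.root.set := by
  have h1 : Integrable (fun x => f (c.inv (c.map x))) ((planeMeasure lam).restrict R) := by
    refine Integrable.congr hfi ?_
    filter_upwards [ae_restrict_mem hR] with x hx
    rw [c.inv_map x hx]
  have hm : StronglyMeasurable fun y => f (c.inv y) := hf.comp_measurable c.measurable_inv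
  have h2 := (integrable_map_measure hm.aestronglyMeasurable c.measurable_map.aemeasurable).2 h1
  rw [c.map_eq, integrable_smul_measure h0 hi] at h2
  exact h2

/-- The factor `μ_λ(R)` from the image measure cancels in the quotient, so averages over cells are
averages over rectangles up to a null set. -/
theorem avg_comp_inv {E : Type*} [NormedAddCommGroup E] [NormedSpace ℝ E] (hR : MeasurableSet R)
    (h0 : planeMeasure lam R ≠ 0) (hi : planeMeasure lam R ≠ ∞) {f : ℝ × ℝ → E}
    (hf : StronglyMeasurable f) (Q : Cell) :
    Q.avg (fun y => f (c.inv y)) = ⨍ x in R ∩ c.map ⁻¹' Q.set, f x ∂(planeMeasure lam) := by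
  have hm : StronglyMeasurable fun y => f (c.inv y) := hf.comp_measurable c.measurable_inv
  have h1 : ∫ x in R ∩ c.map ⁻¹' Q.set, f x ∂(planeMeasure lam) =
      (planeMeasure lam).real R • ∫ y in Q.set, f (c.inv y) := by
    have h2 := setIntegral_map (μ := (planeMeasure lam).restrict R) Q.measurableSet_set
      hm.aestronglyMeasurable c.measurable_map.aemeasurable
    rw [c.map_eq, Measure.restrict_smul, Measure.restrict_restrict Q.measurableSet_set,
      inter_eq_left.2 Q.set_subset_root, integral_smul_measure,
      Measure.restrict_restrict (c.measurableSet_preimage Q), inter_comm] at h2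
    rw [Measure.real, h2]
    refine setIntegral_congr_fun (hR.inter (c.measurableSet_preimage Q)) fun x hx => ?_
    rw [c.inv_map x hx.1]
  have hv : (planeMeasure lam).real R ≠ 0 := ENNReal.toReal_ne_zero.2 ⟨h0, hi⟩
  have hr := Q.r_pos
  rw [Cell.avg, setAverage_eq, h1, Measure.real, c.measure_cell, ENNReal.toReal_mul,
    ENNReal.toReal_ofReal (sq_nonneg _), ← Measure.real, smul_smul]
  congr 1
  field_simp

theorem root_cell : R ∩ c.map ⁻¹' Cell.root.set = R := inter_eq_left.2 fun x hx => c.map_mem x hx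

end Chart

theorem average_norm_sub_eq_meanOsc {lam : ℝ} {R : Set (ℝ × ℝ)} {f : ℝ × ℝ → ℂ}
    (hf : Measurable f) :
    ⨍ x in R, ‖f x - ⨍ y in R, f y ∂(planeMeasure lam)‖ ∂(planeMeasure lam) =
      (meanOsc lam f R).toReal := by
  rw [setAverage_eq, meanOsc, ENNReal.toReal_mul, ENNReal.toReal_inv, smul_eq_mul, Measure.real]
  congr 1
  exact integral_norm_eq_lintegral_enorm (hf.sub_const _).aestronglyMeasurable

/-- The John–Nirenberg inequality of the unit square, transported by a chart. The oscillation
hypothesis is needed on the subrectangles of `R` that correspond to cells. -/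
theorem setLIntegral_pow_le {lam : ℝ} (hlam : 0 < lam) {R : Set (ℝ × ℝ)} (hR : IsRectangle R)
    {f : ℝ × ℝ → ℂ} (hf : Measurable f) {M : ℝ} (hM : 0 < M)
    (hosc : ∀ R', IsRectangle R' → meanOsc lam f R' ≤ ENNReal.ofReal M) (n : ℕ) :
    ∫⁻ x in R, ‖f x - ⨍ y in R, f y ∂(planeMeasure lam)‖ₑ ^ n ∂(planeMeasure lam) ≤
      ENNReal.ofReal (4 * n.factorial * (8 / Real.log 2) ^ n * M ^ n) * planeMeasure lam R := by
  obtain ⟨c⟩ := hR.exists_chart hlam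
  obtain ⟨h0, hi⟩ := hR.measure_ne hlam
  have hbmo : bmoNorm lam f < ∞ := (iSup₂_le hosc).trans_lt ENNReal.ofReal_lt_top
  have hfi : IntegrableOn f R (planeMeasure lam) :=
    integrableOn_of_bmoNorm hf.aestronglyMeasurable hbmo hR hi
  have hF := c.integrableOn_comp_inv hR.measurableSet h0 hi hf.stronglyMeasurable hfi
  have hFm : Measurable fun y => f (c.inv y) := hf.comp c.measurable_inv
  have hav := c.avg_comp_inv hR.measurableSet h0 hi hf.stronglyMeasurable
  have hosc' : ∀ Q : Cell, Q.avg (fun y => ‖f (c.inv y) - Q.avg fun y => f (c.inv y)‖) ≤ M := by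
    intro Q
    obtain ⟨R', hR', -, hae⟩ := c.exists_rectangle Q
    rw [hav Q, c.avg_comp_inv (f := fun x => ‖f x - _‖) hR.measurableSet h0 hi
      (hf.sub_const _).norm.stronglyMeasurable Q, setAverage_congr hae.symm,
      setAverage_congr hae.symm, average_norm_sub_eq_meanOsc hf]
    exact ENNReal.toReal_le_of_le_ofReal hM.le (hosc R' hR')
  have key := Cell.lintegral_pow_le hF hM hosc' n
  rw [hav Cell.root, c.root_cell] at key
  rw [mul_comm]
  calc _ = ∫⁻ x in R, ENNReal.ofReal (‖f (c.inv (c.map x)) -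
        ⨍ y in R, f y ∂(planeMeasure lam)‖ ^ n) ∂(planeMeasure lam) := by
        refine setLIntegral_congr_fun hR.measurableSet fun x hx => ?_
        rw [c.inv_map x hx, ENNReal.ofReal_pow (norm_nonneg _), ofReal_norm]
    _ = _ := c.lintegral_comp_map (g := fun y => ENNReal.ofReal (‖f (c.inv y) -
        ⨍ y in R, f y ∂(planeMeasure lam)‖ ^ n))
        ((hFm.sub_const _).norm.pow_const n).ennreal_ofReal
    _ ≤ _ := by gcongr

/-- The moment inequality is available for integers; an integer `n ≥ p` and Hölder on the finite
measure space `R` give the exponent `p`. -/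
theorem exists_eLpNorm_sub_average_le {lam : ℝ} (hlam : 0 < lam) {p : ℝ≥0∞} (hp : 1 ≤ p)
    (hpt : p ≠ ∞) : ∃ K : ℝ, 0 < K ∧ ∀ R, IsRectangle R → ∀ f : ℝ × ℝ → ℂ, Measurable f →
      ∀ M : ℝ, 0 < M → (∀ R', IsRectangle R' → meanOsc lam f R' ≤ ENNReal.ofReal M) →
      eLpNorm (fun x => f x - ⨍ y in R, f y ∂(planeMeasure lam)) p ((planeMeasure lam).restrict R)
        ≤ ENNReal.ofReal (K * M) * planeMeasure lam R ^ p.toReal⁻¹ := by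
  obtain ⟨n, hn⟩ := exists_nat_ge p.toReal
  have hpn : p ≤ n := by
    rw [← ENNReal.ofReal_toReal hpt, ← ENNReal.ofReal_natCast]
    exact ENNReal.ofReal_le_ofReal hn
  have hp1 : 1 ≤ p.toReal := by
    rw [← ENNReal.toReal_one]; exact ENNReal.toReal_mono hpt hp
  have hn0 : (0 : ℝ) < n := by linarith
  have hl : 0 < Real.log 2 := Real.log_pos one_lt_two
  have hn0' : n ≠ 0 := by rintro rfl; simp at hn0
  refine ⟨(4 * n.factorial) ^ (n : ℝ)⁻¹ * (8 / Real.log 2), by positivity, ?_⟩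
  intro R hR f hf M hM hosc
  obtain ⟨h0, hi⟩ := hR.measure_ne hlam
  have h1 := setLIntegral_pow_le hlam hR hf hM hosc n
  have h2 : eLpNorm (fun x => f x - ⨍ y in R, f y ∂(planeMeasure lam)) n
      ((planeMeasure lam).restrict R) ≤ ENNReal.ofReal ((4 * n.factorial) ^ (n : ℝ)⁻¹ *
        (8 / Real.log 2) * M) * planeMeasure lam R ^ (n : ℝ)⁻¹ := by
    rw [eLpNorm_eq_lintegral_rpow_enorm_toReal (by exact_mod_cast hn0') (by simp)]
    simp only [ENNReal.toReal_natCast, ENNReal.rpow_natCast, one_div]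
    refine (ENNReal.rpow_le_rpow h1 (by positivity)).trans_eq ?_
    rw [ENNReal.mul_rpow_of_nonneg _ _ (by positivity),
      ENNReal.ofReal_rpow_of_nonneg (by positivity) (by positivity), mul_assoc, ← mul_pow,
      Real.mul_rpow (by positivity) (by positivity), Real.pow_rpow_inv_natCast (by positivity) hn0',
      mul_assoc]
  refine (eLpNorm_le_eLpNorm_mul_rpow_measure_univ hpn
    (hf.sub_const _).aestronglyMeasurable).trans ?_
  rw [Measure.restrict_apply_univ, ENNReal.toReal_natCast]
  calc _ ≤ ENNReal.ofReal ((4 * n.factorial) ^ (n : ℝ)⁻¹ *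
        (8 / Real.log 2) * M) * planeMeasure lam R ^ (n : ℝ)⁻¹ *
        planeMeasure lam R ^ (1 / p.toReal - 1 / n) := by gcongr
    _ = _ := by
      rw [mul_assoc, ← ENNReal.rpow_add _ _ h0 hi]
      congr 2
      ring

/-! ### Completeness of the little Hardy space and its bounded elements -/

namespace LittleHardy

variable {lam : ℝ} {q : ℝ≥0∞}

theorem toLp_injective : Function.Injective (toLp : LittleHardy lam q → _) :=
  Subtype.val_injective

/-- The inclusion of `h^{1,q}(ℝ_λ)` into `L¹(ℝ_λ)`, as a continuous linear map. -/
def toLpCLM (lam : ℝ) (q : ℝ≥0∞) [hq : Fact (1 < q)] :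
    LittleHardy lam q →L[ℂ] Lp ℂ 1 (planeMeasure lam) :=
  LinearMap.mkContinuous
    { toFun := toLp
      map_add' := fun _ _ => rfl
      map_smul' := fun _ _ => rfl } 1 fun f => by
    rw [one_mul]
    exact norm_le_atomicNorm hq.out f.mem

@[simp] theorem toLpCLM_apply [Fact (1 < q)] (f : LittleHardy lam q) :
    toLpCLM lam q f = f.toLp := rfl

theorem norm_le_of_decomposition {f : LittleHardy lam q} {α : ℕ → ℂ}
    {a : ℕ → Lp ℂ 1 (planeMeasure lam)} (h : IsAtomicDecomposition lam q f.toLp α a) :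
    ‖f‖ ≤ ∑' i, ‖α i‖ := atomicNorm_le h

/-- Nearly optimal decompositions of all the terms are merged into one, indexed by pairs. The strict
inequality is what permits choosing them with total coefficient below `v k`. -/
theorem exists_hasSum_toLp [hq : Fact (1 < q)] {u : ℕ → LittleHardy lam q} {v : ℕ → ℝ}
    (hv : Summable v) (huv : ∀ k, ‖u k‖ < v k) :
    ∃ g : LittleHardy lam q, HasSum (fun k => (u k).toLp) g.toLp ∧ ‖g‖ ≤ ∑' k, v k := by
  choose α a hd hlt using fun k => exists_lt_of_atomicNorm_lt (u k).mem (huv k)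
  have hs : Summable fun x : ℕ × ℕ => ‖α x.1 x.2‖ := by
    rw [summable_prod_of_nonneg fun _ => norm_nonneg _]
    exact ⟨fun k => (hd k).summable, hv.of_nonneg_of_le
      (fun k => tsum_nonneg fun _ => norm_nonneg _) fun k => (hlt k).le⟩
  have hs' : Summable fun x : ℕ × ℕ => α x.1 x.2 • a x.1 x.2 := by
    refine Summable.of_norm_bounded hs fun x => ?_
    rw [norm_smul]
    exact mul_le_of_le_one_right (norm_nonneg _) (((hd x.1).isAtom x.2).norm_le_one hq.out)
  obtain ⟨e⟩ : Nonempty (ℕ ≃ ℕ × ℕ) := ⟨Nat.pairEquiv.symm⟩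
  have hdec : IsAtomicDecomposition lam q (∑' x : ℕ × ℕ, α x.1 x.2 • a x.1 x.2)
      (fun i => α (e i).1 (e i).2) (fun i => a (e i).1 (e i).2) :=
    ⟨fun i => (hd _).isAtom _, e.summable_iff.2 hs, e.hasSum_iff.2 hs'.hasSum⟩
  let g : LittleHardy lam q := ⟨_, _, _, hdec⟩
  refine ⟨g, HasSum.prod_fiberwise hs'.hasSum fun k => (hd k).hasSum,
    (norm_le_of_decomposition (f := g) hdec).trans ?_⟩
  rw [e.tsum_eq (fun x : ℕ × ℕ => ‖α x.1 x.2‖), hs.tsum_prod]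
  exact hs.prod.tsum_le_tsum (fun k => (hlt k).le) hv

theorem completeSpace (lam : ℝ) (q : ℝ≥0∞) [Fact (1 < q)] : CompleteSpace (LittleHardy lam q) := by
  refine NormedAddCommGroup.completeSpace_of_summable_imp_tendsto fun u hu => ?_
  -- The norm is an infimum that need not be attained, so each term receives a summable slack.
  have hv : Summable fun k => ‖u k‖ + (1 / 2 : ℝ) ^ k :=
    hu.add (summable_geometric_of_lt_one (by norm_num) (by norm_num))
  have hlt : ∀ k, ‖u k‖ < ‖u k‖ + (1 / 2 : ℝ) ^ k := fun k => lt_add_of_pos_right _ (by positivity)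
  obtain ⟨g, hg, -⟩ := exists_hasSum_toLp hv hlt
  refine ⟨g, ?_⟩
  rw [tendsto_iff_norm_sub_tendsto_zero]
  have htail := tendsto_sum_nat_add fun k => ‖u k‖ + (1 / 2 : ℝ) ^ k
  refine squeeze_zero (fun _ => norm_nonneg _) (fun n => ?_) htail
  obtain ⟨r, hr, hrn⟩ := exists_hasSum_toLp (u := fun k => u (k + n))
    (v := fun k => ‖u (k + n)‖ + (1 / 2 : ℝ) ^ (k + n)) 
    ((summable_nat_add_iff (f := fun k => ‖u k‖ + (1 / 2 : ℝ) ^ k) n).2 hv)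
    fun k => hlt (k + n)
  -- The `L¹` sum `g` minus a partial sum is the element `r` built from the tail, whose Hardy norm
  -- is bounded by the tail of the majorant.
  have h1 := (hasSum_nat_add_iff (f := fun k => (u k).toLp) n).1 hr
  have h2 : g = r + ∑ i ∈ Finset.range n, u i := by
    apply toLp_injective
    rw [hg.unique h1, ← toLpCLM_apply (r + _), map_add, map_sum]
    simp only [toLpCLM_apply]
  rw [norm_sub_rev, h2, add_sub_cancel_right]
  exact hrn

/-- Dividing by a positive bound `B ≥ A` yields an atom. Since `A` may vanish, the norm estimate is
reached by letting `B` decrease to `A`. -/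
theorem exists_toLp_eq_of_eLpNorm_le [Fact (1 < q)] {f : Lp ℂ 1 (planeMeasure lam)}
    (hf : MemLp f q (planeMeasure lam)) {R : Set (ℝ × ℝ)} (hR : IsRectangle R)
    (hsupp : ∀ᵐ x ∂(planeMeasure lam), x ∉ R → f x = 0) (h0 : ∫ x, f x ∂(planeMeasure lam) = 0)
    {A : ℝ} (hA : 0 ≤ A) (hle : eLpNorm f q (planeMeasure lam) ≤
      ENNReal.ofReal A * planeMeasure lam R ^ ((q⁻¹).toReal - 1)) :
    ∃ u : LittleHardy lam q, u.toLp = f ∧ ‖u‖ ≤ A := by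
  have key : ∀ B : ℝ, 0 < B → A ≤ B → ∃ α a, IsAtomicDecomposition lam q f α a ∧
      ∑' i, ‖α i‖ = B := by
    intro B hB hAB
    have hBC : (B : ℂ) ≠ 0 := by exact_mod_cast hB.ne'
    have hco : ((B⁻¹ : ℂ) • f : Lp ℂ 1 (planeMeasure lam)) =ᵐ[planeMeasure lam]
      (B⁻¹ : ℂ) • (f : ℝ × ℝ → ℂ) := Lp.coeFn_smul _ _
    have hat : IsAtom lam q ((B⁻¹ : ℂ) • f) := by
      refine ⟨(memLp_congr_ae hco).2 (hf.const_smul _), ⟨R, hR, ?_, ?_⟩, ?_⟩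
      · filter_upwards [hco, hsupp] with x hx hs hxR
        rw [hx, Pi.smul_apply, hs hxR, smul_zero]
      · rw [eLpNorm_congr_ae hco, eLpNorm_const_smul]
        have hn : ‖(B⁻¹ : ℂ)‖ₑ = (ENNReal.ofReal B)⁻¹ := by
          rw [← ofReal_norm, norm_inv, Complex.norm_real, Real.norm_of_nonneg hB.le,
            ENNReal.ofReal_inv_of_pos hB]
        rw [hn]
        calc _ ≤ (ENNReal.ofReal B)⁻¹ * (ENNReal.ofReal B *
              planeMeasure lam R ^ ((q⁻¹).toReal - 1)) := by
              gcongr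
              exact hle.trans (by gcongr)
          _ = _ := by
              rw [← mul_assoc, ENNReal.inv_mul_cancel (by simpa using hB) ENNReal.ofReal_ne_top,
                one_mul]
      · rw [integral_congr_ae hco]
        simp only [Pi.smul_apply]
        rw [integral_smul, h0, smul_zero]
    -- A single term, padded to a sequence by zero coefficients.
    refine ⟨Pi.single 0 (B : ℂ), fun _ => (B⁻¹ : ℂ) • f, ⟨fun _ => hat, ?_, ?_⟩, ?_⟩
    · refine summable_of_hasFiniteSupport ((Set.finite_singleton 0).subset fun i hi => ?_)
      by_contra h
      exact hi (by simp [Pi.single_eq_of_ne (show i ≠ 0 from h)])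
    · convert hasSum_single (f := fun i => (Pi.single 0 (B : ℂ) : ℕ → ℂ) i • ((B⁻¹ : ℂ) • f)) 0 ?_
      · rw [Pi.single_eq_same, smul_smul, mul_inv_cancel₀ hBC, one_smul]
      · intro i hi
        simp [Pi.single_eq_of_ne hi]
    · rw [tsum_eq_single 0 fun i hi => by simp [Pi.single_eq_of_ne hi]]
      simp [hB.le]
  obtain ⟨α, a, hd, -⟩ := key (A + 1) (by linarith) (by linarith)
  refine ⟨⟨f, α, a, hd⟩, rfl, le_of_forall_pos_le_add fun ε hε => ?_⟩
  obtain ⟨α', a', hd', hs⟩ := key (A + ε) (by linarith) (by linarith)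
  exact (norm_le_of_decomposition hd').trans hs.le

end LittleHardy

/-- The bounded measurable functions with integral zero which vanish outside `R`. -/
def bddMeanZero (lam : ℝ) (R : Set (ℝ × ℝ)) : Submodule ℂ (ℝ × ℝ → ℂ) where
  carrier := {f | Measurable f ∧ Integrable f (planeMeasure lam) ∧ (∀ x ∉ R, f x = 0) ∧
    (∃ K : ℝ, ∀ x, ‖f x‖ ≤ K) ∧ ∫ x, f x ∂(planeMeasure lam) = 0}
  zero_mem' := ⟨measurable_zero, integrable_zero _ _ _, fun _ _ => rfl, ⟨0, fun _ => by simp⟩,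
    by simp⟩
  add_mem' := by
    rintro f g ⟨h1, h2, h3, ⟨K, h4⟩, h5⟩ ⟨k1, k2, k3, ⟨L, k4⟩, k5⟩
    refine ⟨h1.add k1, h2.add k2, fun x hx => ?_, ⟨K + L, fun x => ?_⟩, ?_⟩
    · rw [Pi.add_apply, h3 x hx, k3 x hx, add_zero]
    · exact (norm_add_le _ _).trans (add_le_add (h4 x) (k4 x))
    · simp only [Pi.add_apply]
      rw [integral_add h2 k2, h5, k5, add_zero]
  smul_mem' := by
    rintro z f ⟨h1, h2, h3, ⟨K, h4⟩, h5⟩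
    refine ⟨h1.const_smul z, h2.smul z, fun x hx => ?_, ⟨‖z‖ * K, fun x => ?_⟩, ?_⟩
    · rw [Pi.smul_apply, h3 x hx, smul_zero]
    · rw [Pi.smul_apply, norm_smul]
      gcongr
      exact h4 x
    · simp only [Pi.smul_apply]
      rw [integral_smul, h5, smul_zero]

theorem mem_bddMeanZero_of_bound {lam : ℝ} {R : Set (ℝ × ℝ)} (hfin : planeMeasure lam R ≠ ∞)
    {f : ℝ × ℝ → ℂ} (hf : Measurable f) (hs : ∀ x ∉ R, f x = 0) {K : ℝ}
    (hK : ∀ x, ‖f x‖ ≤ K) (h0 : ∫ x, f x ∂(planeMeasure lam) = 0) : f ∈ bddMeanZero lam R := by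
  refine ⟨hf, ?_, hs, ⟨K, hK⟩, h0⟩
  have : IntegrableOn f R (planeMeasure lam) :=
    Measure.integrableOn_of_bounded (M := K) hfin hf.aestronglyMeasurable
      (Filter.Eventually.of_forall hK)
  exact (integrableOn_iff_integrable_of_support_subset fun x hx => by
    by_contra h; exact hx (hs x h)).1 this

theorem bddMeanZero_mono {lam : ℝ} {R R' : Set (ℝ × ℝ)} (h : R ⊆ R') :
    bddMeanZero lam R ≤ bddMeanZero lam R' := fun _ hf =>
  ⟨hf.1, hf.2.1, fun x hx => hf.2.2.1 x fun hxR => hx (h hxR), hf.2.2.2⟩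

section Embedding

variable {lam : ℝ} (q : ℝ≥0∞) [hq : Fact (1 < q)] {R : Set (ℝ × ℝ)}

/-- A function bounded by `K` on `R` has `L^q` norm at most `K μ(R) ^ (1/q) = K μ(R) * μ(R) ^ (1/q -
1)`. -/
theorem exists_hardy_of_bound (hlam : 0 < lam) {f : ℝ × ℝ → ℂ}
    (hf : Integrable f (planeMeasure lam)) (h0 : ∫ x, f x ∂(planeMeasure lam) = 0)
    (hR : IsRectangle R) (hs : ∀ᵐ x ∂(planeMeasure lam), x ∉ R → f x = 0) {K : ℝ} (hK0 : 0 ≤ K)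
    (hK : ∀ᵐ x ∂(planeMeasure lam), ‖f x‖ ≤ K) :
    ∃ u : LittleHardy lam q, u.toLp = hf.toL1 ∧ ‖u‖ ≤ K * (planeMeasure lam).real R := by
  obtain ⟨hR0, hRi⟩ := hR.measure_ne hlam
  have hco : (hf.toL1 : ℝ × ℝ → ℂ) =ᵐ[planeMeasure lam] f := hf.coeFn_toL1
  have hind : f =ᵐ[planeMeasure lam] R.indicator f := by
    filter_upwards [hs] with x hx
    by_cases hxR : x ∈ R
    · simp [hxR]
    · simp [hxR, hx hxR]
  have hle : eLpNorm f q (planeMeasure lam) ≤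
      ENNReal.ofReal (K * (planeMeasure lam).real R) *
        planeMeasure lam R ^ ((q⁻¹).toReal - 1) := by
    rw [eLpNorm_congr_ae hind, eLpNorm_indicator_eq_eLpNorm_restrict hR.measurableSet]
    refine (eLpNorm_le_of_ae_bound (ae_restrict_of_ae hK)).trans_eq ?_
    rw [Measure.restrict_apply_univ, ENNReal.ofReal_mul hK0, Measure.real,
      ENNReal.ofReal_toReal hRi, mul_comm, mul_assoc, ENNReal.rpow_sub _ _ hR0 hRi,
      ENNReal.rpow_one, ENNReal.mul_div_cancel hR0 hRi, ENNReal.toReal_inv]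
  refine LittleHardy.exists_toLp_eq_of_eLpNorm_le ?_ hR ?_ ?_ (by positivity)
    ((eLpNorm_congr_ae hco).trans_le hle)
  · rw [memLp_congr_ae hco]
    refine ⟨hf.1, hle.trans_lt ?_⟩
    exact ENNReal.mul_lt_top ENNReal.ofReal_lt_top
      (ENNReal.rpow_ne_top_of_ne_zero hR0 hRi).lt_top
  · filter_upwards [hco, hs] with x hx h hxR
    rw [hx, h hxR]
  · rw [integral_congr_ae hco, h0]

/-- The embedding of the bounded functions with integral zero on a rectangle into
`h^{1,q}(ℝ_λ)`. -/
def bddToHardy (hlam : 0 < lam) (hR : IsRectangle R) :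
    bddMeanZero lam R →ₗ[ℂ] LittleHardy lam q where
  toFun f := ⟨f.2.2.1.toL1, by
    obtain ⟨K, hK⟩ := f.2.2.2.2.1
    obtain ⟨u, hu, -⟩ := exists_hardy_of_bound q hlam f.2.2.1 f.2.2.2.2.2 hR
      (Filter.Eventually.of_forall f.2.2.2.1) ((norm_nonneg _).trans (hK 0))
      (Filter.Eventually.of_forall hK)
    rw [← hu]
    exact u.mem⟩
  map_add' f g := Subtype.ext (Integrable.toL1_add _ _ f.2.2.1 g.2.2.1)
  map_smul' z f := Subtype.ext (Integrable.toL1_smul _ f.2.2.1 z)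

theorem bddToHardy_ae_eq (hlam : 0 < lam) (hR : IsRectangle R) (f : bddMeanZero lam R) :
    ((bddToHardy q hlam hR f).toLp : ℝ × ℝ → ℂ) =ᵐ[planeMeasure lam] f :=
  f.2.2.1.coeFn_toL1

/-- The rectangle `R'` carrying `f` may be much smaller than the ambient `R`; functions living on a
single cell are estimated in this way. -/
theorem norm_bddToHardy_le (hlam : 0 < lam) (hR : IsRectangle R) (f : bddMeanZero lam R)
    {R' : Set (ℝ × ℝ)} (hR' : IsRectangle R')
    (hs : ∀ᵐ x ∂(planeMeasure lam), x ∉ R' → (f : ℝ × ℝ → ℂ) x = 0) {K : ℝ} (hK0 : 0 ≤ K)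
    (hK : ∀ x, ‖(f : ℝ × ℝ → ℂ) x‖ ≤ K) :
    ‖bddToHardy q hlam hR f‖ ≤ K * (planeMeasure lam).real R' := by
  obtain ⟨u, hu, hn⟩ := exists_hardy_of_bound q hlam f.2.2.1 f.2.2.2.2.2 hR' hs hK0
    (Filter.Eventually.of_forall hK)
  have : bddToHardy q hlam hR f = u := LittleHardy.toLp_injective hu.symm
  rwa [this]

end Embedding

/-! ### Truncation -/

/-- Truncation of the real and imaginary parts at height `N`. -/
def trunc (N : ℕ) (z : ℂ) : ℂ := ⟨max (-N) (min N z.re), max (-N) (min N z.im)⟩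

theorem abs_clamp_sub_clamp_le (N x y : ℝ) :
    |max (-N) (min N x) - max (-N) (min N y)| ≤ |x - y| :=
  calc _ ≤ max |(-N) - (-N)| |min N x - min N y| := abs_max_sub_max_le_max _ _ _ _
    _ = |min N x - min N y| := by simp
    _ ≤ max |N - N| |x - y| := abs_min_sub_min_le_max _ _ _ _
    _ = |x - y| := by simp

theorem abs_clamp_le {N : ℝ} (hN : 0 ≤ N) (x : ℝ) : |max (-N) (min N x)| ≤ N := by
  rw [abs_le]
  exact ⟨le_max_left _ _, max_le (by linarith) (min_le_left _ _)⟩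

/-- Each clamp is 1-Lipschitz; adding the real and imaginary parts costs the factor 2. -/
theorem norm_trunc_sub_trunc_le (N : ℕ) (z w : ℂ) : ‖trunc N z - trunc N w‖ ≤ 2 * ‖z - w‖ := by
  refine (Complex.norm_le_abs_re_add_abs_im _).trans ?_
  have h1 := abs_clamp_sub_clamp_le N z.re w.re
  have h2 := abs_clamp_sub_clamp_le N z.im w.im
  have h3 := Complex.abs_re_le_norm (z - w)
  have h4 := Complex.abs_im_le_norm (z - w)
  simp only [Complex.sub_re, Complex.sub_im, trunc] at *
  linarith

theorem trunc_zero (N : ℕ) : trunc N 0 = 0 := by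
  apply Complex.ext <;> simp [trunc]

theorem norm_trunc_le (N : ℕ) (z : ℂ) : ‖trunc N z‖ ≤ 2 * ‖z‖ := by
  simpa [trunc_zero] using norm_trunc_sub_trunc_le N z 0

theorem norm_trunc_le_nat (N : ℕ) (z : ℂ) : ‖trunc N z‖ ≤ 2 * N := by
  refine (Complex.norm_le_abs_re_add_abs_im _).trans ?_
  have h1 := abs_clamp_le (Nat.cast_nonneg (α := ℝ) N) z.re
  have h2 := abs_clamp_le (Nat.cast_nonneg (α := ℝ) N) z.im
  simp only [trunc]
  linarith

theorem tendsto_trunc (z : ℂ) : Filter.Tendsto (fun N => trunc N z) Filter.atTop (nhds z) := by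
  refine tendsto_const_nhds.congr' ?_
  obtain ⟨n, hn⟩ := exists_nat_ge ‖z‖
  filter_upwards [Filter.eventually_ge_atTop n] with N hN
  have h : ‖z‖ ≤ N := hn.trans (by exact_mod_cast hN)
  have h1 := abs_le.1 ((Complex.abs_re_le_norm z).trans h)
  have h2 := abs_le.1 ((Complex.abs_im_le_norm z).trans h)
  apply Complex.ext
  · simp only [trunc]; rw [min_eq_right h1.2, max_eq_right h1.1]
  · simp only [trunc]; rw [min_eq_right h2.2, max_eq_right h2.1]

theorem measurable_trunc (N : ℕ) : Measurable (trunc N) := by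
  refine (LipschitzWith.of_dist_le_mul (K := 2) fun z w => ?_).continuous.measurable
  rw [dist_eq_norm, dist_eq_norm]
  exact norm_trunc_sub_trunc_le N z w

/-! ### Mean oscillation -/

/-- The mean differs from `z` by at most the average of `‖g - z‖`, so replacing one by the other at
most doubles the oscillation. -/
theorem meanOsc_le_two_mul {lam : ℝ} (hlam : 0 < lam) {R : Set (ℝ × ℝ)} (hR : IsRectangle R)
    {g : ℝ × ℝ → ℂ} (hg : IntegrableOn g R (planeMeasure lam)) (z : ℂ) :
    meanOsc lam g R ≤
      2 * ((planeMeasure lam R)⁻¹ * ∫⁻ x in R, ‖g x - z‖ₑ ∂(planeMeasure lam)) := by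
  obtain ⟨h0, hi⟩ := hR.measure_ne hlam
  have hconst : IntegrableOn (fun _ => z) R (planeMeasure lam) := integrableOn_const hi
  have hv : (planeMeasure lam).real R ≠ 0 := ENNReal.toReal_ne_zero.2 ⟨h0, hi⟩
  have h1 : ⨍ y in R, g y ∂(planeMeasure lam) - z = ⨍ y in R, (g y - z) ∂(planeMeasure lam) := by
    rw [setAverage_eq, setAverage_eq, integral_sub hg hconst, setIntegral_const, smul_sub,
      smul_smul, inv_mul_cancel₀ hv, one_smul]
  have h2 : ‖⨍ y in R, g y ∂(planeMeasure lam) - z‖ₑ ≤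
      (planeMeasure lam R)⁻¹ * ∫⁻ x in R, ‖g x - z‖ₑ ∂(planeMeasure lam) := by
    rw [h1, setAverage_eq, enorm_smul]
    gcongr
    · rw [← ofReal_norm, norm_inv, Real.norm_of_nonneg measureReal_nonneg,
        ENNReal.ofReal_inv_of_pos (lt_of_le_of_ne measureReal_nonneg hv.symm), Measure.real,
        ENNReal.ofReal_toReal hi]
    · exact enorm_integral_le_lintegral_enorm _
  rw [meanOsc]
  calc _ ≤ (planeMeasure lam R)⁻¹ * ∫⁻ x in R, (‖g x - z‖ₑ +
        (planeMeasure lam R)⁻¹ * ∫⁻ x in R, ‖g x - z‖ₑ ∂(planeMeasure lam))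
          ∂(planeMeasure lam) := by
        gcongr with x
        rw [← sub_sub_sub_cancel_right _ _ z]
        exact enorm_sub_le.trans (by gcongr)
    _ = _ := by
        rw [lintegral_add_right _ measurable_const, lintegral_const, Measure.restrict_apply_univ,
          mul_add, two_mul, mul_right_comm _ _ (planeMeasure lam R), ENNReal.inv_mul_cancel h0 hi,
          one_mul]

/-- One factor 2 is the Lipschitz constant of the truncation, the other comes from comparing with
the truncated mean of `b`. The bound does not depend on `N`. -/
theorem meanOsc_trunc_le {lam : ℝ} (hlam : 0 < lam) {R : Set (ℝ × ℝ)} (hR : IsRectangle R)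
    {b : ℝ × ℝ → ℂ} (hb : Measurable b) (N : ℕ) :
    meanOsc lam (fun x => trunc N (b x)) R ≤ 4 * meanOsc lam b R := by
  obtain ⟨-, hi⟩ := hR.measure_ne hlam
  have hint : IntegrableOn (fun x => trunc N (b x)) R (planeMeasure lam) :=
    Measure.integrableOn_of_bounded (M := 2 * N) hi
      ((measurable_trunc N).comp hb).aestronglyMeasurable
      (Filter.Eventually.of_forall fun x => norm_trunc_le_nat N _)
  refine (meanOsc_le_two_mul hlam hR hint
    (trunc N (⨍ y in R, b y ∂(planeMeasure lam)))).trans ?_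
  have h : ∀ x, ‖trunc N (b x) - trunc N (⨍ y in R, b y ∂(planeMeasure lam))‖ₑ ≤
      2 * ‖b x - ⨍ y in R, b y ∂(planeMeasure lam)‖ₑ := fun x => by
    rw [← ofReal_norm, ← ofReal_norm, ← ENNReal.ofReal_ofNat 2,
      ← ENNReal.ofReal_mul (by norm_num)]
    exact ENNReal.ofReal_le_ofReal (norm_trunc_sub_trunc_le _ _ _)
  calc _ ≤ 2 * ((planeMeasure lam R)⁻¹ * ∫⁻ x in R,
        2 * ‖b x - ⨍ y in R, b y ∂(planeMeasure lam)‖ₑ ∂(planeMeasure lam)) := by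
        gcongr with x
        exact h x
    _ = _ := by
        rw [lintegral_const_mul' _ _ (by norm_num), meanOsc, mul_left_comm _ (2 : ℝ≥0∞),
          ← mul_assoc]
        norm_num

/-! ### Pairing of `bmo` functions with atoms -/

/-- As `a` has integral zero, `b` may be replaced by `b - m_R(b)` in the integral; Hölder on `R`
does the rest. -/
theorem integrable_mul_and_integral_bound {lam : ℝ} {q p : ℝ≥0∞}
    [ENNReal.HolderConjugate p q] {R : Set (ℝ × ℝ)} (hR : IsRectangle R) {b a : ℝ × ℝ → ℂ}
    (hb : Measurable b) {B : ℝ≥0∞} (hBt : B ≠ ∞)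
    (hB : eLpNorm (fun x => b x - ⨍ y in R, b y ∂(planeMeasure lam)) p
      ((planeMeasure lam).restrict R) ≤ B) (ha1 : Integrable a (planeMeasure lam))
    (ha : MemLp a q (planeMeasure lam)) (hs : ∀ᵐ x ∂(planeMeasure lam), x ∉ R → a x = 0)
    (h0 : ∫ x, a x ∂(planeMeasure lam) = 0) :
    Integrable (fun x => b x * a x) (planeMeasure lam) ∧
      ‖∫ x, b x * a x ∂(planeMeasure lam)‖ₑ ≤ B * eLpNorm a q (planeMeasure lam) := by
  set z := ⨍ y in R, b y ∂(planeMeasure lam) with hz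
  have hind : (fun x => (b x - z) * a x) =ᵐ[planeMeasure lam]
      R.indicator fun x => (b x - z) * a x := by
    filter_upwards [hs] with x hx
    by_cases hxR : x ∈ R
    · simp [hxR]
    · simp [hxR, hx hxR]
  have hle : eLpNorm (fun x => (b x - z) * a x) 1 (planeMeasure lam) ≤
      B * eLpNorm a q (planeMeasure lam) := by
    rw [eLpNorm_congr_ae hind, eLpNorm_indicator_eq_eLpNorm_restrict hR.measurableSet]
    refine (eLpNorm_smul_le_mul_eLpNorm (p := p) (q := q) (r := 1) (f := a)
      (φ := fun x => b x - z) ha.1.restrict (hb.sub_const z).aestronglyMeasurable).trans ?_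
    gcongr
    exact Measure.restrict_le_self
  have hm : AEStronglyMeasurable (fun x => (b x - z) * a x) (planeMeasure lam) :=
    (hb.sub_const z).aestronglyMeasurable.mul ha.1
  have hint : Integrable (fun x => (b x - z) * a x) (planeMeasure lam) :=
    memLp_one_iff_integrable.1 ⟨hm, hle.trans_lt (ENNReal.mul_lt_top hBt.lt_top ha.2)⟩
  have heq : (fun x => b x * a x) = fun x => (b x - z) * a x + z * a x := by
    ext x; ring
  refine ⟨heq ▸ hint.add (ha1.const_mul z), ?_⟩
  rw [heq, integral_add hint (ha1.const_mul z), integral_const_mul, h0, mul_zero, add_zero]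
  refine (enorm_integral_le_lintegral_enorm _).trans ?_
  rwa [← eLpNorm_one_eq_lintegral_enorm]

/-- The assumption `1 < q` is exactly what keeps the conjugate exponent finite, as John–Nirenberg
requires; `q = ∞` gives `p = 1`. -/
theorem exists_holderConjugate (q : ℝ≥0∞) (hq : 1 < q) :
    ∃ p : ℝ≥0∞, ENNReal.HolderConjugate p q ∧ 1 ≤ p ∧ p ≠ ∞ := by
  have h := ENNReal.HolderConjugate.conjExponent hq.le
  refine ⟨q.conjExponent, h.symm, ?_, ?_⟩
  · simp [ENNReal.conjExponent]
  · simp [ENNReal.conjExponent, tsub_eq_zero_iff_le, hq]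

/-- The powers `1/p` and `1/q - 1` of `μ_λ(R)` from John–Nirenberg and from the atom cancel. Stated
for functions with an oscillation bound, so that it applies to truncations as well. -/
theorem exists_atom_pairing_bound {lam : ℝ} (hlam : 0 < lam) (q : ℝ≥0∞) (hq : 1 < q) :
    ∃ K : ℝ, 0 < K ∧ ∀ (a : Lp ℂ 1 (planeMeasure lam)) (_ : IsAtom lam q a) (b : ℝ × ℝ → ℂ)
      (_ : Measurable b) (M : ℝ) (_ : 0 < M)
      (_ : ∀ R', IsRectangle R' → meanOsc lam b R' ≤ ENNReal.ofReal M),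
      Integrable (fun x => b x * a x) (planeMeasure lam) ∧
        ‖∫ x, b x * a x ∂(planeMeasure lam)‖ ≤ K * M := by
  obtain ⟨p, hpq, hp1, hpt⟩ := exists_holderConjugate q hq
  obtain ⟨K, hK, hJN⟩ := exists_eLpNorm_sub_average_le hlam hp1 hpt
  refine ⟨K, hK, ?_⟩
  rintro a ⟨ha, ⟨R, hR, hs, hle⟩, h0⟩ b hb M hM hosc
  obtain ⟨hR0, hRi⟩ := hR.measure_ne hlam
  have hBt : ENNReal.ofReal (K * M) * planeMeasure lam R ^ p.toReal⁻¹ ≠ ∞ :=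
    ENNReal.mul_ne_top ENNReal.ofReal_ne_top (ENNReal.rpow_ne_top_of_ne_zero hR0 hRi)
  obtain ⟨hi, hn⟩ := integrable_mul_and_integral_bound (q := q) hR hb hBt
    (hJN R hR b hb M hM hosc) (L1.integrable_coeFn a) ha hs h0
  refine ⟨hi, ?_⟩
  have hpq1 : p.toReal⁻¹ + (q⁻¹).toReal = 1 := by
    rw [← ENNReal.toReal_inv, ← ENNReal.toReal_add, ENNReal.HolderConjugate.inv_add_inv_eq_one,
      ENNReal.toReal_one]
    · simp; rintro rfl; simp at hp1
    · simp; rintro rfl; simp at hq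
  have h2 : ‖∫ x, b x * a x ∂(planeMeasure lam)‖ₑ ≤ ENNReal.ofReal (K * M) := by
    refine hn.trans ?_
    calc _ ≤ ENNReal.ofReal (K * M) * planeMeasure lam R ^ p.toReal⁻¹ *
          planeMeasure lam R ^ ((q⁻¹).toReal - 1) := by gcongr
      _ = _ := by
        rw [mul_assoc, ← ENNReal.rpow_add _ _ hR0 hRi,
          show p.toReal⁻¹ + ((q⁻¹).toReal - 1) = 0 by linarith, ENNReal.rpow_zero, mul_one]
  rw [← ofReal_norm] at h2
  exact (ENNReal.ofReal_le_ofReal_iff (by positivity)).1 h2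

/-- Integration of integrable functions against a bounded measurable function. -/
def boundedPairing (lam : ℝ) {g : ℝ × ℝ → ℂ} (hg : Measurable g) {K : ℝ} (hK : ∀ x, ‖g x‖ ≤ K) :
    Lp ℂ 1 (planeMeasure lam) →L[ℂ] ℂ :=
  have hint : ∀ f : Lp ℂ 1 (planeMeasure lam), Integrable (fun x => g x * f x) (planeMeasure lam) :=
    fun f => (L1.integrable_coeFn f).bdd_mul hg.aestronglyMeasurable
      (Filter.Eventually.of_forall hK)
  LinearMap.mkContinuous
    { toFun := fun f => ∫ x, g x * f x ∂(planeMeasure lam)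
      map_add' := fun f h => by
        rw [← integral_add (hint f) (hint h)]
        refine integral_congr_ae ?_
        filter_upwards [Lp.coeFn_add f h] with x hx
        rw [hx, Pi.add_apply, mul_add]
      map_smul' := fun z f => by
        rw [RingHom.id_apply, ← integral_smul]
        refine integral_congr_ae ?_
        filter_upwards [Lp.coeFn_smul z f] with x hx
        rw [hx, Pi.smul_apply, smul_eq_mul, smul_eq_mul, mul_left_comm] } K fun f => by
    refine (norm_integral_le_integral_norm _).trans ?_
    rw [L1.norm_eq_integral_norm, ← integral_const_mul]
    refine integral_mono (hint f).norm ((L1.integrable_coeFn f).norm.const_mul K) fun x => ?_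
    simp only [norm_mul]
    gcongr
    exact hK x

theorem boundedPairing_apply (lam : ℝ) {g : ℝ × ℝ → ℂ} (hg : Measurable g) {K : ℝ}
    (hK : ∀ x, ‖g x‖ ≤ K) (f : Lp ℂ 1 (planeMeasure lam)) :
    boundedPairing lam hg hK f = ∫ x, g x * f x ∂(planeMeasure lam) := rfl

theorem tendsto_integral_trunc {lam : ℝ} {b f : ℝ × ℝ → ℂ} (hb : Measurable b)
    (hf : AEStronglyMeasurable f (planeMeasure lam))
    (h : Integrable (fun x => b x * f x) (planeMeasure lam)) :
    Filter.Tendsto (fun N => ∫ x, trunc N (b x) * f x ∂(planeMeasure lam)) Filter.atTop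
      (nhds (∫ x, b x * f x ∂(planeMeasure lam))) := by
  refine tendsto_integral_of_dominated_convergence (fun x => 2 * ‖b x * f x‖)
    (fun N => ((measurable_trunc N).comp hb).aestronglyMeasurable.mul hf)
    (h.norm.const_mul 2) (fun N => Filter.Eventually.of_forall fun x => ?_)
    (Filter.Eventually.of_forall fun x => (tendsto_trunc (b x)).mul_const _)
  rw [norm_mul, norm_mul, ← mul_assoc]
  gcongr
  exact norm_trunc_le N _

/-- The integrals depend only on `f` and the sum on a decomposition, so the sum is independent of
the decomposition. The limit enters the sum by dominated convergence, since truncations pair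
uniformly boundedly with atoms. -/
theorem tendsto_integral_trunc_of_decomposition {lam : ℝ} (hlam : 0 < lam) {q : ℝ≥0∞}
    (hq : 1 < q) {b : ℝ × ℝ → ℂ} (hb : Measurable b) (hbmo : bmoNorm lam b < ∞)
    {f : Lp ℂ 1 (planeMeasure lam)} {α : ℕ → ℂ} {a : ℕ → Lp ℂ 1 (planeMeasure lam)}
    (hd : IsAtomicDecomposition lam q f α a) :
    Filter.Tendsto (fun N => ∫ x, trunc N (b x) * f x ∂(planeMeasure lam)) Filter.atTop
      (nhds (∑' i, α i * ∫ x, b x * a i x ∂(planeMeasure lam))) := by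
  obtain ⟨K, hK, hbound⟩ := exists_atom_pairing_bound hlam q hq
  set M := (bmoNorm lam b).toReal + 1 with hMdef
  have hM : 0 < M := by positivity
  have hosc : ∀ R', IsRectangle R' → meanOsc lam b R' ≤ ENNReal.ofReal M := fun R' hR' => by
    refine (meanOsc_le_bmoNorm lam b hR').trans ?_
    rw [ENNReal.le_ofReal_iff_toReal_le hbmo.ne hM.le]
    linarith
  have hoscN : ∀ N R', IsRectangle R' →
      meanOsc lam (fun x => trunc N (b x)) R' ≤ ENNReal.ofReal (4 * M) := fun N R' hR' => by
    refine (meanOsc_trunc_le hlam hR' hb N).trans ?_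
    rw [ENNReal.ofReal_mul (by norm_num), ENNReal.ofReal_ofNat]
    gcongr
    exact hosc R' hR'
  -- For fixed `N` the truncation is bounded, hence a continuous functional on `L¹`, and `L¹`
  -- convergence of the decomposition suffices.
  have hsum : ∀ N, ∫ x, trunc N (b x) * f x ∂(planeMeasure lam) =
      ∑' i, α i * ∫ x, trunc N (b x) * a i x ∂(planeMeasure lam) := fun N => by
    have := (boundedPairing lam ((measurable_trunc N).comp hb)
      (fun x => norm_trunc_le_nat N (b x))).hasSum hd.hasSum
    simp only [Function.comp_def, map_smul, boundedPairing_apply, smul_eq_mul] at this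
    exact this.tsum_eq.symm
  simp only [hsum]
  refine tendsto_tsum_of_dominated_convergence (bound := fun i => ‖α i‖ * (K * (4 * M)))
    (hd.summable.mul_right _) (fun i => ?_) (Filter.Eventually.of_forall fun N i => ?_)
  · exact (tendsto_integral_trunc hb (Lp.aestronglyMeasurable _)
      (hbound (a i) (hd.isAtom i) b hb M hM hosc).1).const_mul _
  · rw [norm_mul]
    gcongr
    exact (hbound (a i) (hd.isAtom i) _ ((measurable_trunc N).comp hb) (4 * M) (by positivity)
      (hoscN N)).2

/-! ### The duality map -/

theorem LittleBMO.measurable {lam : ℝ} (b : LittleBMO lam) : Measurable b :=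
  b.toAEEqFun.stronglyMeasurable.measurable

theorem LittleBMO.meanOsc_le {lam : ℝ} (b : LittleBMO lam) {M : ℝ} (hM : ‖b‖ ≤ M) {R : Set (ℝ × ℝ)}
    (hR : IsRectangle R) : meanOsc lam b R ≤ ENNReal.ofReal M := by
  refine (meanOsc_le_bmoNorm lam b hR).trans ?_
  rw [← ENNReal.ofReal_toReal b.memBMO.2.ne]
  exact ENNReal.ofReal_le_ofReal hM

/-- The earlier bound needs `M > 0`; letting `M` decrease to `‖b‖` also covers functions of norm
zero. -/
theorem exists_atom_pairing_bound_littleBMO {lam : ℝ} (hlam : 0 < lam) (q : ℝ≥0∞) (hq : 1 < q) :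
    ∃ K : ℝ, 0 < K ∧ ∀ (a : Lp ℂ 1 (planeMeasure lam)) (_ : IsAtom lam q a) (b : LittleBMO lam),
      Integrable (fun x => b x * a x) (planeMeasure lam) ∧
        ‖∫ x, b x * a x ∂(planeMeasure lam)‖ ≤ K * ‖b‖ := by
  obtain ⟨K, hK, h⟩ := exists_atom_pairing_bound hlam q hq
  have hM : ∀ (b : LittleBMO lam) (ε : ℝ), 0 < ε → 0 < ‖b‖ + ε := fun b ε hε => by
    have := norm_nonneg b
    linarith
  refine ⟨K, hK, fun a ha b => ⟨?_, ?_⟩⟩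
  · exact (h a ha b b.measurable _ (hM b 1 one_pos)
      fun R hR => b.meanOsc_le (by linarith) hR).1
  · refine le_of_forall_pos_le_add fun ε hε => ?_
    have h1 := (h a ha b b.measurable _ (hM b (ε / K) (by positivity))
      fun R hR => b.meanOsc_le (le_add_of_nonneg_right (by positivity)) hR).2
    rwa [mul_add, mul_div_cancel₀ _ hK.ne'] at h1

theorem integrable_mul_of_mem_span {lam : ℝ} (hlam : 0 < lam) {q : ℝ≥0∞} (hq : 1 < q)
    (b : LittleBMO lam) {f : Lp ℂ 1 (planeMeasure lam)}
    (hf : f ∈ Submodule.span ℂ {a | IsAtom lam q a}) :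
    Integrable (fun x => b x * f x) (planeMeasure lam) := by
  obtain ⟨K, -, hK⟩ := exists_atom_pairing_bound_littleBMO hlam q hq
  induction hf using Submodule.span_induction with
  | mem a ha => exact (hK a ha b).1
  | zero =>
    refine (integrable_zero _ _ _).congr ?_
    filter_upwards [Lp.coeFn_zero ℂ 1 (planeMeasure lam)] with x hx
    rw [hx, Pi.zero_apply, mul_zero]
  | add f g _ _ hf hg =>
    refine (hf.add hg).congr ?_
    filter_upwards [Lp.coeFn_add f g] with x hx
    rw [hx, Pi.add_apply, Pi.add_apply, mul_add]
  | smul z f _ hf =>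
    refine (hf.smul z).congr ?_
    filter_upwards [Lp.coeFn_smul z f] with x hx
    rw [hx, Pi.smul_apply, Pi.smul_apply, smul_eq_mul, smul_eq_mul, mul_left_comm]

/-- The pairing of `b ∈ bmo` with `f ∈ h^{1,q}`, as the limit of the integrals of `f` against the
truncations of `b`. -/
def pairing {lam : ℝ} {q : ℝ≥0∞} (b : LittleBMO lam) (f : LittleHardy lam q) : ℂ :=
  Filter.atTop.limUnder fun N : ℕ => ∫ x, trunc N (b x) * f.toLp x ∂(planeMeasure lam)

section Pairing

variable {lam : ℝ} {q : ℝ≥0∞} [hq : Fact (1 < q)]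

theorem pairing_eq_tsum (hlam : 0 < lam) (b : LittleBMO lam) {f : LittleHardy lam q} {α : ℕ → ℂ}
    {a : ℕ → Lp ℂ 1 (planeMeasure lam)} (hd : IsAtomicDecomposition lam q f.toLp α a) :
    pairing b f = ∑' i, α i * ∫ x, b x * a i x ∂(planeMeasure lam) :=
  (tendsto_integral_trunc_of_decomposition hlam hq.out b.measurable b.memBMO.2 hd).limUnder_eq

theorem tendsto_pairing (hlam : 0 < lam) (b : LittleBMO lam) (f : LittleHardy lam q) :
    Filter.Tendsto (fun N => ∫ x, trunc N (b x) * f.toLp x ∂(planeMeasure lam)) Filter.atTop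
      (nhds (pairing b f)) := by
  obtain ⟨α, a, hd⟩ := f.mem
  rw [pairing_eq_tsum hlam b hd]
  exact tendsto_integral_trunc_of_decomposition hlam hq.out b.measurable b.memBMO.2 hd

theorem pairing_eq_integral (hlam : 0 < lam) (b : LittleBMO lam) {f : LittleHardy lam q}
    (h : Integrable (fun x => b x * f.toLp x) (planeMeasure lam)) :
    pairing b f = ∫ x, b x * f.toLp x ∂(planeMeasure lam) :=
  tendsto_nhds_unique (tendsto_pairing hlam b f)
    (tendsto_integral_trunc b.measurable (Lp.aestronglyMeasurable _) h)

/-- Linearity in `f` is inherited from the truncated integrals; decompositions of `f` and `g` need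
not be matched. -/
theorem pairing_add_right (hlam : 0 < lam) (b : LittleBMO lam) (f g : LittleHardy lam q) :
    pairing b (f + g) = pairing b f + pairing b g := by
  refine tendsto_nhds_unique (tendsto_pairing hlam b (f + g))
    (((tendsto_pairing hlam b f).add (tendsto_pairing hlam b g)).congr fun N => ?_)
  exact ((boundedPairing lam ((measurable_trunc N).comp b.measurable)
      (fun x => norm_trunc_le_nat N (b x))).map_add f.toLp g.toLp).symm

theorem pairing_smul_right (hlam : 0 < lam) (b : LittleBMO lam) (z : ℂ) (f : LittleHardy lam q) :
    pairing b (z • f) = z • pairing b f := by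
  refine tendsto_nhds_unique (tendsto_pairing hlam b (z • f))
    (((tendsto_pairing hlam b f).const_smul z).congr fun N => ?_)
  exact ((boundedPairing lam ((measurable_trunc N).comp b.measurable)
      (fun x => norm_trunc_le_nat N (b x))).map_smul z f.toLp).symm

theorem summable_pairing (hlam : 0 < lam) (b : LittleBMO lam) {f : Lp ℂ 1 (planeMeasure lam)}
    {α : ℕ → ℂ} {a : ℕ → Lp ℂ 1 (planeMeasure lam)} (hd : IsAtomicDecomposition lam q f α a) :
    Summable fun i => α i * ∫ x, b x * a i x ∂(planeMeasure lam) := by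
  obtain ⟨K, -, h⟩ := exists_atom_pairing_bound_littleBMO hlam q hq.out
  refine Summable.of_norm_bounded (hd.summable.mul_right (K * ‖b‖)) fun i => ?_
  rw [norm_mul]
  gcongr
  exact (h (a i) (hd.isAtom i) b).2

/-- Truncation is not additive, so linearity in `b` is read off from the sum over a fixed
decomposition instead. -/
theorem pairing_add_left (hlam : 0 < lam) (b c : LittleBMO lam) (f : LittleHardy lam q) :
    pairing (b + c) f = pairing b f + pairing c f := by
  obtain ⟨K, -, h⟩ := exists_atom_pairing_bound_littleBMO hlam q hq.out
  obtain ⟨α, a, hd⟩ := f.mem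
  rw [pairing_eq_tsum hlam _ hd, pairing_eq_tsum hlam _ hd, pairing_eq_tsum hlam _ hd,
    ← (summable_pairing hlam b hd).tsum_add (summable_pairing hlam c hd)]
  congr 1
  ext i
  rw [← mul_add, ← integral_add (h (a i) (hd.isAtom i) b).1 (h (a i) (hd.isAtom i) c).1]
  congr 1
  refine integral_congr_ae ?_
  filter_upwards [AEEqFun.coeFn_add b.toAEEqFun c.toAEEqFun] with x hx
  rw [← add_mul]
  exact congrArg (· * _) hx

theorem pairing_smul_left (hlam : 0 < lam) (z : ℂ) (b : LittleBMO lam) (f : LittleHardy lam q) :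
    pairing (z • b) f = z • pairing b f := by
  obtain ⟨α, a, hd⟩ := f.mem
  rw [pairing_eq_tsum hlam _ hd, pairing_eq_tsum hlam _ hd, smul_eq_mul, ← tsum_mul_left]
  congr 1
  ext i
  rw [mul_left_comm, ← integral_const_mul z]
  congr 1
  refine integral_congr_ae ?_
  filter_upwards [AEEqFun.coeFn_smul z b.toAEEqFun] with x hx
  rw [← mul_assoc]
  exact congrArg (· * _) hx

theorem exists_norm_pairing_le (hlam : 0 < lam) : ∃ K : ℝ, 0 < K ∧
    ∀ (b : LittleBMO lam) (f : LittleHardy lam q), ‖pairing b f‖ ≤ K * ‖b‖ * ‖f‖ := by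
  obtain ⟨K, hK, h⟩ := exists_atom_pairing_bound_littleBMO hlam q hq.out
  refine ⟨K, hK, fun b f => ?_⟩
  have key : ∀ r, ‖f‖ < r → ‖pairing b f‖ ≤ K * ‖b‖ * r := fun r hr => by
    obtain ⟨α, a, hd, hlt⟩ := exists_lt_of_atomicNorm_lt f.mem hr
    rw [pairing_eq_tsum hlam b hd]
    refine (tsum_of_norm_bounded (hd.summable.mul_left (K * ‖b‖)).hasSum fun i => ?_).trans ?_
    · rw [norm_mul, mul_comm]
      gcongr
      exact (h (a i) (hd.isAtom i) b).2
    · rw [tsum_mul_left]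
      have := norm_nonneg b
      gcongr
  have hKb : 0 ≤ K * ‖b‖ := mul_nonneg hK.le (norm_nonneg b)
  refine le_of_forall_pos_le_add fun ε hε => ?_
  have h1 := key (‖f‖ + ε / (K * ‖b‖ + 1)) (lt_add_of_pos_right _ (by positivity))
  have h2 : K * ‖b‖ * (ε / (K * ‖b‖ + 1)) ≤ ε := by
    rw [mul_div_assoc', div_le_iff₀ (by positivity)]
    nlinarith
  linarith [mul_add (K * ‖b‖) ‖f‖ (ε / (K * ‖b‖ + 1))]

end Pairing

/-- The map from `bmo(ℝ_λ)` to the dual of `h^{1,q}(ℝ_λ)`. -/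
def dualityMap {lam : ℝ} (hlam : 0 < lam) (q : ℝ≥0∞) [hq : Fact (1 < q)] :
    LittleBMO lam →ₗ[ℂ] (LittleHardy lam q →L[ℂ] ℂ) where
  toFun b := LinearMap.mkContinuousOfExistsBound
    { toFun := pairing b
      map_add' := pairing_add_right hlam b
      map_smul' := pairing_smul_right hlam b }
    (let ⟨K, _, h⟩ := exists_norm_pairing_le (q := q) hlam; ⟨K * ‖b‖, h b⟩)
  map_add' b c := ContinuousLinearMap.ext (pairing_add_left hlam b c)
  map_smul' z b := ContinuousLinearMap.ext (pairing_smul_left hlam z b)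

theorem dualityMap_apply {lam : ℝ} (hlam : 0 < lam) (q : ℝ≥0∞) [hq : Fact (1 < q)]
    (b : LittleBMO lam) (f : LittleHardy lam q) : dualityMap hlam q b f = pairing b f := rfl

theorem exists_norm_dualityMap_le {lam : ℝ} (hlam : 0 < lam) (q : ℝ≥0∞) [hq : Fact (1 < q)] :
    ∃ K : ℝ, 0 < K ∧ ∀ b : LittleBMO lam, ‖dualityMap hlam q b‖ ≤ K * ‖b‖ := by
  obtain ⟨K, hK, h⟩ := exists_norm_pairing_le (q := q) hlam
  exact ⟨K, hK, fun b => ContinuousLinearMap.opNorm_le_bound _ (mul_nonneg hK.le (norm_nonneg b))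
    (h b)⟩

/-! ### Bounds for the mean oscillation by duality -/

theorem indicator_sub_average_mem {lam : ℝ} (hlam : 0 < lam) {R : Set (ℝ × ℝ)} (hR : IsRectangle R)
    {g : ℝ × ℝ → ℂ} (hg : Measurable g) {K : ℝ} (hK : ∀ x, ‖g x‖ ≤ K) :
    (R.indicator fun x => g x - ⨍ y in R, g y ∂(planeMeasure lam)) ∈ bddMeanZero lam R ∧
    ∀ x, ‖R.indicator (fun x => g x - ⨍ y in R, g y ∂(planeMeasure lam)) x‖ ≤ 2 * K := by
  obtain ⟨h0, hi⟩ := hR.measure_ne hlam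
  have hv : (planeMeasure lam).real R ≠ 0 := ENNReal.toReal_ne_zero.2 ⟨h0, hi⟩
  have hgi : IntegrableOn g R (planeMeasure lam) :=
    Measure.integrableOn_of_bounded (M := K) hi hg.aestronglyMeasurable
      (Filter.Eventually.of_forall hK)
  have hav : ‖⨍ y in R, g y ∂(planeMeasure lam)‖ ≤ K := by
    rw [setAverage_eq, norm_smul, norm_inv, Real.norm_of_nonneg measureReal_nonneg,
      inv_mul_le_iff₀ (lt_of_le_of_ne measureReal_nonneg hv.symm), mul_comm]
    exact norm_setIntegral_le_of_norm_le_const hi.lt_top fun x _ => hK x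
  have hb : ∀ x, ‖R.indicator (fun x => g x - ⨍ y in R, g y ∂(planeMeasure lam)) x‖ ≤ 2 * K :=
    fun x => by
      refine (norm_indicator_le_norm_self _ _).trans ((norm_sub_le _ _).trans ?_)
      linarith [hK x]
  refine ⟨mem_bddMeanZero_of_bound hi ((hg.sub_const _).indicator hR.measurableSet)
    (fun x hx => indicator_of_notMem hx _) hb ?_, hb⟩
  rw [integral_indicator hR.measurableSet, integral_sub hgi (integrableOn_const hi),
    setIntegral_const, setAverage_eq, smul_smul, mul_inv_cancel₀ hv, one_smul, sub_self]

/-- Subtraction of the mean over `R` is symmetric for the bilinear pairing, so it can be moved from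
the test function to `b`. -/
theorem setIntegral_mul_sub_average {lam : ℝ} (hlam : 0 < lam) {R : Set (ℝ × ℝ)}
    (hR : IsRectangle R) {b g : ℝ × ℝ → ℂ} (hb : IntegrableOn b R (planeMeasure lam))
    (hg : Measurable g) {K : ℝ} (hK : ∀ x, ‖g x‖ ≤ K) :
    ∫ x, b x * R.indicator (fun x => g x - ⨍ y in R, g y ∂(planeMeasure lam)) x
      ∂(planeMeasure lam) =
    ∫ x in R, (b x - ⨍ y in R, b y ∂(planeMeasure lam)) * g x ∂(planeMeasure lam) := by
  obtain ⟨h0, hi⟩ := hR.measure_ne hlam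
  have hv : (planeMeasure lam).real R ≠ 0 := ENNReal.toReal_ne_zero.2 ⟨h0, hi⟩
  have hgi : IntegrableOn g R (planeMeasure lam) :=
    Measure.integrableOn_of_bounded (M := K) hi hg.aestronglyMeasurable
      (Filter.Eventually.of_forall hK)
  have hbg : IntegrableOn (fun x => b x * g x) R (planeMeasure lam) :=
    Integrable.mul_bdd (c := K) hb hg.aestronglyMeasurable (Filter.Eventually.of_forall hK)
  have e1 : ∀ x, b x * R.indicator (fun x => g x - ⨍ y in R, g y ∂(planeMeasure lam)) x =
      R.indicator (fun x => b x * g x - b x * ⨍ y in R, g y ∂(planeMeasure lam)) x := fun x => by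
    by_cases hx : x ∈ R
    · simp [hx, mul_sub]
    · simp [hx]
  simp only [e1, sub_mul]
  rw [integral_indicator hR.measurableSet, integral_sub hbg (hb.mul_const _),
    integral_sub hbg (hgi.const_mul _), integral_mul_const, integral_const_mul, setAverage_eq,
    setAverage_eq]
  simp only [Complex.real_smul]
  ring

theorem meanOsc_le_of_forall_bddMeanZero {lam : ℝ} (hlam : 0 < lam) {R : Set (ℝ × ℝ)}
    (hR : IsRectangle R) {b : ℝ × ℝ → ℂ} (hbm : Measurable b)
    (hb : IntegrableOn b R (planeMeasure lam)) {A : ℝ}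
    (hA : ∀ f ∈ bddMeanZero lam R, (∀ x, ‖f x‖ ≤ 2) →
      ‖∫ x, b x * f x ∂(planeMeasure lam)‖ ≤ A * (planeMeasure lam).real R) :
    meanOsc lam b R ≤ ENNReal.ofReal A := by
  obtain ⟨h0, hi⟩ := hR.measure_ne hlam
  have hv : 0 < (planeMeasure lam).real R := ENNReal.toReal_pos h0 hi
  set z := ⨍ y in R, b y ∂(planeMeasure lam) with hz
  have hwm : Measurable fun x => b x - z := hbm.sub_const z
  -- The conjugate phase of `b - z`. Where `b = z` division by zero gives 0, which agrees with `(b -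
  -- z) g = ‖b - z‖`.
  set g : ℝ × ℝ → ℂ := fun x => (starRingEnd ℂ) (b x - z) / ‖b x - z‖ with hg
  have hgm : Measurable g :=
    (Complex.continuous_conj.measurable.comp hwm).div
      (Complex.measurable_ofReal.comp hwm.norm)
  have hg1 : ∀ x, ‖g x‖ ≤ 1 := fun x => by
    rw [hg]
    simp only [norm_div, RCLike.norm_conj, Complex.norm_real, norm_norm]
    exact div_self_le_one _
  have hgw : ∀ x, (b x - z) * g x = (‖b x - z‖ : ℝ) := fun x => by
    rw [hg]
    simp only
    rw [← mul_div_assoc, Complex.mul_conj, Complex.normSq_eq_norm_sq]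
    push_cast
    rw [sq, mul_self_div_self]
  obtain ⟨hmem, hb2⟩ := indicator_sub_average_mem hlam hR hgm hg1
  have h1 := hA _ hmem (fun x => (hb2 x).trans (by norm_num))
  rw [setIntegral_mul_sub_average hlam hR hb hgm hg1, ← hz] at h1
  simp only [hgw] at h1
  rw [integral_complex_ofReal, Complex.norm_real,
    Real.norm_of_nonneg (integral_nonneg fun _ => norm_nonneg _)] at h1
  have hint : Integrable (fun x => b x - z) ((planeMeasure lam).restrict R) :=
    Integrable.sub hb (integrableOn_const hi)
  rw [meanOsc, ← ofReal_integral_norm_eq_lintegral_enorm hint, ENNReal.inv_mul_le_iff h0 hi,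
    ← ENNReal.ofReal_toReal hi, ← ENNReal.ofReal_mul ENNReal.toReal_nonneg, mul_comm]
  exact ENNReal.ofReal_le_ofReal h1

/-- Test functions of sup norm at most 2 on `R` have Hardy norm at most `2 μ_λ(R)`. This serves both
the lower bound for the duality map and the bmo membership of a representing function. -/
theorem bmoNorm_le_of_forall_bddMeanZero {lam : ℝ} (hlam : 0 < lam) {q : ℝ≥0∞} [Fact (1 < q)]
    {b : ℝ × ℝ → ℂ} (hbm : Measurable b)
    (hb : ∀ R, IsRectangle R → IntegrableOn b R (planeMeasure lam))
    (ℓ : LittleHardy lam q →L[ℂ] ℂ)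
    (hℓ : ∀ R (hR : IsRectangle R) (f : bddMeanZero lam R),
      ℓ (bddToHardy q hlam hR f) = ∫ x, b x * (f : ℝ × ℝ → ℂ) x ∂(planeMeasure lam)) :
    bmoNorm lam b ≤ ENNReal.ofReal (2 * ‖ℓ‖) := by
  refine iSup₂_le fun R hR => meanOsc_le_of_forall_bddMeanZero hlam hR hbm (hb R hR) ?_
  intro f hf hf2
  rw [← hℓ R hR ⟨f, hf⟩]
  refine (ℓ.le_opNorm _).trans ?_
  rw [mul_comm 2, mul_assoc]
  gcongr
  exact norm_bddToHardy_le q hlam hR ⟨f, hf⟩ hR (Filter.Eventually.of_forall hf.2.2.1)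
    (by norm_num) hf2

theorem LittleBMO.integrableOn {lam : ℝ} (hlam : 0 < lam) (b : LittleBMO lam) {R : Set (ℝ × ℝ)}
    (hR : IsRectangle R) : IntegrableOn b R (planeMeasure lam) :=
  integrableOn_of_bmoNorm b.measurable.aestronglyMeasurable b.memBMO.2 hR (hR.measure_ne hlam).2

theorem integrable_mul_of_mem_bddMeanZero {lam : ℝ} {R : Set (ℝ × ℝ)}
    {b f : ℝ × ℝ → ℂ} (hb : IntegrableOn b R (planeMeasure lam))
    (hf : f ∈ bddMeanZero lam R) : Integrable (fun x => b x * f x) (planeMeasure lam) := by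
  obtain ⟨hfm, -, hs, ⟨K, hK⟩, -⟩ := hf
  have h1 : IntegrableOn (fun x => b x * f x) R (planeMeasure lam) :=
    Integrable.mul_bdd (c := K) hb hfm.aestronglyMeasurable (Filter.Eventually.of_forall hK)
  exact (integrableOn_iff_integrable_of_support_subset fun x hx => by
    by_contra h; exact hx (by simp [hs x h])).1 h1

theorem dualityMap_bddToHardy {lam : ℝ} (hlam : 0 < lam) (q : ℝ≥0∞) [hq : Fact (1 < q)]
    (b : LittleBMO lam) {R : Set (ℝ × ℝ)} (hR : IsRectangle R) (f : bddMeanZero lam R) :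
    dualityMap hlam q b (bddToHardy q hlam hR f) =
      ∫ x, b x * (f : ℝ × ℝ → ℂ) x ∂(planeMeasure lam) := by
  have hco : (fun x => b x * (bddToHardy q hlam hR f).toLp x) =ᵐ[planeMeasure lam]
      fun x => b x * (f : ℝ × ℝ → ℂ) x := by
    filter_upwards [bddToHardy_ae_eq q hlam hR f] with x hx
    rw [hx]
  rw [dualityMap_apply, pairing_eq_integral hlam, integral_congr_ae hco]
  exact (integrable_mul_of_mem_bddMeanZero (b.integrableOn hlam hR) f.2).congr hco.symm

theorem norm_le_dualityMap {lam : ℝ} (hlam : 0 < lam) (q : ℝ≥0∞) [hq : Fact (1 < q)]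
    (b : LittleBMO lam) : ‖b‖ ≤ 2 * ‖dualityMap hlam q b‖ :=
  ENNReal.toReal_le_of_le_ofReal (by positivity)
    (bmoNorm_le_of_forall_bddMeanZero hlam b.measurable (fun R hR => b.integrableOn hlam hR)
      (dualityMap hlam q b) fun _ hR f => dualityMap_bddToHardy hlam q b hR f)

/-! ### Bounded functions in the little Hardy space: control of the norm by the `L²` norm -/

namespace Chart

variable {lam : ℝ} {R : Set (ℝ × ℝ)} (c : Chart lam R)

/-- The indicator function of a cell, with normalized integral. -/
def bump (Q : Cell) : ℝ × ℝ → ℂ :=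
  (R ∩ c.map ⁻¹' Q.set).indicator fun _ => (((Q.r ^ 2)⁻¹ : ℝ) : ℂ)

theorem bump_of_mem {Q : Cell} {x : ℝ × ℝ} (hx : x ∈ R) (hQ : c.map x ∈ Q.set) :
    c.bump Q x = (((Q.r ^ 2)⁻¹ : ℝ) : ℂ) := 
  indicator_of_mem (s := R ∩ c.map ⁻¹' Q.set) ⟨hx, hQ⟩ _

theorem bump_of_notMem {Q : Cell} {x : ℝ × ℝ} (hx : ¬ (x ∈ R ∧ c.map x ∈ Q.set)) :
    c.bump Q x = 0 := indicator_of_notMem (s := R ∩ c.map ⁻¹' Q.set) hx _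

theorem norm_bump_le (Q : Cell) (x : ℝ × ℝ) : ‖c.bump Q x‖ ≤ (Q.r ^ 2)⁻¹ := by
  refine (norm_indicator_le_norm_self _ _).trans ?_
  rw [Complex.norm_real, Real.norm_of_nonneg (by positivity)]

/-- A child has a quarter of the measure, so its normalized indicator is four times as high. -/
theorem bump_child (Q : Cell) (k : Bool × Bool) (x : ℝ × ℝ) :
    c.bump (Q.child k) x = if Q.side (c.map x) = k then 4 * c.bump Q x else 0 := by
  by_cases hx : x ∈ R ∧ c.map x ∈ Q.set
  · split_ifs with h
    · rw [c.bump_of_mem hx.1 (Cell.mem_child_iff.2 ⟨hx.2, h⟩), c.bump_of_mem hx.1 hx.2]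
      simp only [Cell.child]
      push_cast
      rw [div_pow, inv_div, div_eq_mul_inv]
      norm_num
    · exact c.bump_of_notMem fun h' => h (Cell.mem_child_iff.1 h'.2).2
  · rw [c.bump_of_notMem hx, c.bump_of_notMem fun h' => hx ⟨h'.1, (Cell.mem_child_iff.1 h'.2).1⟩]
    simp

theorem bump_eq_child (Q : Cell) : c.bump Q = (4 : ℝ)⁻¹ • ∑ k, c.bump (Q.child k) := by
  ext x
  rw [Pi.smul_apply, Finset.sum_apply]
  simp only [bump_child, Finset.sum_ite_eq, Finset.mem_univ, if_true, Complex.real_smul]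
  push_cast
  ring

theorem norm_bump_eq_child (x : ℝ × ℝ) (Q : Cell) :
    ‖c.bump Q x‖ = (4 : ℝ)⁻¹ • ∑ k, ‖c.bump (Q.child k) x‖ := by
  have : ∀ k, ‖c.bump (Q.child k) x‖ =
      if Q.side (c.map x) = k then 4 * ‖c.bump Q x‖ else 0 := fun k => by
    rw [bump_child]; split_ifs <;> simp
  simp only [this, Finset.sum_ite_eq, Finset.mem_univ, if_true, smul_eq_mul]
  ring

/-- Averages of weighted bumps are step functions. -/
theorem treeAvg_bump (G : Cell → ℂ) (m : ℕ) (Q : Cell) (x : ℝ × ℝ) :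
    treeAvg Cell.child m (fun Q' => G Q' * c.bump Q' x) Q =
      G (Cell.leaf m Q (c.map x)) * c.bump Q x := by
  induction m generalizing Q with
  | zero => rfl
  | succ m ih =>
    simp only [treeAvg_succ, ih, bump_child, mul_ite, mul_zero, Finset.sum_ite_eq,
      Finset.mem_univ, if_true, Cell.leaf, Complex.real_smul]
    push_cast
    ring

theorem measurable_bump (hR : MeasurableSet R) (Q : Cell) : Measurable (c.bump Q) :=
  measurable_const.indicator (hR.inter (c.measurableSet_preimage Q))

theorem integral_bump (hR : MeasurableSet R) (Q : Cell) :
    ∫ x, c.bump Q x ∂(planeMeasure lam) = (planeMeasure lam).real R := by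
  have := Q.r_pos
  rw [bump, integral_indicator (hR.inter (c.measurableSet_preimage Q)), setIntegral_const,
    Measure.real, c.measure_cell, ENNReal.toReal_mul, ENNReal.toReal_ofReal (sq_nonneg _),
    Complex.real_smul, ← Complex.ofReal_mul, Measure.real]
  congr 1
  field_simp

theorem integrable_bump (hR : MeasurableSet R) (hi : planeMeasure lam R ≠ ∞) (Q : Cell) :
    Integrable (c.bump Q) (planeMeasure lam) := by
  refine (integrable_indicator_iff (hR.inter (c.measurableSet_preimage Q))).2
    (integrableOn_const ?_)
  exact ((measure_mono inter_subset_left).trans_lt hi.lt_top).ne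

/-- The difference of a normalized indicator function of a cell and that of the rectangle. -/
def bumpSub (hlam : 0 < lam) (hR : IsRectangle R) (Q : Cell) : bddMeanZero lam R :=
  ⟨c.bump Q - c.bump Cell.root, by
    have hi := (hR.measure_ne hlam).2
    refine mem_bddMeanZero_of_bound (K := (Q.r ^ 2)⁻¹ + (Cell.root.r ^ 2)⁻¹) hi
      ((c.measurable_bump hR.measurableSet Q).sub (c.measurable_bump hR.measurableSet _))
      (fun x hx => ?_) (fun x => ?_) ?_
    · rw [Pi.sub_apply, c.bump_of_notMem fun h => hx h.1, c.bump_of_notMem fun h => hx h.1,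
        sub_zero]
    · exact (norm_sub_le _ _).trans (add_le_add (c.norm_bump_le Q x) (c.norm_bump_le _ x))
    · simp only [Pi.sub_apply]
      rw [integral_sub (c.integrable_bump hR.measurableSet hi Q)
        (c.integrable_bump hR.measurableSet hi _), c.integral_bump hR.measurableSet,
        c.integral_bump hR.measurableSet, sub_self]⟩

theorem coe_bumpSub (hlam : 0 < lam) (hR : IsRectangle R) (Q : Cell) :
    (c.bumpSub hlam hR Q : ℝ × ℝ → ℂ) = c.bump Q - c.bump Cell.root := rfl

theorem bumpSub_eq_child (hlam : 0 < lam) (hR : IsRectangle R) (Q : Cell) :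
    c.bumpSub hlam hR Q = (4 : ℝ)⁻¹ • ∑ k, c.bumpSub hlam hR (Q.child k) := by
  apply Subtype.ext
  rw [Submodule.coe_smul_of_tower, Submodule.coe_sum]
  simp only [coe_bumpSub, Finset.sum_sub_distrib, smul_sub]
  rw [← bump_eq_child]
  congr 1
  rw [Finset.sum_const, Finset.card_univ, ← Nat.cast_smul_eq_nsmul ℝ, smul_smul]
  simp

/-- Evaluation of treeAvg in the space of bounded functions at a point. -/
theorem coe_treeAvg_apply (w : Cell → bddMeanZero lam R) (m : ℕ) (Q : Cell) (x : ℝ × ℝ) :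
    ((treeAvg Cell.child m w Q : bddMeanZero lam R) : ℝ × ℝ → ℂ) x =
      treeAvg Cell.child m (fun Q' => (w Q' : ℝ × ℝ → ℂ) x) Q :=
  map_treeAvg Cell.child (((LinearMap.proj x : (ℝ × ℝ → ℂ) →ₗ[ℂ] ℂ) ∘ₗ
    (bddMeanZero lam R).subtype).restrictScalars ℝ) m w Q

section Functional

variable {q : ℝ≥0∞} [hq : Fact (1 < q)] (hlam : 0 < lam) (hR : IsRectangle R)
  (ℓ : LittleHardy lam q →L[ℂ] ℂ)

/-- The values of a functional on normalized indicator functions of cells. -/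
def cellValue (Q : Cell) : ℂ := ℓ (bddToHardy q hlam hR (c.bumpSub hlam hR Q))

theorem apply_treeAvg (w : Cell → bddMeanZero lam R) (m : ℕ) (Q : Cell) :
    ℓ (bddToHardy q hlam hR (treeAvg Cell.child m w Q)) =
      treeAvg Cell.child m (fun Q' => ℓ (bddToHardy q hlam hR (w Q'))) Q :=
  map_treeAvg Cell.child (((ℓ : LittleHardy lam q →ₗ[ℂ] ℂ) ∘ₗ
    bddToHardy q hlam hR).restrictScalars ℝ) m w Q

theorem cellValue_root : c.cellValue hlam hR ℓ Cell.root = 0 := by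
  have : c.bumpSub hlam hR Cell.root = 0 := Subtype.ext (sub_self _)
  rw [cellValue, this, map_zero, map_zero]

theorem cellValue_eq_child (Q : Cell) :
    c.cellValue hlam hR ℓ Q = (4 : ℝ)⁻¹ • ∑ k, c.cellValue hlam hR ℓ (Q.child k) := by
  have := apply_treeAvg hlam hR ℓ (c.bumpSub hlam hR) 1 Q
  simp only [treeAvg_succ, treeAvg_zero] at this
  rw [← c.bumpSub_eq_child hlam hR] at this
  exact this

/-- With unimodular weights the mean oscillation becomes the value of `ℓ` at one bounded mean-zero
function carried by the cell. That function is a controlled multiple of an atom, whatever the depth.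
-/
theorem treeAvg_norm_cellValue_sub_le (m : ℕ) (Q : Cell) :
    treeAvg Cell.child m (fun Q' => ‖c.cellValue hlam hR ℓ Q' - c.cellValue hlam hR ℓ Q‖) Q ≤
      2 * ‖ℓ‖ * (planeMeasure lam).real R := by
  set β := c.cellValue hlam hR ℓ with hβ
  set σ : Cell → ℂ := fun Q' => (starRingEnd ℂ) (β Q' - β Q) / ‖β Q' - β Q‖ with hσ
  have hσ1 : ∀ Q', ‖σ Q'‖ ≤ 1 := fun Q' => by
    rw [hσ]
    simp only [norm_div, RCLike.norm_conj, Complex.norm_real, norm_norm]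
    exact div_self_le_one _
  have hσβ : ∀ Q', σ Q' * (β Q' - β Q) = (‖β Q' - β Q‖ : ℝ) := fun Q' => by
    rw [hσ]
    simp only
    rw [div_mul_eq_mul_div, mul_comm, Complex.mul_conj, Complex.normSq_eq_norm_sq]
    push_cast
    rw [sq, mul_self_div_self]
  set w : bddMeanZero lam R := treeAvg Cell.child m
    (fun Q' => σ Q' • (c.bumpSub hlam hR Q' - c.bumpSub hlam hR Q)) Q with hw
  have h1 : ((treeAvg Cell.child m (fun Q' => ‖β Q' - β Q‖) Q : ℝ) : ℂ) =
      ℓ (bddToHardy q hlam hR w) := by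
    rw [hw, apply_treeAvg]
    simp only [map_smul, map_sub, smul_eq_mul]
    refine (map_treeAvg Cell.child Complex.ofRealLI.toLinearMap m _ Q).trans ?_
    congr 1
    ext Q'
    exact (hσβ Q').symm
  -- The absolute values of the bumps themselves average to the bump of `Q`, so the bound does not
  -- grow with `m`.
  have hwx : ∀ x, ‖(w : ℝ × ℝ → ℂ) x‖ ≤ 2 * ‖c.bump Q x‖ := fun x => by
    rw [hw, coe_treeAvg_apply]
    refine (norm_treeAvg_le Cell.child _ m Q).trans ?_
    calc _ ≤ treeAvg Cell.child m (fun Q' => ‖c.bump Q' x‖ + ‖c.bump Q x‖) Q := by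
          refine treeAvg_mono Cell.child (fun Q' => ?_) m Q
          have : (((σ Q' • (c.bumpSub hlam hR Q' - c.bumpSub hlam hR Q) : bddMeanZero lam R)) :
              ℝ × ℝ → ℂ) x = σ Q' * (c.bump Q' x - c.bump Q x) := by
            rw [Submodule.coe_smul, Submodule.coe_sub, coe_bumpSub, coe_bumpSub,
              sub_sub_sub_cancel_right]
            rfl
          rw [this, norm_mul]
          refine (mul_le_of_le_one_left (norm_nonneg _) (hσ1 Q')).trans (norm_sub_le _ _)
      _ = _ := by
          rw [treeAvg_add, treeAvg_const, treeAvg_eq_self Cell.child (c.norm_bump_eq_child x)]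
          ring
  obtain ⟨R', hR', -, hae⟩ := c.exists_rectangle Q
  have hsupp : ∀ᵐ x ∂(planeMeasure lam), x ∉ R' → (w : ℝ × ℝ → ℂ) x = 0 := by
    filter_upwards [hae] with x hx hxR
    have hx' : ¬ (x ∈ R ∧ c.map x ∈ Q.set) := fun h => hxR ((iff_of_eq hx).2 h)
    have := hwx x
    rw [c.bump_of_notMem hx', norm_zero, mul_zero] at this
    exact norm_le_zero_iff.1 this
  -- The height `2 / r ^ 2` compensates the measure `r ^ 2 * μ_λ(R)` of the small rectangle.
  have h2 := norm_bddToHardy_le q hlam hR w hR' hsupp (K := 2 * (Q.r ^ 2)⁻¹) (by positivity)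
    fun x => (hwx x).trans (by gcongr; exact c.norm_bump_le Q x)
  have hr := Q.r_pos
  rw [measureReal_congr hae, Measure.real, c.measure_cell, ENNReal.toReal_mul,
    ENNReal.toReal_ofReal (sq_nonneg _), ← Measure.real] at h2
  have h0 : 0 ≤ treeAvg Cell.child m (fun Q' => ‖β Q' - β Q‖) Q := by
    have := treeAvg_mono Cell.child (c := fun _ => (0 : ℝ)) (fun Q' => norm_nonneg (β Q' - β Q)) m Q
    rwa [treeAvg_const] at this
  calc _ = ‖ℓ (bddToHardy q hlam hR w)‖ := by
        rw [← h1, Complex.norm_real, Real.norm_of_nonneg h0]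
    _ ≤ ‖ℓ‖ * (2 * (Q.r ^ 2)⁻¹ * ((planeMeasure lam).real R * Q.r ^ 2)) :=
        (ℓ.le_opNorm _).trans (by gcongr)
    _ = _ := by field_simp

end Functional

/-- The projection of a function to step functions on the cells at depth `m`. -/
def step (hlam : 0 < lam) (hR : IsRectangle R) (m : ℕ) (f : bddMeanZero lam R) :
    bddMeanZero lam R :=
  treeAvg Cell.child m (fun Q => Q.avg (fun y => (f : ℝ × ℝ → ℂ) (c.inv y)) •
    c.bumpSub hlam hR Q) Cell.root

theorem integrableOn_comp_inv_of_mem (hlam : 0 < lam) (hR : IsRectangle R)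
    (f : bddMeanZero lam R) : IntegrableOn (fun y => (f : ℝ × ℝ → ℂ) (c.inv y))
    Cell.root.set :=
  c.integrableOn_comp_inv hR.measurableSet (hR.measure_ne hlam).1 (hR.measure_ne hlam).2
    f.2.1.stronglyMeasurable f.2.2.1.integrableOn

theorem avg_root_eq_zero (hlam : 0 < lam) (hR : IsRectangle R) (f : bddMeanZero lam R) :
    Cell.root.avg (fun y => (f : ℝ × ℝ → ℂ) (c.inv y)) = 0 := by
  rw [c.avg_comp_inv hR.measurableSet (hR.measure_ne hlam).1 (hR.measure_ne hlam).2
    f.2.1.stronglyMeasurable, root_cell, setAverage_eq,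
    setIntegral_eq_integral_of_forall_compl_eq_zero f.2.2.2.1, f.2.2.2.2.2, smul_zero]

/-- The root bumps subtracted in `bumpSub` contribute a multiple of the mean of `f`, which is zero.
-/
theorem step_apply (hlam : 0 < lam) (hR : IsRectangle R) (f : bddMeanZero lam R) (m : ℕ)
    {x : ℝ × ℝ} (hx : x ∈ R) :
    (c.step hlam hR m f : ℝ × ℝ → ℂ) x =
      (Cell.leaf m Cell.root (c.map x)).avg fun y => (f : ℝ × ℝ → ℂ) (c.inv y) := by
  have h1 : ∀ Q : Cell, ((Q.avg (fun y => (f : ℝ × ℝ → ℂ) (c.inv y)) • c.bumpSub hlam hR Q :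
      bddMeanZero lam R) : ℝ × ℝ → ℂ) x =
      Q.avg (fun y => (f : ℝ × ℝ → ℂ) (c.inv y)) * c.bump Q x +
      (-c.bump Cell.root x) • Q.avg (fun y => (f : ℝ × ℝ → ℂ) (c.inv y)) := fun Q => by
    rw [Submodule.coe_smul, coe_bumpSub, Pi.smul_apply, Pi.sub_apply, smul_eq_mul, smul_eq_mul]
    ring
  rw [step, coe_treeAvg_apply]
  simp only [h1]
  have h2 := map_treeAvg Cell.child
    ((LinearMap.mulLeft ℂ (-c.bump Cell.root x)).restrictScalars ℝ) m
    (fun Q => Q.avg (fun y => (f : ℝ × ℝ → ℂ) (c.inv y))) Cell.root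
  rw [treeAvg_eq_self Cell.child (Cell.avg_eq_child (c.integrableOn_comp_inv_of_mem hlam hR f)),
    c.avg_root_eq_zero hlam hR, map_zero] at h2
  rw [treeAvg_add, treeAvg_bump]
  rw [show treeAvg Cell.child m (fun Q => (-c.bump Cell.root x) •
    Q.avg (fun y => (f : ℝ × ℝ → ℂ) (c.inv y))) Cell.root = 0 from h2.symm,
    c.bump_of_mem hx (c.map_mem x hx)]
  simp [Cell.root]

theorem integrableOn_sq (f : bddMeanZero lam R) :
    IntegrableOn (fun x => ‖(f : ℝ × ℝ → ℂ) x‖ ^ 2) R (planeMeasure lam) := by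
  obtain ⟨K, hK⟩ := f.2.2.2.2.1
  have := (f.2.2.1.norm.bdd_mul (c := K) f.2.1.norm.aestronglyMeasurable
    (Filter.Eventually.of_forall fun x => by simpa using hK x)).integrableOn (s := R)
  simpa only [sq] using this

theorem treeAvg_sq_norm_avg_le (hlam : 0 < lam) (hR : IsRectangle R)
    (f : bddMeanZero lam R) (m : ℕ) :
    treeAvg Cell.child m (fun Q => ‖Q.avg fun y => (f : ℝ × ℝ → ℂ) (c.inv y)‖ ^ 2) Cell.root ≤
      ((planeMeasure lam).real R)⁻¹ *
        ∫ x in R, ‖(f : ℝ × ℝ → ℂ) x‖ ^ 2 ∂(planeMeasure lam) := by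
  obtain ⟨h0, hi⟩ := hR.measure_ne hlam
  have hF := c.integrableOn_comp_inv_of_mem hlam hR f
  have hm : StronglyMeasurable fun x => ‖(f : ℝ × ℝ → ℂ) x‖ ^ 2 :=
    (f.2.1.norm.pow_const 2).stronglyMeasurable
  have hF2 := c.integrableOn_comp_inv hR.measurableSet h0 hi hm (integrableOn_sq f)
  have h1 : ∀ Q : Cell, ‖Q.avg fun y => (f : ℝ × ℝ → ℂ) (c.inv y)‖ ^ 2 ≤
      Q.avg fun y => ‖(f : ℝ × ℝ → ℂ) (c.inv y)‖ ^ 2 := fun Q => by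
    have hQ0 : volume Q.set ≠ 0 := by
      rw [Q.volume_set]; simpa using Q.r_pos.ne'
    have hQi : volume Q.set ≠ ∞ := by rw [Q.volume_set]; exact ENNReal.ofReal_ne_top
    rw [Cell.avg_eq_average, Cell.avg_eq_average]
    have hconv : ConvexOn ℝ univ fun z : ℂ => ‖z‖ ^ 2 :=
      convexOn_univ_norm.pow (fun _ _ => norm_nonneg _) 2
    exact hconv.map_set_average_le (by fun_prop) isClosed_univ hQ0 hQi (by simp)
      (hF.mono_set Q.set_subset_root) (hF2.mono_set Q.set_subset_root)
  refine (treeAvg_mono Cell.child h1 m Cell.root).trans_eq ?_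
  rw [treeAvg_eq_self Cell.child (Cell.avg_eq_child hF2),
    c.avg_comp_inv hR.measurableSet h0 hi hm, root_cell, setAverage_eq, smul_eq_mul]

/-- A norming functional evaluates the step function as the tree average of the products of the cell
means of `f` with the cell values of the functional. Jensen bounds the first factor in mean square,
John–Nirenberg the second. -/
theorem exists_norm_step_le (hlam : 0 < lam) (hR : IsRectangle R) (q : ℝ≥0∞) [hq : Fact (1 < q)] :
    ∃ D : ℝ, 0 < D ∧ ∀ (f : bddMeanZero lam R) (m : ℕ) (ρ : ℝ), 0 < ρ →
      ∫ x in R, ‖(f : ℝ × ℝ → ℂ) x‖ ^ 2 ∂(planeMeasure lam) ≤ ρ ^ 2 →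
      ‖bddToHardy q hlam hR (c.step hlam hR m f)‖ ≤ D * ρ := by
  obtain ⟨h0, hi⟩ := hR.measure_ne hlam
  have hv : 0 < (planeMeasure lam).real R := ENNReal.toReal_pos h0 hi
  have hl : 0 < Real.log 2 := Real.log_pos one_lt_two
  set v := (planeMeasure lam).real R with hvdef
  -- The second moment bound with oscillation `M = 2 * v`, valid for a functional of norm one.
  set D₀ : ℝ := 4 * (2 : ℕ).factorial * (8 / Real.log 2) ^ 2 * (2 * v) ^ 2 with hD₀
  have hD₀pos : 0 < D₀ := by positivity
  refine ⟨(v⁻¹ + D₀) / 2, by positivity, fun f m ρ hρ hf => ?_⟩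
  by_cases hz : ‖bddToHardy q hlam hR (c.step hlam hR m f)‖ = 0
  · rw [hz]; positivity
  obtain ⟨ℓ, hℓ, hval⟩ := exists_dual_vector ℂ (bddToHardy q hlam hR (c.step hlam hR m f)) hz
  have h1 : ‖bddToHardy q hlam hR (c.step hlam hR m f)‖ =
      ‖ℓ (bddToHardy q hlam hR (c.step hlam hR m f))‖ := by
    rw [hval, RCLike.norm_ofReal, abs_of_nonneg (norm_nonneg _)]
  set β := c.cellValue hlam hR ℓ with hβ
  have hosc : ∀ m Q, treeAvg Cell.child m (fun Q' => ‖β Q' - β Q‖) Q ≤ 2 * v := fun m Q => by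
    have := c.treeAvg_norm_cellValue_sub_le hlam hR ℓ m Q
    rwa [hℓ, mul_one] at this
  have hβ2 := treeAvg_pow_le Cell.child (by positivity) (c.cellValue_eq_child hlam hR ℓ) hosc 2 m
    Cell.root
  rw [c.cellValue_root] at hβ2
  simp only [sub_zero] at hβ2
  have hc2 := c.treeAvg_sq_norm_avg_le hlam hR f m
  rw [h1, step, apply_treeAvg hlam hR ℓ]
  refine (norm_treeAvg_le Cell.child _ m _).trans ?_
  set F : Cell → ℂ := fun Q => Q.avg fun y => (f : ℝ × ℝ → ℂ) (c.inv y) with hF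
  -- Cauchy–Schwarz in the form of a weighted arithmetic-geometric inequality; the weight `ρ` makes
  -- both averages of order `ρ`.
  calc _ ≤ treeAvg Cell.child m (fun Q => (ρ⁻¹ / 2) * ‖F Q‖ ^ 2 + (ρ / 2) * ‖β Q‖ ^ 2)
        Cell.root := by
        refine treeAvg_mono Cell.child (fun Q => ?_) m _
        rw [map_smul, map_smul, smul_eq_mul, norm_mul]
        have e : (ρ⁻¹ / 2) * ‖F Q‖ ^ 2 + (ρ / 2) * ‖β Q‖ ^ 2 - ‖F Q‖ * ‖β Q‖ =
            (ρ⁻¹ / 2) * (‖F Q‖ - ρ * ‖β Q‖) ^ 2 := by field_simp; ring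
        have : 0 ≤ (ρ⁻¹ / 2) * (‖F Q‖ - ρ * ‖β Q‖) ^ 2 := by positivity
        change ‖F Q‖ * ‖β Q‖ ≤ _
        linarith
    _ = (ρ⁻¹ / 2) * treeAvg Cell.child m (fun Q => ‖F Q‖ ^ 2) Cell.root +
        (ρ / 2) * treeAvg Cell.child m (fun Q => ‖β Q‖ ^ 2) Cell.root := by
        rw [treeAvg_add, treeAvg_const_mul, treeAvg_const_mul]
    _ ≤ (ρ⁻¹ / 2) * (v⁻¹ * ρ ^ 2) + (ρ / 2) * D₀ := by
        gcongr
        exact hc2.trans (by gcongr)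
    _ = _ := by field_simp

/-- Lebesgue differentiation gives convergence almost everywhere, and a sup bound `K` for `f` also
bounds its averages, so `(2 * K) ^ 2` dominates. -/
theorem tendsto_integral_sq_sub_step (hlam : 0 < lam) (hR : IsRectangle R)
    (f : bddMeanZero lam R) :
    Filter.Tendsto (fun m => ∫ x in R, ‖((f - c.step hlam hR m f : bddMeanZero lam R) :
      ℝ × ℝ → ℂ) x‖ ^ 2 ∂(planeMeasure lam)) Filter.atTop (nhds 0) := by
  obtain ⟨h0, hi⟩ := hR.measure_ne hlam
  obtain ⟨K, hK⟩ := f.2.2.2.2.1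
  have hF := c.integrableOn_comp_inv_of_mem hlam hR f
  have hav : ∀ Q : Cell, ‖Q.avg fun y => (f : ℝ × ℝ → ℂ) (c.inv y)‖ ≤ K := fun Q => by
    have hr := Q.r_pos
    rw [Cell.avg, norm_smul, norm_inv, Real.norm_of_nonneg (by positivity),
      inv_mul_le_iff₀ (by positivity), mul_comm, ← Q.volume_real_set]
    exact norm_setIntegral_le_of_norm_le_const (by rw [Q.volume_set]; exact ENNReal.ofReal_lt_top)
      fun x _ => hK _
  have hae : ∀ᵐ x ∂((planeMeasure lam).restrict R), Filter.Tendsto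
      (fun m => (Cell.leaf m Cell.root (c.map x)).avg fun y => (f : ℝ × ℝ → ℂ) (c.inv y))
      Filter.atTop (nhds ((f : ℝ × ℝ → ℂ) (c.inv (c.map x)))) := by
    refine ae_of_ae_map (p := fun y => Filter.Tendsto
      (fun m => (Cell.leaf m Cell.root y).avg fun y => (f : ℝ × ℝ → ℂ) (c.inv y))
      Filter.atTop (nhds ((f : ℝ × ℝ → ℂ) (c.inv y)))) c.measurable_map.aemeasurable ?_
    rw [c.map_eq]
    exact Measure.ae_smul_measure (Cell.ae_tendsto_avg_leaf hF) _
  have hlim := tendsto_integral_of_dominated_convergence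
    (μ := (planeMeasure lam).restrict R) (f := fun _ => (0 : ℝ))
    (F := fun m x => ‖((f - c.step hlam hR m f : bddMeanZero lam R) : ℝ × ℝ → ℂ) x‖ ^ 2)
    (fun _ => (2 * K) ^ 2)
    (fun m => ((f - c.step hlam hR m f).2.1.norm.pow_const 2).aestronglyMeasurable)
    (integrableOn_const hi) (fun m => ?_) ?_
  · simpa using hlim
  · filter_upwards [ae_restrict_mem hR.measurableSet] with x hx
    rw [norm_pow, norm_norm, Submodule.coe_sub, Pi.sub_apply, c.step_apply hlam hR f m hx]
    gcongr
    refine (norm_sub_le _ _).trans ?_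
    linarith [hK x, hav (Cell.leaf m Cell.root (c.map x))]
  · filter_upwards [ae_restrict_mem hR.measurableSet, hae] with x hx h
    rw [c.inv_map x hx] at h
    have := ((h.const_sub ((f : ℝ × ℝ → ℂ) x)).norm).pow 2
    rw [sub_self, norm_zero, zero_pow two_ne_zero] at this
    refine this.congr fun m => ?_
    rw [Submodule.coe_sub, Pi.sub_apply, c.step_apply hlam hR f m hx]

end Chart

/-! ### Representation of functionals -/

section Representation

variable {lam : ℝ} {R : Set (ℝ × ℝ)} {q : ℝ≥0∞} [hq : Fact (1 < q)]

theorem norm_toLp_bddToHardy_le (hlam : 0 < lam) (hR : IsRectangle R) (f : bddMeanZero lam R)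
    {ρ : ℝ} (hρ : 0 < ρ)
    (hf : ∫ x in R, ‖(f : ℝ × ℝ → ℂ) x‖ ^ 2 ∂(planeMeasure lam) ≤ ρ ^ 2) :
    ‖(bddToHardy q hlam hR f).toLp‖ ≤ (1 + (planeMeasure lam).real R) * ρ := by
  obtain ⟨h0, hi⟩ := hR.measure_ne hlam
  have hint : IntegrableOn (fun x => (2 * ρ)⁻¹ * ‖(f : ℝ × ℝ → ℂ) x‖ ^ 2 + ρ / 2) R
      (planeMeasure lam) :=
    Integrable.add ((Chart.integrableOn_sq f).const_mul _) (integrableOn_const hi)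
  rw [L1.norm_eq_integral_norm, integral_congr_ae (g := fun x => ‖(f : ℝ × ℝ → ℂ) x‖)
    (by filter_upwards [bddToHardy_ae_eq q hlam hR f] with x hx; rw [hx]),
    ← setIntegral_eq_integral_of_forall_compl_eq_zero (s := R)
      (fun x hx => by rw [f.2.2.2.1 x hx, norm_zero])]
  calc _ ≤ ∫ x in R, ((2 * ρ)⁻¹ * ‖(f : ℝ × ℝ → ℂ) x‖ ^ 2 + ρ / 2) ∂(planeMeasure lam) := by
        refine integral_mono f.2.2.1.norm.integrableOn hint fun x => ?_
        have e : (2 * ρ)⁻¹ * ‖(f : ℝ × ℝ → ℂ) x‖ ^ 2 + ρ / 2 - ‖(f : ℝ × ℝ → ℂ) x‖ =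
            (2 * ρ)⁻¹ * (‖(f : ℝ × ℝ → ℂ) x‖ - ρ) ^ 2 := by field_simp; ring
        have : 0 ≤ (2 * ρ)⁻¹ * (‖(f : ℝ × ℝ → ℂ) x‖ - ρ) ^ 2 := by positivity
        simp only
        linarith
    _ = (2 * ρ)⁻¹ * ∫ x in R, ‖(f : ℝ × ℝ → ℂ) x‖ ^ 2 ∂(planeMeasure lam) +
        (planeMeasure lam).real R * (ρ / 2) := by
        rw [integral_add ((Chart.integrableOn_sq f).const_mul _) (integrableOn_const hi),
          integral_const_mul, setIntegral_const, smul_eq_mul]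
    _ ≤ (2 * ρ)⁻¹ * ρ ^ 2 + (planeMeasure lam).real R * (ρ / 2) := by gcongr
    _ ≤ _ := by
        have e : (2 * ρ)⁻¹ * ρ ^ 2 = ρ / 2 := by field_simp
        have : 0 ≤ (planeMeasure lam).real R := measureReal_nonneg
        rw [e]
        nlinarith

/-- The projections converge in `L²`, with no convergence in the Hardy norm known in advance.
Projecting the remainders repeatedly, each time halving the `L²` bound, gives a series of step
functions that converges absolutely in the Hardy space. -/
theorem exists_norm_bddToHardy_le (hlam : 0 < lam) (hR : IsRectangle R) (q : ℝ≥0∞)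
    [hq : Fact (1 < q)] : ∃ D : ℝ, 0 < D ∧ ∀ (f : bddMeanZero lam R) (ρ : ℝ), 0 < ρ →
      ∫ x in R, ‖(f : ℝ × ℝ → ℂ) x‖ ^ 2 ∂(planeMeasure lam) ≤ ρ ^ 2 →
      ‖bddToHardy q hlam hR f‖ ≤ D * ρ := by
  have := LittleHardy.completeSpace lam q
  obtain ⟨c⟩ := hR.exists_chart hlam
  obtain ⟨D, hD, hstep⟩ := c.exists_norm_step_le hlam hR q
  refine ⟨2 * D, by positivity, fun f ρ hρ hf => ?_⟩
  set S : bddMeanZero lam R → ℝ := fun f =>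
    ∫ x in R, ‖(f : ℝ × ℝ → ℂ) x‖ ^ 2 ∂(planeMeasure lam) with hS
  have hex : ∀ (k : ℕ) (f : bddMeanZero lam R), ∃ g : bddMeanZero lam R,
      S f ≤ (ρ / 2 ^ k) ^ 2 → ‖bddToHardy q hlam hR g‖ ≤ D * (ρ / 2 ^ k) ∧
        S (f - g) ≤ (ρ / 2 ^ (k + 1)) ^ 2 := by
    intro k f
    have hpos : (0 : ℝ) < (ρ / 2 ^ (k + 1)) ^ 2 := by positivity
    obtain ⟨m, hm⟩ := ((c.tendsto_integral_sq_sub_step hlam hR f).eventually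
      (gt_mem_nhds hpos)).exists
    exact ⟨c.step hlam hR m f, fun h => ⟨hstep f m _ (by positivity) h, hm.le⟩⟩
  -- The smallness hypothesis was placed inside the existential so that `g` is defined for every
  -- function; the recursion below can then precede its estimates.
  choose g hg using hex
  set F : ℕ → bddMeanZero lam R := fun n => Nat.rec f (fun k f => f - g k f) n with hF
  have hF0 : F 0 = f := rfl
  have hFs : ∀ k, F (k + 1) = F k - g k (F k) := fun k => rfl
  have hFS : ∀ k, S (F k) ≤ (ρ / 2 ^ k) ^ 2 := fun k => by
    induction k with
    | zero => rw [hF0, pow_zero, div_one]; exact hf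
    | succ k ih => rw [hFs]; exact (hg k _ ih).2
  set u : ℕ → LittleHardy lam q := fun k => bddToHardy q hlam hR (g k (F k)) with hu
  have hun : ∀ k, ‖u k‖ ≤ D * ρ * (1 / 2) ^ k := fun k => by
    refine (hg k _ (hFS k)).1.trans_eq ?_
    rw [one_div, inv_pow]
    ring
  have hgeo : HasSum (fun k : ℕ => D * ρ * (1 / 2 : ℝ) ^ k) (2 * D * ρ) := by
    have := hasSum_geometric_two.mul_left (D * ρ)
    rwa [mul_comm (D * ρ) 2, ← mul_assoc] at this
  have hus : Summable u := Summable.of_norm_bounded hgeo.summable hun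
  have hpart : ∀ n, ∑ k ∈ Finset.range n, u k =
      bddToHardy q hlam hR f - bddToHardy q hlam hR (F n) := fun n => by
    induction n with
    | zero => rw [Finset.sum_range_zero, hF0, sub_self]
    | succ n ih => rw [Finset.sum_range_succ, ih, hFs, map_sub]; simp only [hu]; abel
  have hlim : Filter.Tendsto (fun n => (bddToHardy q hlam hR (F n)).toLp) Filter.atTop
      (nhds 0) := by
    refine squeeze_zero_norm (a := fun n : ℕ => (1 + (planeMeasure lam).real R) *
      (ρ * (1 / 2 : ℝ) ^ n)) (fun n => ?_) ?_
    · have := norm_toLp_bddToHardy_le (q := q) hlam hR (F n) (ρ := ρ / 2 ^ n) (by positivity)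
        (hFS n)
      rwa [div_eq_mul_inv, ← inv_pow, ← one_div] at this
    · have := ((tendsto_pow_atTop_nhds_zero_of_lt_one (by norm_num : (0 : ℝ) ≤ 1 / 2)
        (by norm_num)).const_mul ρ).const_mul (1 + (planeMeasure lam).real R)
      rwa [mul_zero, mul_zero] at this
  -- The Hardy sum is identified in `L¹`, where the remainders tend to zero.
  have heq : bddToHardy q hlam hR f = ∑' k, u k := by
    apply LittleHardy.toLp_injective
    have h1 := ((LittleHardy.toLpCLM lam q).continuous.tendsto _).comp
      hus.hasSum.tendsto_sum_nat
    have h2 : Filter.Tendsto (fun n => (bddToHardy q hlam hR f).toLp -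
        (bddToHardy q hlam hR (F n)).toLp) Filter.atTop
        (nhds ((bddToHardy q hlam hR f).toLp - 0)) := tendsto_const_nhds.sub hlim
    rw [sub_zero] at h2
    refine tendsto_nhds_unique h2 (h1.congr fun n => ?_)
    rw [Function.comp_apply, hpart, map_sub]
    rfl
  rw [heq]
  exact tsum_of_norm_bounded hgeo hun

/-- The inclusion of bounded functions into `L²` of a rectangle. -/
def bddToL2 (lam : ℝ) (R : Set (ℝ × ℝ)) :
    bddMeanZero lam R →ₗ[ℂ] Lp ℂ 2 ((planeMeasure lam).restrict R) where
  toFun f := MemLp.toLp f ((memLp_two_iff_integrable_sq_norm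
    f.2.1.aestronglyMeasurable).2 (Chart.integrableOn_sq f))
  map_add' _ _ := MemLp.toLp_add _ _
  map_smul' z _ := MemLp.toLp_const_smul z _

theorem bddToL2_ae_eq (f : bddMeanZero lam R) :
    (bddToL2 lam R f : ℝ × ℝ → ℂ) =ᵐ[(planeMeasure lam).restrict R] f :=
  MemLp.coeFn_toLp ((memLp_two_iff_integrable_sq_norm
    f.2.1.aestronglyMeasurable).2 (Chart.integrableOn_sq f))

theorem norm_bddToL2_sq (f : bddMeanZero lam R) :
    ‖bddToL2 lam R f‖ ^ 2 = ∫ x in R, ‖(f : ℝ × ℝ → ℂ) x‖ ^ 2 ∂(planeMeasure lam) := by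
  have h1 : ((‖bddToL2 lam R f‖ ^ 2 : ℝ) : ℂ) = inner ℂ (bddToL2 lam R f) (bddToL2 lam R f) := by
    rw [inner_self_eq_norm_sq_to_K]; push_cast; rfl
  have h2 : inner ℂ (bddToL2 lam R f) (bddToL2 lam R f) =
      ((∫ x in R, ‖(f : ℝ × ℝ → ℂ) x‖ ^ 2 ∂(planeMeasure lam) : ℝ) : ℂ) := by
    rw [L2.inner_def, ← integral_complex_ofReal]
    refine integral_congr_ae ?_
    filter_upwards [bddToL2_ae_eq f] with x hx
    rw [hx, inner_self_eq_norm_sq_to_K]; push_cast; rfl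
  exact_mod_cast h1.trans h2

/-- By the `L²` control of the Hardy norm, `ℓ` induces a bounded functional on a subspace of
`L²(R)`; Hahn–Banach and Riesz supply `b`. -/
theorem exists_representation (hlam : 0 < lam) (hR : IsRectangle R)
    (ℓ : LittleHardy lam q →L[ℂ] ℂ) : ∃ b : ℝ × ℝ → ℂ, Measurable b ∧
      IntegrableOn b R (planeMeasure lam) ∧ ∀ f : bddMeanZero lam R,
        ℓ (bddToHardy q hlam hR f) = ∫ x, b x * (f : ℝ × ℝ → ℂ) x ∂(planeMeasure lam) := by
  obtain ⟨h0, hi⟩ := hR.measure_ne hlam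
  obtain ⟨D, hD, hDb⟩ := exists_norm_bddToHardy_le hlam hR q
  have hbound : ∀ f : bddMeanZero lam R,
      ‖ℓ (bddToHardy q hlam hR f)‖ ≤ ‖ℓ‖ * D * ‖bddToL2 lam R f‖ := fun f => by
    have h1 : ‖bddToHardy q hlam hR f‖ ≤ D * ‖bddToL2 lam R f‖ := by
      refine le_of_forall_pos_le_add fun ε hε => ?_
      have := hDb f (‖bddToL2 lam R f‖ + ε / D) (by positivity) (by
        rw [← norm_bddToL2_sq f]
        gcongr
        exact le_add_of_nonneg_right (by positivity))
      rwa [mul_add, mul_div_cancel₀ _ hD.ne'] at this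
    rw [mul_assoc]
    exact (ℓ.le_opNorm _).trans (by gcongr)
  -- An arbitrary linear choice of representatives of the `L²` classes. Its effect disappears
  -- because `ℓ` vanishes on functions of zero `L²` norm.
  obtain ⟨s, hs⟩ := (bddToL2 lam R).rangeRestrict.exists_rightInverse_of_surjective
    (bddToL2 lam R).range_rangeRestrict
  have hs' : ∀ y, bddToL2 lam R (s y) = y := fun y =>
    congrArg Subtype.val (LinearMap.congr_fun hs y)
  obtain ⟨Λ, hΛ, -⟩ := exists_extension_norm_eq (LinearMap.range (bddToL2 lam R))
    (LinearMap.mkContinuous ((ℓ : LittleHardy lam q →ₗ[ℂ] ℂ) ∘ₗ bddToHardy q hlam hR ∘ₗ s)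
      (‖ℓ‖ * D) fun y => by
        have := hbound (s y)
        rwa [hs'] at this)
  have hΛf : ∀ f, Λ (bddToL2 lam R f) = ℓ (bddToHardy q hlam hR f) := fun f => by
    have h1 := hΛ ⟨bddToL2 lam R f, LinearMap.mem_range_self _ f⟩
    have h2 := hbound (f - s ⟨bddToL2 lam R f, LinearMap.mem_range_self _ f⟩)
    rw [map_sub (bddToL2 lam R), hs', sub_self, norm_zero, mul_zero, map_sub, map_sub] at h2
    exact h1.trans (sub_eq_zero.1 (norm_le_zero_iff.1 h2)).symm
  set y := (InnerProductSpace.toDual ℂ (Lp ℂ 2 ((planeMeasure lam).restrict R))).symm Λ with hy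
  have hfinite : IsFiniteMeasure ((planeMeasure lam).restrict R) :=
    ⟨by rw [Measure.restrict_apply_univ]; exact hi.lt_top⟩
  have hyi : Integrable y ((planeMeasure lam).restrict R) := (Lp.memLp y).integrable one_le_two
  -- The inner product conjugates its first argument, whereas the pairing is bilinear.
  refine ⟨fun x => (starRingEnd ℂ) (y x),
    Complex.continuous_conj.measurable.comp (Lp.stronglyMeasurable y).measurable, ?_, fun f => ?_⟩
  · refine hyi.norm.mono' (Complex.continuous_conj.comp_aestronglyMeasurable hyi.1)
      (Filter.Eventually.of_forall fun x => ?_)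
    simp
  · have hset : ∫ x in R, (starRingEnd ℂ) (y x) * (f : ℝ × ℝ → ℂ) x ∂(planeMeasure lam) =
        ∫ x, (starRingEnd ℂ) (y x) * (f : ℝ × ℝ → ℂ) x ∂(planeMeasure lam) :=
      setIntegral_eq_integral_of_forall_compl_eq_zero
        fun x hx => by rw [f.2.2.2.1 x hx, mul_zero]
    rw [← hΛf, ← InnerProductSpace.toDual_symm_apply, ← hy, L2.inner_def, ← hset]
    refine integral_congr_ae ?_
    filter_upwards [bddToL2_ae_eq f] with x hx
    rw [hx, RCLike.inner_apply, mul_comm]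

end Representation

theorem ae_eq_average_of_meanOsc_eq_zero {lam : ℝ} (hlam : 0 < lam) {R : Set (ℝ × ℝ)}
    (hR : IsRectangle R) {g : ℝ × ℝ → ℂ} (hg : Measurable g) (h : meanOsc lam g R = 0) :
    ∀ᵐ x ∂((planeMeasure lam).restrict R), g x = ⨍ y in R, g y ∂(planeMeasure lam) := by
  obtain ⟨h0, hi⟩ := hR.measure_ne hlam
  rw [meanOsc, mul_eq_zero, ENNReal.inv_eq_zero, or_iff_right hi,
    lintegral_eq_zero_iff (hg.sub_const _).enorm] at h
  filter_upwards [h] with x hx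
  simpa [sub_eq_zero] using hx

/-! ### Exhaustion of the quadrant -/

/-- The squares `(0, n + 1) × (0, n + 1)`, which exhaust the quadrant. -/
def square (n : ℕ) : Set (ℝ × ℝ) := Ioo 0 (n + 1 : ℝ) ×ˢ Ioo 0 (n + 1 : ℝ)

theorem isRectangle_square (n : ℕ) : IsRectangle (square n) :=
  isRectangle_iff.2 ⟨0, n + 1, 0, n + 1, le_rfl, by positivity, le_rfl, by positivity, rfl⟩

theorem square_mono {m n : ℕ} (h : m ≤ n) : square m ⊆ square n := by
  have : (m : ℝ) + 1 ≤ n + 1 := by gcongr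
  exact prod_mono (Ioo_subset_Ioo_right this) (Ioo_subset_Ioo_right this)

theorem IsRectangle.exists_subset_square {R : Set (ℝ × ℝ)} (hR : IsRectangle R) :
    ∃ n, R ⊆ square n := by
  obtain ⟨a, b, c, d, ha, hab, hc, hcd, rfl⟩ := isRectangle_iff.1 hR
  obtain ⟨n, hn⟩ := exists_nat_ge (max b d)
  refine ⟨n, prod_mono (Ioo_subset_Ioo ha ?_) (Ioo_subset_Ioo hc ?_)⟩
  · linarith [le_max_left b d]
  · linarith [le_max_right b d]

/-- The index of the first square which contains a given point of the quadrant. -/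
def squareIndex (x : ℝ × ℝ) : ℕ := ⌊max x.1 x.2⌋₊

theorem measurable_squareIndex : Measurable squareIndex :=
  (measurable_fst.max measurable_snd).nat_floor

theorem mem_square_squareIndex {x : ℝ × ℝ} (hx : x ∈ quadrant) : x ∈ square (squareIndex x) := by
  have := Nat.lt_floor_add_one (max x.1 x.2)
  exact ⟨⟨hx.1, (le_max_left _ _).trans_lt this⟩, hx.2, (le_max_right _ _).trans_lt this⟩

theorem squareIndex_le {x : ℝ × ℝ} {n : ℕ} (hx : x ∈ square n) : squareIndex x ≤ n := by
  refine Nat.lt_succ_iff.1 ((Nat.floor_lt ?_).2 ?_)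
  · exact hx.1.1.le.trans (le_max_left _ _)
  · push_cast
    exact max_lt hx.1.2 hx.2.2

theorem square_subset_quadrant (n : ℕ) : square n ⊆ quadrant := fun _ hx => ⟨hx.1.1, hx.2.1⟩

theorem ae_mem_quadrant (lam : ℝ) : ∀ᵐ x ∂(planeMeasure lam), x ∈ quadrant := by
  have h : ∀ᵐ x ∂(lineMeasure lam), x ∈ Ioi (0 : ℝ) := by
    unfold lineMeasure
    exact (withDensity_absolutelyContinuous _ _).ae_le (ae_restrict_mem measurableSet_Ioi)
  have h1 : ∀ᵐ x ∂(planeMeasure lam), x.1 ∈ Ioi (0 : ℝ) := Measure.quasiMeasurePreserving_fst.ae h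
  have h2 : ∀ᵐ x ∂(planeMeasure lam), x.2 ∈ Ioi (0 : ℝ) := Measure.quasiMeasurePreserving_snd.ae h
  filter_upwards [h1, h2] with x h1 h2 using ⟨h1, h2⟩

/-- All squares contain `square 0`, which has positive measure and so forces the constants to agree.
-/
theorem exists_ae_eq_const_of_forall_square {lam : ℝ} (hlam : 0 < lam) {b : ℝ × ℝ → ℂ}
    (hb : ∀ n, ∃ z : ℂ, ∀ᵐ x ∂((planeMeasure lam).restrict (square n)), b x = z) :
    ∃ z : ℂ, ∀ᵐ x ∂(planeMeasure lam), b x = z := by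
  choose z hz using hb
  have hconst : ∀ n, z n = z 0 := fun n => by
    have h1 : ∀ᵐ x ∂((planeMeasure lam).restrict (square 0)), b x = z n :=
      ae_mono (Measure.restrict_mono (square_mono (Nat.zero_le n)) le_rfl) (hz n)
    have hne : (planeMeasure lam).restrict (square 0) ≠ 0 := by
      rw [Ne, Measure.restrict_eq_zero]
      exact ((isRectangle_square 0).measure_ne hlam).1
    have : (ae ((planeMeasure lam).restrict (square 0))).NeBot := ae_neBot.2 hne
    obtain ⟨x, hx1, hx2⟩ := (h1.and (hz 0)).exists
    rw [← hx1, hx2]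
  refine ⟨z 0, ?_⟩
  have h2 : ∀ᵐ x ∂(planeMeasure lam), ∀ n, x ∈ square n → b x = z 0 := by
    rw [ae_all_iff]
    intro n
    rw [← ae_restrict_iff' (isRectangle_square n).measurableSet, ← hconst n]
    exact hz n
  filter_upwards [h2, ae_mem_quadrant lam] with x hx hxq
  exact hx _ (mem_square_squareIndex hxq)

/-- A local representer is determined up to a constant. Prescribing mean zero on `square 0` fixes
it, and the pieces then agree almost everywhere. -/
theorem exists_global_representation {lam : ℝ} (hlam : 0 < lam) {q : ℝ≥0∞} [hq : Fact (1 < q)]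
    (ℓ : LittleHardy lam q →L[ℂ] ℂ) : ∃ b : ℝ × ℝ → ℂ, Measurable b ∧
      (∀ R, IsRectangle R → IntegrableOn b R (planeMeasure lam)) ∧
      ∀ R (hR : IsRectangle R) (f : bddMeanZero lam R),
        ℓ (bddToHardy q hlam hR f) = ∫ x, b x * (f : ℝ × ℝ → ℂ) x ∂(planeMeasure lam) := by
  have hv0 : (planeMeasure lam).real (square 0) ≠ 0 :=
    ENNReal.toReal_ne_zero.2 ((isRectangle_square 0).measure_ne hlam)
  choose b₀ hbm₀ hbi₀ hbr₀ using fun n => exists_representation hlam (isRectangle_square n) ℓ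
  set b₁ : ℕ → ℝ × ℝ → ℂ := fun n x => b₀ n x - ⨍ y in square 0, b₀ n y ∂(planeMeasure lam) with hb₁
  have hbm : ∀ n, Measurable (b₁ n) := fun n => (hbm₀ n).sub_const _
  have hbi : ∀ n, IntegrableOn (b₁ n) (square n) (planeMeasure lam) := fun n =>
    Integrable.sub (hbi₀ n) (integrableOn_const ((isRectangle_square n).measure_ne hlam).2)
  have hbr : ∀ n R (hR : IsRectangle R) (_ : R ⊆ square n) (f : bddMeanZero lam R),
      ℓ (bddToHardy q hlam hR f) = ∫ x, b₁ n x * (f : ℝ × ℝ → ℂ) x ∂(planeMeasure lam) := by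
    intro n R hR hsub f
    have h1 := hbr₀ n ⟨f, bddMeanZero_mono hsub f.2⟩
    have h2 : bddToHardy q hlam (isRectangle_square n) ⟨f, bddMeanZero_mono hsub f.2⟩ =
        bddToHardy q hlam hR f := LittleHardy.toLp_injective rfl
    rw [h2] at h1
    rw [h1]
    simp only [hb₁, sub_mul]
    rw [integral_sub (integrable_mul_of_mem_bddMeanZero ((hbi₀ n).mono_set hsub) f.2)
      (f.2.2.1.const_mul _), integral_const_mul, f.2.2.2.2.2, mul_zero, sub_zero]
  have hav : ∀ n, ⨍ y in square 0, b₁ n y ∂(planeMeasure lam) = 0 := fun n => by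
    rw [setAverage_eq, integral_sub ((hbi₀ n).mono_set (square_mono (Nat.zero_le n)))
      (integrableOn_const ((isRectangle_square 0).measure_ne hlam).2), setIntegral_const,
      setAverage_eq, smul_smul, mul_inv_cancel₀ hv0, one_smul, sub_self, smul_zero]
  have hagree : ∀ m n, m ≤ n →
      ∀ᵐ x ∂(planeMeasure lam), x ∈ square m → b₁ m x = b₁ n x := fun m n hmn => by
    have hsub := square_mono hmn
    have hdi : IntegrableOn (fun x => b₁ m x - b₁ n x) (square m) (planeMeasure lam) :=
      Integrable.sub (hbi m) ((hbi n).mono_set hsub)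
    -- Both functions represent `ℓ` on the smaller square, so their difference annihilates all its
    -- test functions and has no oscillation.
    have hosc : meanOsc lam (fun x => b₁ m x - b₁ n x) (square m) = 0 := by
      rw [← nonpos_iff_eq_zero, ← ENNReal.ofReal_zero]
      refine meanOsc_le_of_forall_bddMeanZero hlam (isRectangle_square m)
        ((hbm m).sub (hbm n)) hdi fun f hf _ => ?_
      have e : ∀ x, (b₁ m - b₁ n) x * f x = b₁ m x * f x - b₁ n x * f x := fun x => sub_mul _ _ _
      simp only [e]
      rw [integral_sub (integrable_mul_of_mem_bddMeanZero (hbi m) hf)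
        (integrable_mul_of_mem_bddMeanZero ((hbi n).mono_set hsub) hf),
        ← hbr m _ (isRectangle_square m) subset_rfl ⟨f, hf⟩,
        ← hbr n _ (isRectangle_square m) hsub ⟨f, hf⟩]
      simp
    have hc : ∀ᵐ x ∂((planeMeasure lam).restrict (square m)), b₁ m x - b₁ n x =
        ⨍ y in square m, (b₁ m y - b₁ n y) ∂(planeMeasure lam) :=
      ae_eq_average_of_meanOsc_eq_zero hlam (isRectangle_square m)
      ((hbm m).sub (hbm n)) hosc
    set z := ⨍ y in square m, (b₁ m y - b₁ n y) ∂(planeMeasure lam) with hz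
    have hz0 : z = 0 := by
      have h1 : ∀ᵐ x ∂((planeMeasure lam).restrict (square 0)), b₁ m x - b₁ n x = z :=
        ae_mono (Measure.restrict_mono (square_mono (Nat.zero_le m)) le_rfl) hc
      have h2 : ⨍ y in square 0, (b₁ m y - b₁ n y) ∂(planeMeasure lam) = 0 := by
        have hm0 := hav m
        have hn0 := hav n
        rw [setAverage_eq] at hm0 hn0 ⊢
        rw [integral_sub ((hbi m).mono_set (square_mono (Nat.zero_le m)))
          ((hbi n).mono_set (square_mono (Nat.zero_le n))), smul_sub, hm0, hn0, sub_zero]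
      rw [setAverage_eq, integral_congr_ae h1, setIntegral_const, smul_smul,
        inv_mul_cancel₀ hv0, one_smul] at h2
      exact h2
    filter_upwards [(ae_restrict_iff' (isRectangle_square m).measurableSet).1 hc] with x hx hxm
    have := hx hxm
    rwa [hz0, sub_eq_zero] at this
  set b : ℝ × ℝ → ℂ := fun x => b₁ (squareIndex x) x with hb
  have hbmeas : Measurable b := by
    have h : Measurable fun p : ℕ × (ℝ × ℝ) => b₁ p.1 p.2 :=
      measurable_from_prod_countable_right fun n => hbm n
    exact h.comp (measurable_squareIndex.prodMk measurable_id)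
  have hbeq : ∀ n, ∀ᵐ x ∂(planeMeasure lam), x ∈ square n → b x = b₁ n x := fun n => by
    have h1 : ∀ᵐ x ∂(planeMeasure lam), ∀ m, m ≤ n → x ∈ square m → b₁ m x = b₁ n x := by
      rw [ae_all_iff]
      intro m
      by_cases hmn : m ≤ n
      · filter_upwards [hagree m n hmn] with x hx _ using hx
      · exact Filter.Eventually.of_forall fun x h => absurd h hmn
    filter_upwards [h1] with x hx hxn
    exact hx _ (squareIndex_le hxn) (mem_square_squareIndex (square_subset_quadrant n hxn))
  refine ⟨b, hbmeas, fun R hR => ?_, fun R hR f => ?_⟩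
  · obtain ⟨n, hn⟩ := hR.exists_subset_square
    refine IntegrableOn.mono_set (t := square n) (Integrable.congr (hbi n) ?_) hn
    rw [Filter.EventuallyEq, ae_restrict_iff' (isRectangle_square n).measurableSet]
    filter_upwards [hbeq n] with x hx hxn
    exact (hx hxn).symm
  · obtain ⟨n, hn⟩ := hR.exists_subset_square
    rw [hbr n R hR hn f]
    refine integral_congr_ae ?_
    filter_upwards [hbeq n] with x hx
    by_cases hxR : x ∈ R
    · rw [hx (hn hxR)]
    · rw [f.2.2.2.1 x hxR, mul_zero, mul_zero]

/-! ### Density of bounded functions and surjectivity -/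

/-- By Hölder, taking the mean does not increase the `L^q` norm on `R`. For `q = ∞` the exponent `1
/ q.toReal` is `1 / 0 = 0`, as it should be. -/
theorem eLpNorm_sub_average_le {lam : ℝ} (hlam : 0 < lam) {R : Set (ℝ × ℝ)} (hR : IsRectangle R)
    {q : ℝ≥0∞} (hq : 1 ≤ q) {h : ℝ × ℝ → ℂ}
    (hm : AEStronglyMeasurable h ((planeMeasure lam).restrict R)) :
    eLpNorm (fun x => h x - ⨍ y in R, h y ∂(planeMeasure lam)) q ((planeMeasure lam).restrict R) ≤
      2 * eLpNorm h q ((planeMeasure lam).restrict R) := by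
  obtain ⟨h0, hi⟩ := hR.measure_ne hlam
  have hq0 : q ≠ 0 := (zero_lt_one.trans_le hq).ne'
  have hv : (planeMeasure lam).real R ≠ 0 := ENNReal.toReal_ne_zero.2 ⟨h0, hi⟩
  have h1 : ‖⨍ y in R, h y ∂(planeMeasure lam)‖ₑ ≤
      (planeMeasure lam R)⁻¹ * (eLpNorm h q ((planeMeasure lam).restrict R) *
        planeMeasure lam R ^ (1 - 1 / q.toReal)) := by
    rw [setAverage_eq, enorm_smul]
    gcongr
    · rw [← ofReal_norm, norm_inv, Real.norm_of_nonneg measureReal_nonneg,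
        ENNReal.ofReal_inv_of_pos (lt_of_le_of_ne measureReal_nonneg hv.symm), Measure.real,
        ENNReal.ofReal_toReal hi]
    · refine (enorm_integral_le_lintegral_enorm _).trans ?_
      rw [← eLpNorm_one_eq_lintegral_enorm]
      refine (eLpNorm_le_eLpNorm_mul_rpow_measure_univ hq hm).trans_eq ?_
      simp
  refine (eLpNorm_sub_le hm aestronglyMeasurable_const hq).trans ?_
  rw [two_mul]
  gcongr
  have hne : (planeMeasure lam).restrict R ≠ 0 := by
    rwa [Ne, Measure.restrict_eq_zero]
  rw [eLpNorm_const _ hq0 hne, Measure.restrict_apply_univ]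
  calc _ ≤ (planeMeasure lam R)⁻¹ * (eLpNorm h q ((planeMeasure lam).restrict R) *
        planeMeasure lam R ^ (1 - 1 / q.toReal)) * planeMeasure lam R ^ (1 / q.toReal) := by
        gcongr
    _ = _ := by
        rw [mul_assoc, mul_assoc, ← ENNReal.rpow_add _ _ h0 hi, sub_add_cancel, ENNReal.rpow_one,
          mul_left_comm, ENNReal.inv_mul_cancel h0 hi, mul_one]

theorem IsAtom.exists_littleHardy {lam : ℝ} {q : ℝ≥0∞} [Fact (1 < q)]
    {a : Lp ℂ 1 (planeMeasure lam)} (ha : IsAtom lam q a) :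
    ∃ u : LittleHardy lam q, u.toLp = a ∧ ‖u‖ ≤ 1 := by
  obtain ⟨h1, ⟨R, hR, hs, hle⟩, h0⟩ := ha
  exact LittleHardy.exists_toLp_eq_of_eLpNorm_le h1 hR hs h0 zero_le_one (by simpa using hle)

/-- For `q = ∞` the atom is itself bounded after a change on a null set. For `q < ∞` simple
functions approximate it in `L^q(R)`; after their mean is removed, the error is a small multiple of
an atom on the same rectangle. -/
theorem exists_norm_sub_bddToHardy_le {lam : ℝ} (hlam : 0 < lam) {q : ℝ≥0∞} [hq : Fact (1 < q)]
    {u : LittleHardy lam q} (hu : IsAtom lam q u.toLp) {ε : ℝ} (hε : 0 < ε) :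
    ∃ (R : Set (ℝ × ℝ)) (hR : IsRectangle R) (f : bddMeanZero lam R),
      ‖u - bddToHardy q hlam hR f‖ ≤ ε := by
  obtain ⟨hmem, ⟨R, hR, hs, -⟩, hint⟩ := hu
  obtain ⟨h0, hi⟩ := hR.measure_ne hlam
  have ham : Measurable u.toLp := (Lp.stronglyMeasurable _).measurable
  by_cases hqt : q = ∞
  · subst hqt
    set K := (eLpNorm u.toLp ∞ (planeMeasure lam)).toReal with hKdef
    have hK : ∀ᵐ x ∂(planeMeasure lam), ‖u.toLp x‖ ≤ K := by
      filter_upwards [ae_le_eLpNormEssSup (f := u.toLp) (μ := planeMeasure lam)] with x hx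
      rw [hKdef, ← toReal_enorm]
      exact ENNReal.toReal_mono hmem.2.ne (by simpa using hx)
    set f : ℝ × ℝ → ℂ := (R ∩ {x | ‖u.toLp x‖ ≤ K}).indicator u.toLp with hf
    have hae : f =ᵐ[planeMeasure lam] u.toLp := by
      filter_upwards [hK, hs] with x hx hxs
      by_cases hxR : x ∈ R
      · exact indicator_of_mem (show x ∈ R ∩ {x | ‖u.toLp x‖ ≤ K} from ⟨hxR, hx⟩) _
      · rw [hf, indicator_of_notMem (fun h => hxR h.1), hxs hxR]
    have hfmem : f ∈ bddMeanZero lam R := by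
      refine mem_bddMeanZero_of_bound (K := K) hi
        (ham.indicator (hR.measurableSet.inter (measurableSet_le ham.norm measurable_const)))
        (fun x hx => indicator_of_notMem (fun h => hx h.1) _) (fun x => ?_) ?_
      · by_cases hx : x ∈ R ∩ {x | ‖u.toLp x‖ ≤ K}
        · rw [hf, indicator_of_mem hx]; exact hx.2
        · rw [hf, indicator_of_notMem hx, norm_zero]; exact ENNReal.toReal_nonneg
      · rw [integral_congr_ae hae, hint]
    refine ⟨R, hR, ⟨f, hfmem⟩, ?_⟩
    have : u = bddToHardy ∞ hlam hR ⟨f, hfmem⟩ := by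
      apply LittleHardy.toLp_injective
      refine Lp.ext ?_
      filter_upwards [hae, bddToHardy_ae_eq ∞ hlam hR ⟨f, hfmem⟩] with x h1 h2
      rw [h2, ← h1]
    rw [← this, sub_self, norm_zero]
    exact hε.le
  · set B : ℝ≥0∞ := planeMeasure lam R ^ ((q⁻¹).toReal - 1) with hB
    -- Half of `ε`, because removing the mean may double the `L^q` error.
    have hB0 : ENNReal.ofReal (ε / 2) * B ≠ 0 := by
      refine mul_ne_zero (by simpa using hε) ?_
      rw [hB, Ne, ENNReal.rpow_eq_zero_iff]
      rintro (h | h)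
      · exact h0 h.1
      · exact hi h.1
    obtain ⟨g, hg, hgmem⟩ := (hmem.restrict R).exists_simpleFunc_eLpNorm_sub_lt hqt hB0
    obtain ⟨K, hK⟩ := g.exists_forall_norm_le
    obtain ⟨hfm, -⟩ := indicator_sub_average_mem hlam hR g.measurable hK
    refine ⟨R, hR, ⟨_, hfm⟩, ?_⟩
    set f : bddMeanZero lam R := ⟨_, hfm⟩ with hf
    set d := u - bddToHardy q hlam hR f with hd
    have hgi : IntegrableOn g R (planeMeasure lam) :=
      Measure.integrableOn_of_bounded (M := K) hi g.measurable.aestronglyMeasurable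
        (Filter.Eventually.of_forall hK)
    have hai : Integrable u.toLp (planeMeasure lam) := L1.integrable_coeFn _
    have hav : ⨍ y in R, ((u.toLp : ℝ × ℝ → ℂ) - g) y ∂(planeMeasure lam) =
        - ⨍ y in R, g y ∂(planeMeasure lam) := by
      have e : ∫ y in R, u.toLp y ∂(planeMeasure lam) = 0 := by
        rw [← hint, ← integral_indicator hR.measurableSet]
        refine integral_congr_ae ?_
        filter_upwards [hs] with x hx
        by_cases hxR : x ∈ R
        · simp [hxR]
        · simp [hxR, hx hxR]
      rw [setAverage_eq, setAverage_eq]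
      simp only [Pi.sub_apply]
      rw [integral_sub hai.integrableOn hgi, e, zero_sub, smul_neg]
    have hdae : (d.toLp : ℝ × ℝ → ℂ) =ᵐ[planeMeasure lam] R.indicator fun x =>
        ((u.toLp : ℝ × ℝ → ℂ) - g) x -
          ⨍ y in R, ((u.toLp : ℝ × ℝ → ℂ) - g) y ∂(planeMeasure lam) := by
      have h1 : d.toLp = u.toLp - (bddToHardy q hlam hR f).toLp := rfl
      rw [h1]
      filter_upwards [Lp.coeFn_sub u.toLp (bddToHardy q hlam hR f).toLp,
        bddToHardy_ae_eq q hlam hR f, hs] with x h2 h3 h4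
      rw [h2, Pi.sub_apply, h3, hav]
      by_cases hxR : x ∈ R
      · simp [hf, hxR]; ring
      · simp [hf, hxR, h4 hxR]
    have hle : eLpNorm d.toLp q (planeMeasure lam) ≤ ENNReal.ofReal ε * B := by
      rw [eLpNorm_congr_ae hdae, eLpNorm_indicator_eq_eLpNorm_restrict hR.measurableSet]
      refine (eLpNorm_sub_average_le hlam hR hq.out.le
        (ham.sub g.measurable).aestronglyMeasurable).trans ?_
      refine (mul_le_mul_right hg.le 2).trans_eq ?_
      rw [← mul_assoc, ← ENNReal.ofReal_ofNat 2, ← ENNReal.ofReal_mul (by norm_num)]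
      congr 2
      ring
    have hBt : B ≠ ∞ := ENNReal.rpow_ne_top_of_ne_zero h0 hi
    have hds : ∀ᵐ x ∂(planeMeasure lam), x ∉ R → d.toLp x = 0 := by
      filter_upwards [hdae] with x hx hxR
      rw [hx, indicator_of_notMem hxR]
    have hd0 : ∫ x, d.toLp x ∂(planeMeasure lam) = 0 := by
      have h1 : d.toLp = u.toLp - (bddToHardy q hlam hR f).toLp := rfl
      rw [h1, integral_congr_ae (Lp.coeFn_sub _ _)]
      simp only [Pi.sub_apply]
      rw [integral_sub hai (L1.integrable_coeFn _), hint,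
        integral_congr_ae (bddToHardy_ae_eq q hlam hR f), f.2.2.2.2.2, sub_zero]
    obtain ⟨w, hw, hwn⟩ := LittleHardy.exists_toLp_eq_of_eLpNorm_le (q := q) (f := d.toLp)
      ⟨Lp.aestronglyMeasurable _, hle.trans_lt (ENNReal.mul_lt_top ENNReal.ofReal_lt_top
        hBt.lt_top)⟩ hR hds hd0 hε.le hle
    rwa [LittleHardy.toLp_injective hw] at hwn

/-- The series converges absolutely in the complete Hardy space, and its sum there has the same `L¹`
limit. Continuous functionals may therefore be applied term by term. -/
theorem LittleHardy.hasSum_of_decomposition {lam : ℝ} {q : ℝ≥0∞} [hq : Fact (1 < q)]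
    {f : LittleHardy lam q} {α : ℕ → ℂ} {u : ℕ → LittleHardy lam q} (hu : ∀ i, ‖u i‖ ≤ 1)
    (hd : IsAtomicDecomposition lam q f.toLp α fun i => (u i).toLp) :
    HasSum (fun i => α i • u i) f := by
  have := LittleHardy.completeSpace lam q
  have hs : Summable fun i => α i • u i := by
    refine Summable.of_norm_bounded hd.summable fun i => ?_
    rw [norm_smul]
    exact mul_le_of_le_one_right (norm_nonneg _) (hu i)
  have h1 := (LittleHardy.toLpCLM lam q).hasSum hs.hasSum
  have h2 : f = ∑' i, α i • u i := by
    apply LittleHardy.toLp_injective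
    refine hd.hasSum.unique (h1.congr_fun ?_)
    intro i
    simp only [map_smul, LittleHardy.toLpCLM_apply]
  rw [h2]
  exact hs.hasSum

/-- Bounded functions approximate atoms in the Hardy norm, and atomic series converge in that norm.
-/
theorem eq_of_forall_bddToHardy {lam : ℝ} (hlam : 0 < lam) {q : ℝ≥0∞} [hq : Fact (1 < q)]
    {ℓ ℓ' : LittleHardy lam q →L[ℂ] ℂ}
    (h : ∀ R (hR : IsRectangle R) (f : bddMeanZero lam R),
      ℓ (bddToHardy q hlam hR f) = ℓ' (bddToHardy q hlam hR f)) : ℓ = ℓ' := by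
  have hatom : ∀ u : LittleHardy lam q, IsAtom lam q u.toLp → ℓ u = ℓ' u := fun u hu => by
    rw [← sub_eq_zero, ← norm_le_zero_iff]
    refine le_of_forall_pos_le_add fun ε hε => ?_
    have hC : 0 < ‖ℓ - ℓ'‖ + 1 := by positivity
    obtain ⟨R, hR, f, hf⟩ := exists_norm_sub_bddToHardy_le hlam hu (div_pos hε hC)
    have h1 : ℓ u - ℓ' u = (ℓ - ℓ') (u - bddToHardy q hlam hR f) := by
      rw [map_sub, sub_apply, sub_apply, h R hR f,
        sub_self, sub_zero]
    rw [h1, zero_add]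
    calc _ ≤ ‖ℓ - ℓ'‖ * (ε / (‖ℓ - ℓ'‖ + 1)) := ((ℓ - ℓ').le_opNorm _).trans (by gcongr)
      _ ≤ ε := by
        rw [mul_div_assoc', div_le_iff₀ hC]
        nlinarith [norm_nonneg (ℓ - ℓ')]
  ext f
  obtain ⟨α, a, hd⟩ := f.mem
  choose u hu hu1 using fun i => (hd.isAtom i).exists_littleHardy
  obtain rfl : (fun i => (u i).toLp) = a := funext hu
  have hs := LittleHardy.hasSum_of_decomposition hu1 hd
  refine (ℓ.hasSum hs).unique ((ℓ'.hasSum hs).congr_fun fun i => ?_)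
  simp only [map_smul]
  rw [hatom (u i) (hd.isAtom i)]

theorem dualityMap_surjective {lam : ℝ} (hlam : 0 < lam) (q : ℝ≥0∞) [hq : Fact (1 < q)] :
    Function.Surjective (dualityMap hlam q) := by
  intro ℓ
  obtain ⟨b, hbm, hbi, hbr⟩ := exists_global_representation hlam ℓ
  have hmem : MemBMO lam b := by
    refine ⟨fun x hx => ⟨square (squareIndex x), mem_nhdsWithin_of_mem_nhds
      ((isOpen_Ioo.prod isOpen_Ioo).mem_nhds (mem_square_squareIndex hx)),
      hbi _ (isRectangle_square _)⟩, ?_⟩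
    exact (bmoNorm_le_of_forall_bddMeanZero hlam hbm hbi ℓ hbr).trans_lt ENNReal.ofReal_lt_top
  have hae := AEEqFun.coeFn_mk b hbm.aestronglyMeasurable (μ := planeMeasure lam)
  let B : LittleBMO lam :=
    ⟨AEEqFun.mk b hbm.aestronglyMeasurable, memBMO_congr hae.symm hmem⟩
  refine ⟨B, eq_of_forall_bddToHardy hlam fun R hR f => ?_⟩
  rw [dualityMap_bddToHardy hlam q B hR f, hbr R hR f]
  refine integral_congr_ae ?_
  filter_upwards [hae] with x hx
  exact congrArg (· * _) hx

/-- Vanishing oscillation makes `b` constant on each square of an exhaustion; conversely, the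
oscillation may be tested against the constant. -/
theorem norm_littleBMO_eq_zero_iff {lam : ℝ} (hlam : 0 < lam) (b : LittleBMO lam) :
    ‖b‖ = 0 ↔ ∃ c : ℂ, ∀ᵐ x ∂(planeMeasure lam), b x = c := by
  constructor
  · intro h
    refine exists_ae_eq_const_of_forall_square hlam fun n =>
      ⟨_, ae_eq_average_of_meanOsc_eq_zero hlam (isRectangle_square n) b.measurable ?_⟩
    simpa using b.meanOsc_le h.le (isRectangle_square n)
  · rintro ⟨z, hz⟩
    have h0 : bmoNorm lam b = 0 := by
      rw [← nonpos_iff_eq_zero]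
      refine iSup₂_le fun R hR => ?_
      refine (meanOsc_le_two_mul hlam hR (b.integrableOn hlam hR) z).trans_eq ?_
      rw [lintegral_congr_ae (g := fun _ => 0) (by
        filter_upwards [ae_restrict_of_ae hz] with x hx
        rw [hx, sub_self, enorm_zero]), lintegral_zero, mul_zero, mul_zero]
    rw [LittleBMO.norm_def, h0, ENNReal.toReal_zero]

end Bessel

end

theorem mainTheorem7 (lam : ℝ) (hlam : 0 < lam) (q : ℝ≥0∞) [Fact (1 < q)] :
    CompleteSpace (Bessel.LittleHardy lam q) ∧
    ∃ Φ : Bessel.LittleBMO lam →ₗ[ℂ] (Bessel.LittleHardy lam q →L[ℂ] ℂ),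
      (∀ (b : Bessel.LittleBMO lam) (f : Bessel.LittleHardy lam q),
        f.toLp ∈ Submodule.span ℂ {a | Bessel.IsAtom lam q a} →
          Integrable (fun x => b x * f.toLp x) (Bessel.planeMeasure lam) ∧
          Φ b f = ∫ x, b x * f.toLp x ∂(Bessel.planeMeasure lam)) ∧
      Function.Surjective Φ ∧
      (∀ b : Bessel.LittleBMO lam,
        Φ b = 0 ↔ ∃ c : ℂ, ∀ᵐ x ∂(Bessel.planeMeasure lam), b x = c) ∧
      ∃ C : ℝ, 0 < C ∧ ∀ b : Bessel.LittleBMO lam, C⁻¹ * ‖b‖ ≤ ‖Φ b‖ ∧ ‖Φ b‖ ≤ C * ‖b‖ := by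
  obtain ⟨K, hK, hbound⟩ := Bessel.exists_norm_dualityMap_le hlam q
  have hlow := Bessel.norm_le_dualityMap hlam q
  refine ⟨Bessel.LittleHardy.completeSpace lam q, Bessel.dualityMap hlam q, fun b f hf => ?_,
    -- `K + 2` dominates both the upper constant `K` and the lower constant 2.
    Bessel.dualityMap_surjective hlam q, fun b => ?_, K + 2, by positivity, fun b => ⟨?_, ?_⟩⟩
  · have h := Bessel.integrable_mul_of_mem_span hlam Fact.out b hf
    exact ⟨h, Bessel.pairing_eq_integral hlam b h⟩
  · rw [← Bessel.norm_littleBMO_eq_zero_iff hlam b, ← norm_eq_zero]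
    have h1 := hbound b
    have h2 := hlow b
    constructor <;> intro h
    · rw [h, mul_zero] at h2
      exact le_antisymm h2 (norm_nonneg _)
    · rw [h, mul_zero] at h1
      exact le_antisymm h1 (norm_nonneg _)
  · rw [inv_mul_le_iff₀ (by positivity)]
    have h2 := hlow b
    nlinarith [norm_nonneg (Bessel.dualityMap hlam q b)]
  · have h1 := hbound b
    nlinarith [norm_nonneg b]
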